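/- Let $\hat{\mathbb C}=\mathbb C\cup\{\infty\}$ be the Riemann sphere, let $\mathrm{Rat}_1\cong \mathrm{PSL}_2(\mathbb C)$ be the group of Möbius transformations, and let $\mathrm{Rat}_2$ be the space of rational maps $f:\hat{\mathbb C}\to\hat{\mathbb C}$ of degree two, viewed through its coefficients as an open subset of $\mathbb{CP}^5$. Let $\mathrm{Rat}_2^{\rm fm}\subset \mathrm{Rat}_2\times\hat{\mathbb C}^3$ be the space of all $(f,z_1,z_2,z_3)$ such that $z_1,z_2,z_3$ are the fixed points of $f$, listed with multiplicity, and let $\mathrm{Rat}_2^{\rm tm}\subset \mathrm{Rat}_2\times\hat{\mathbb C}^3\times\hat{\mathbb C}^2$ be the space of all $(f,z_1,z_2,z_3,\omega_1,\omega_2)$ such that moreover $\omega_1\neq\omega_2$ are the two critical points of $f$. Both carry the topology and the holomorphic functions induced from the ambient space (a function is holomorphic if it is locally the restriction of a holomorphic function). The group $\mathrm{Rat}_1$ acts on both by conjugation, $g\cdot(f,z_i,\omega_j)=(g\circ f\circ g^{-1},g(z_i),g(\omega_j))$. Let $\mathcal M_2^{\rm fm}$ and $\mathcal M_2^{\rm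 tm}$ be the quotient spaces, with the quotient topology, where a function is called holomorphic if its pullback to $\mathrm{Rat}_2^{\rm fm}$, respectively $\mathrm{Rat}_2^{\rm tm}$, is holomorphic. Then: 1. $\mathrm{Rat}_2^{\rm fm}$ and $\mathrm{Rat}_2^{\rm tm}$ are smooth complex manifolds of dimension $5$, and the map $\mathrm{Rat}_2^{\rm tm}\to\mathrm{Rat}_2^{\rm fm}$ forgetting $\omega_1,\omega_2$ is an unramified (locally biholomorphic) two-sheeted covering. 2. The action of $\mathrm{Rat}_1$ on $\mathrm{Rat}_2^{\rm tm}$ is free, and the quotient $\mathcal M_2^{\rm tm}$ is a smooth complex manifold of dimension $2$. 3. The action of $\mathrm{Rat}_1$ on $\mathrm{Rat}_2^{\rm fm}$ has exactly one non-free orbit, namely that of $(f_0,\infty,\infty,\infty)$, where $f_0(z)=z+z^{-1}$ has a triple fixed point at infinity. 4. The space $\mathcal M_2^{\rm fm}$ is Hausdorff and second countable and has exactly one singular point, namely the class $m_0$ of $(f_0,\infty,\infty,\infty)$: every point other than $m_0$ has a neighborhood biholomorphic to an open subset of $\mathbb C^2$, while $m_0$ has no such neighborhood. The singularity at $m_0$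 is of type $(2,2,2)$: a neighborhood of $m_0$ is biholomorphic to a neighborhood of the origin in the surface $\{z_1^2+z_2^2+z_3^2=0\}\subset\mathbb C^3$, with $m_0$ corresponding to the origin. -/

import Mathlib

open scoped Topology Manifold ContDiff OnePoint

noncomputable section

namespace QuadRat

/-! ### The Riemann sphere `OnePoint ℂ` in homogeneous coordinates -/

/-- The point `[v 0 : v 1]`, that is `v 0 / v 1`, of the Riemann sphere (meaningful for `v ≠ 0`). -/
def proj (v : Fin 2 → ℂ) : OnePoint ℂ := if v 1 = 0 then ∞ else ((v 0 / v 1 : ℂ) : OnePoint ℂ)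

/-- The standard homogeneous coordinates: `[z : 1]` for `z ∈ ℂ` and `[1 : 0]` for `∞`. -/
def hc (z : OnePoint ℂ) : Fin 2 → ℂ := z.elim ![1, 0] (fun t => ![t, 1])

/-- `v` is a vector of homogeneous coordinates of `z`. -/
def IsHom (v : Fin 2 → ℂ) (z : OnePoint ℂ) : Prop := v ≠ 0 ∧ proj v = z

/-- The area form on `ℂ²`; for a fixed `w ≠ 0`, the linear form `v ↦ wedge v w` vanishes exactly
at the multiples of `w`. -/
def wedge (v w : Fin 2 → ℂ) : ℂ := v 0 * w 1 - v 1 * w 0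

/-- The group of Möbius transformations, as a group of permutations of the Riemann sphere. -/
def Rat1 : Subgroup (Equiv.Perm (OnePoint ℂ)) :=
  (MulAction.toPermHom (GL (Fin 2) ℂ) (OnePoint ℂ)).range

/-! ### Quadratic rational maps -/

/-- The coefficients of a pair of binary quadratic forms. -/
abbrev Coef := Fin 2 → Fin 3 → ℂ

/-- The homogeneous quadratic map of `ℂ²` with coefficients `c`. -/
def quadForm (c : Coef) (v : Fin 2 → ℂ) : Fin 2 → ℂ :=
  fun i => c i 0 * v 0 ^ 2 + c i 1 * (v 0 * v 1) + c i 2 * v 1 ^ 2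

/-- The two quadratic forms have no common zero on the Riemann sphere, so that their quotient is
a rational map of degree exactly two. -/
def Nondeg (c : Coef) : Prop := ∀ v, v ≠ 0 → quadForm c v ≠ 0

/-- The self-map `z ↦ (c₀₀ z² + c₀₁ z + c₀₂) / (c₁₀ z² + c₁₁ z + c₁₂)` of the Riemann sphere. -/
def ratMap (c : Coef) (z : OnePoint ℂ) : OnePoint ℂ := proj (quadForm c (hc z))

/-- `c` is a vector of homogeneous coordinates (coefficients) of the quadratic rational map `f`. -/
def Represents (c : Coef) (f : OnePoint ℂ → OnePoint ℂ) : Prop := Nondeg c ∧ ratMap c = f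

/-- The space of quadratic rational maps of the Riemann sphere. -/
def Rat2 := {f : OnePoint ℂ → OnePoint ℂ // ∃ c, Represents c f}

/-- The quadratic rational map with coefficients `c`. -/
def Rat2.ofCoef (c : {c : Coef // Nondeg c}) : Rat2 := ⟨ratMap c.1, c.1, c.2, rfl⟩

/-- The topology of `Rat2` is the quotient topology from the coefficients, that is, the topology
of an open subset of complex projective 5-space. -/
instance : TopologicalSpace Rat2 := TopologicalSpace.coinduced Rat2.ofCoef inferInstance

/-- `z 0, z 1, z 2` is the list of the fixed points of `f`, each repeated according to its
multiplicity: the binary cubic form `v ↦ wedge v (F v)` (for a homogeneous lift `F` of `f`), whose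
zeros are the fixed points, is a nonzero multiple of the product of the linear forms
vanishing at the `z i`. -/
def IsFixedMarking (f : OnePoint ℂ → OnePoint ℂ) (z : Fin 3 → OnePoint ℂ) : Prop :=
  ∃ c, Represents c f ∧ ∃ k : ℂ, k ≠ 0 ∧
    ∀ v, wedge v (quadForm c v) = k * ∏ i, wedge v (hc (z i))

/-- `p` is a critical point of `f`: the differential at `p` of a homogeneous lift of `f` to `ℂ²` is
singular. (A lift `F` satisfies `DF_v v = 2 F v ≠ 0`, so this says that the induced map from
`ℂ² / ℂ v` to `ℂ² / ℂ (F v)`, which is the derivative of `f` up to a nonzero factor, is zero.) -/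
def IsCritical (f : OnePoint ℂ → OnePoint ℂ) (p : OnePoint ℂ) : Prop :=
  ∃ c, Represents c f ∧ (fderiv ℂ (quadForm c) (hc p)).det = 0

/-- `w 0` and `w 1` are the two distinct critical points of `f`. -/
def IsCriticalMarking (f : OnePoint ℂ → OnePoint ℂ) (w : Fin 2 → OnePoint ℂ) : Prop :=
  w 0 ≠ w 1 ∧ ∀ p, IsCritical f p ↔ p = w 0 ∨ p = w 1

/-- The space of fixed point marked quadratic rational maps `(f, z₁, z₂, z₃)`, with the
subspace topology. -/
abbrev Rat2fm := {x : Rat2 × (Fin 3 → OnePoint ℂ) // IsFixedMarking x.1.1 x.2}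

/-- The space of totally marked quadratic rational maps `(f, z₁, z₂, z₃, ω₁, ω₂)`, with the
subspace topology. -/
abbrev Rat2tm := {x : Rat2 × (Fin 3 → OnePoint ℂ) × (Fin 2 → OnePoint ℂ) //
  IsFixedMarking x.1.1 x.2.1 ∧ IsCriticalMarking x.1.1 x.2.2}

/-- The projection forgetting the marking of the critical points. -/
def forget (x : Rat2tm) : Rat2fm := ⟨(x.1.1, x.1.2.1), x.2.1⟩

/-! ### Conjugation by Möbius transformations -/

lemma hc_ne_zero (z : OnePoint ℂ) : hc z ≠ 0 := by
  intro h
  induction z using OnePoint.rec with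
  | infty => simpa [hc] using congrFun h 0
  | coe t => simpa [hc] using congrFun h 1

lemma proj_hc (z : OnePoint ℂ) : proj (hc z) = z := by
  induction z using OnePoint.rec <;> simp [hc, proj]

lemma proj_smul {a : ℂ} (ha : a ≠ 0) (v : Fin 2 → ℂ) : proj (a • v) = proj v := by
  simp only [proj, Pi.smul_apply, smul_eq_mul, mul_eq_zero, ha, false_or, mul_div_mul_left _ _ ha]

lemma exists_smul_hc {v : Fin 2 → ℂ} (hv : v ≠ 0) : ∃ a : ℂ, a ≠ 0 ∧ v = a • hc (proj v) := by
  by_cases h : v 1 = 0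
  · refine ⟨v 0, fun h0 => hv ?_, ?_⟩
    · ext i; fin_cases i <;> simp [h, h0]
    · ext i; fin_cases i <;> simp [hc, proj, h]
  · refine ⟨v 1, h, ?_⟩
    ext i
    fin_cases i
    · simp [hc, proj, h]; field_simp
    · simp [hc, proj, h]

lemma mulVec_ne_zero (g : GL (Fin 2) ℂ) {v : Fin 2 → ℂ} (hv : v ≠ 0) :
    g.1.mulVec v ≠ 0 := by
  intro h
  apply hv
  have : (g⁻¹).1.mulVec (g.1.mulVec v) = v := by
    rw [Matrix.mulVec_mulVec, ← Units.val_mul, inv_mul_cancel, Units.val_one, Matrix.one_mulVec]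
  rw [← this, h, Matrix.mulVec_zero]

lemma smul_eq_proj (g : GL (Fin 2) ℂ) (z : OnePoint ℂ) : g • z = proj (g.1.mulVec (hc z)) := by
  induction z using OnePoint.rec with
  | infty => simp [OnePoint.smul_infty_eq_ite, proj, hc]
  | coe t => simp [OnePoint.smul_some_eq_ite, proj, hc]

lemma smul_proj (g : GL (Fin 2) ℂ) {v : Fin 2 → ℂ} (hv : v ≠ 0) :
    g • proj v = proj (g.1.mulVec v) := by
  obtain ⟨a, ha, h⟩ := exists_smul_hc hv
  conv_rhs => rw [h, Matrix.mulVec_smul, proj_smul ha]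
  rw [smul_eq_proj]

lemma quadForm_smul (c : Coef) (a : ℂ) (v : Fin 2 → ℂ) :
    quadForm c (a • v) = a ^ 2 • quadForm c v := by
  ext i; simp [quadForm]; ring

lemma ratMap_proj (c : Coef) {v : Fin 2 → ℂ} (hv : v ≠ 0) :
    ratMap c (proj v) = proj (quadForm c v) := by
  obtain ⟨a, ha, h⟩ := exists_smul_hc hv
  conv_rhs => rw [h, quadForm_smul, proj_smul (pow_ne_zero 2 ha)]
  rfl

/-- The coefficients of `A ∘ F ∘ B`, where `F` has coefficients `c`. -/
def conjCoef (A B : Matrix (Fin 2) (Fin 2) ℂ) (c : Coef) : Coef := fun j =>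
  ![∑ i, A j i * (c i 0 * B 0 0 ^ 2 + c i 1 * (B 0 0 * B 1 0) + c i 2 * B 1 0 ^ 2),
    ∑ i, A j i * (2 * c i 0 * (B 0 0 * B 0 1) + c i 1 * (B 0 0 * B 1 1 + B 0 1 * B 1 0)
      + 2 * c i 2 * (B 1 0 * B 1 1)),
    ∑ i, A j i * (c i 0 * B 0 1 ^ 2 + c i 1 * (B 0 1 * B 1 1) + c i 2 * B 1 1 ^ 2)]

lemma quadForm_conjCoef (A B : Matrix (Fin 2) (Fin 2) ℂ) (c : Coef) (v : Fin 2 → ℂ) :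
    quadForm (conjCoef A B c) v = A.mulVec (quadForm c (B.mulVec v)) := by
  ext i
  fin_cases i <;> simp [quadForm, conjCoef] <;> ring

lemma represents_conj (g : GL (Fin 2) ℂ) {c : Coef} {f : OnePoint ℂ → OnePoint ℂ}
    (h : Represents c f) :
    Represents (conjCoef g.1 (g⁻¹).1 c) (fun z => g • f (g⁻¹ • z)) := by
  refine ⟨fun v hv => ?_, funext fun z => ?_⟩
  · rw [quadForm_conjCoef]
    exact mulVec_ne_zero g (h.1 _ (mulVec_ne_zero _ hv))
  · have h1 := mulVec_ne_zero g⁻¹ (hc_ne_zero z)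
    rw [ratMap, quadForm_conjCoef, ← h.2, smul_eq_proj g⁻¹ z, ratMap_proj c h1,
      smul_proj g (h.1 _ h1)]

lemma wedge_mulVec (A : Matrix (Fin 2) (Fin 2) ℂ) (v w : Fin 2 → ℂ) :
    wedge (A.mulVec v) (A.mulVec w) = A.det * wedge v w := by
  simp [wedge, Matrix.det_fin_two]; ring

lemma exists_smul_hc_smul (g : GL (Fin 2) ℂ) (z : OnePoint ℂ) :
    ∃ a : ℂ, a ≠ 0 ∧ g.1.mulVec (hc z) = a • hc (g • z) := by
  rw [smul_eq_proj]
  exact exists_smul_hc (mulVec_ne_zero g (hc_ne_zero z))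

lemma wedge_smul_right (v w : Fin 2 → ℂ) (a : ℂ) : wedge v (a • w) = a * wedge v w := by
  simp [wedge]; ring

lemma isFixedMarking_conj (g : GL (Fin 2) ℂ) {f : OnePoint ℂ → OnePoint ℂ}
    {z : Fin 3 → OnePoint ℂ} (h : IsFixedMarking f z) :
    IsFixedMarking (fun x => g • f (g⁻¹ • x)) (fun i => g • z i) := by
  obtain ⟨c, hc', k, hk, hkv⟩ := h
  choose a ha haz using fun i => exists_smul_hc_smul g (z i)
  have hd : g.1.det ≠ 0 := g.det_ne_zero
  have hd' : (g⁻¹).1.det ≠ 0 := (g⁻¹).det_ne_zero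
  refine ⟨_, represents_conj g hc', g.1.det * k * ∏ i, ((g⁻¹).1.det * a i), ?_, fun v => ?_⟩
  · exact mul_ne_zero (mul_ne_zero hd hk)
      (Finset.prod_ne_zero_iff.2 fun i _ => mul_ne_zero hd' (ha i))
  · have hv : v = g.1.mulVec ((g⁻¹).1.mulVec v) := by
      rw [Matrix.mulVec_mulVec, ← Units.val_mul, mul_inv_cancel, Units.val_one, Matrix.one_mulVec]
    have hz : ∀ i, wedge ((g⁻¹).1.mulVec v) (hc (z i)) =
        (g⁻¹).1.det * a i * wedge v (hc (g • z i)) := fun i => by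
      have : hc (z i) = (g⁻¹).1.mulVec (a i • hc (g • z i)) := by
        rw [← haz i, Matrix.mulVec_mulVec, ← Units.val_mul, inv_mul_cancel, Units.val_one,
          Matrix.one_mulVec]
      rw [this, wedge_mulVec, wedge_smul_right, mul_assoc]
    rw [quadForm_conjCoef]
    conv_lhs => rw [hv]
    rw [wedge_mulVec, ← hv, hkv]
    simp_rw [hz]
    rw [Finset.prod_mul_distrib]
    ring

lemma det_fderiv_quadForm (c : Coef) (v : Fin 2 → ℂ) :
    (fderiv ℂ (quadForm c) v).det =
      (2 * c 0 0 * v 0 + c 0 1 * v 1) * (c 1 1 * v 0 + 2 * c 1 2 * v 1) -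
      (c 0 1 * v 0 + 2 * c 0 2 * v 1) * (2 * c 1 0 * v 0 + c 1 1 * v 1) := by
  have hd : HasFDerivAt (quadForm c)
      (LinearMap.toContinuousLinearMap (Matrix.toLin'
        !![2 * c 0 0 * v 0 + c 0 1 * v 1, c 0 1 * v 0 + 2 * c 0 2 * v 1;
           2 * c 1 0 * v 0 + c 1 1 * v 1, c 1 1 * v 0 + 2 * c 1 2 * v 1])) v := by
    rw [hasFDerivAt_pi']
    intro i
    have h0 : HasFDerivAt (fun v : Fin 2 → ℂ => v 0)
      (ContinuousLinearMap.proj 0 : (Fin 2 → ℂ) →L[ℂ] ℂ) v := hasFDerivAt_apply 0 v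
    have h1 : HasFDerivAt (fun v : Fin 2 → ℂ => v 1)
      (ContinuousLinearMap.proj 1 : (Fin 2 → ℂ) →L[ℂ] ℂ) v := hasFDerivAt_apply 1 v
    have := ((((h0.mul h0).const_mul (c i 0)).add ((h0.mul h1).const_mul (c i 1))).add
      ((h1.mul h1).const_mul (c i 2)))
    convert this using 1
    · funext w; simp [quadForm]; ring
    · ext w; fin_cases i <;> simp [Matrix.vecHead, Matrix.vecTail] <;> ring
  rw [hd.fderiv, ContinuousLinearMap.det, LinearMap.coe_toContinuousLinearMap,
    LinearMap.det_toLin', Matrix.det_fin_two_of]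

lemma isCritical_conj (g : GL (Fin 2) ℂ) {f : OnePoint ℂ → OnePoint ℂ}
    {p : OnePoint ℂ} (h : IsCritical f p) :
    IsCritical (fun x => g • f (g⁻¹ • x)) (g • p) := by
  obtain ⟨c, hr, hdet⟩ := h
  obtain ⟨a, ha, hap⟩ := exists_smul_hc_smul g p
  refine ⟨_, represents_conj g hr, ?_⟩
  have hp : hc (g • p) = a⁻¹ • g.1.mulVec (hc p) := by
    rw [hap, smul_smul, inv_mul_cancel₀ ha, one_smul]
  have hB : (g⁻¹).1.mulVec (hc (g • p)) = a⁻¹ • hc p := by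
    rw [hp, Matrix.mulVec_smul, Matrix.mulVec_mulVec, ← Units.val_mul, inv_mul_cancel,
      Units.val_one, Matrix.one_mulVec]
  have key : ∀ (A B : Matrix (Fin 2) (Fin 2) ℂ) (v : Fin 2 → ℂ),
      (fderiv ℂ (quadForm (conjCoef A B c)) v).det =
        A.det * B.det * (fderiv ℂ (quadForm c) (B.mulVec v)).det := by
    intro A B v
    simp [det_fderiv_quadForm, conjCoef, Matrix.det_fin_two]
    ring
  have hs : (fderiv ℂ (quadForm c) (a⁻¹ • hc p)).det =
      a⁻¹ ^ 2 * (fderiv ℂ (quadForm c) (hc p)).det := by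
    simp only [det_fderiv_quadForm, Pi.smul_apply, smul_eq_mul]
    ring
  rw [key, hB, hs, hdet]
  ring

lemma isCriticalMarking_conj (g : GL (Fin 2) ℂ) {f : OnePoint ℂ → OnePoint ℂ}
    {w : Fin 2 → OnePoint ℂ} (h : IsCriticalMarking f w) :
    IsCriticalMarking (fun x => g • f (g⁻¹ • x)) (fun i => g • w i) := by
  refine ⟨fun h' => h.1 (MulAction.injective g h'), fun p => ?_⟩
  have : IsCritical (fun x => g • f (g⁻¹ • x)) p ↔ IsCritical f (g⁻¹ • p) := by
    constructor
    · intro hp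
      simpa using isCritical_conj g⁻¹ hp
    · intro hp
      simpa using isCritical_conj g hp
  rw [this, h.2, inv_smul_eq_iff, inv_smul_eq_iff]

/-- Möbius transformations act on quadratic rational maps by `g • f = g ∘ f ∘ g⁻¹`. -/
instance : MulAction Rat1 Rat2 where
  smul g f := ⟨fun z => g.1 (f.1 (g.1⁻¹ z)), by
    obtain ⟨_, g, rfl⟩ := g
    obtain ⟨f, c, hf⟩ := f
    exact ⟨_, represents_conj g hf⟩⟩
  one_smul _ := rfl
  mul_smul _ _ _ := rfl

/-- The conjugation action `g • (f, z) = (g ∘ f ∘ g⁻¹, g z)` on fixed point marked maps. -/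
instance : MulAction Rat1 Rat2fm where
  smul g x := ⟨(g • x.1.1, fun i => g.1 (x.1.2 i)), by
    obtain ⟨_, g, rfl⟩ := g
    obtain ⟨x, hx⟩ := x
    exact isFixedMarking_conj g hx⟩
  one_smul _ := rfl
  mul_smul _ _ _ := rfl

/-- The conjugation action `g • (f, z, ω) = (g ∘ f ∘ g⁻¹, g z, g ω)` on totally marked maps. -/
instance : MulAction Rat1 Rat2tm where
  smul g x := ⟨(g • x.1.1, fun i => g.1 (x.1.2.1 i), fun j => g.1 (x.1.2.2 j)), by
    obtain ⟨_, g, rfl⟩ := g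
    obtain ⟨x, hx⟩ := x
    exact ⟨isFixedMarking_conj g hx.1, isCriticalMarking_conj g hx.2⟩⟩
  one_smul _ := rfl
  mul_smul _ _ _ := rfl

/-- The moduli space of fixed point marked maps, with the quotient topology. -/
abbrev M2fm := Quotient (MulAction.orbitRel Rat1 Rat2fm)

/-- The moduli space of totally marked maps, with the quotient topology. -/
abbrev M2tm := Quotient (MulAction.orbitRel Rat1 Rat2tm)

/-- The class of a fixed point marked map in the moduli space. -/
def Rat2fm.toModuli (x : Rat2fm) : M2fm := Quotient.mk _ x

/-- The class of a totally marked map in the moduli space. -/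
def Rat2tm.toModuli (x : Rat2tm) : M2tm := Quotient.mk _ x

/-! ### The map `z + 1/z` -/

/-- The self-map `z ↦ z + 1/z` of the Riemann sphere. -/
def zAddInv (z : OnePoint ℂ) : OnePoint ℂ :=
  z.elim ∞ (fun t => if t = 0 then ∞ else ((t + t⁻¹ : ℂ) : OnePoint ℂ))

lemma represents_zAddInv : Represents ![![1, 0, 1], ![0, 1, 0]] zAddInv := by
  refine ⟨fun v hv h => hv ?_, funext fun z => ?_⟩
  · have h0 := congrFun h 0
    have h1 := congrFun h 1
    simp [quadForm] at h0 h1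
    ext i
    rcases h1 with h1 | h1 <;> simp [h1] at h0 <;> fin_cases i <;> simp [h0, h1]
  · induction z using OnePoint.rec with
    | infty => simp [ratMap, quadForm, hc, proj, zAddInv]
    | coe t =>
      by_cases ht : t = 0
      · simp [ratMap, quadForm, hc, proj, zAddInv, ht]
      · simp [ratMap, quadForm, hc, proj, zAddInv, ht]
        field_simp

/-- The map `z ↦ z + 1/z`, with its triple fixed point at infinity listed three times. -/
def tripleFixed : Rat2fm := ⟨(⟨zAddInv, _, represents_zAddInv⟩, fun _ => ∞), by
  refine ⟨_, represents_zAddInv, 1, one_ne_zero, fun v => ?_⟩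
  simp [wedge, quadForm, hc]
  ring⟩

/-! ### Holomorphic functions

A complex structure on a topological space `X` is recorded by its holomorphic functions, as a
predicate `H g x`: the function `g : X → ℂ` is holomorphic near the point `x`. -/

/-- `(c, w)` is a system of homogeneous coordinates of the marked map `(f, z)`. -/
def Rat2fm.IsLift (p : Coef × (Fin 3 → Fin 2 → ℂ)) (x : Rat2fm) : Prop :=
  Represents p.1 x.1.1.1 ∧ ∀ i, IsHom (p.2 i) (x.1.2 i)

/-- The complex structure of `Rat2fm` as a subset of `ℂP⁵ × (ℂP¹)³`: a function is holomorphic near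
`x` if, in homogeneous coordinates, it is locally the restriction of an analytic function. -/
def Rat2fm.HolAt (g : Rat2fm → ℂ) (x : Rat2fm) : Prop :=
  ∀ p, Rat2fm.IsLift p x → ∃ G : Coef × (Fin 3 → Fin 2 → ℂ) → ℂ,
    AnalyticAt ℂ G p ∧ ∀ᶠ q in 𝓝 p, ∀ y, Rat2fm.IsLift q y → g y = G q

/-- `(c, w, u)` is a system of homogeneous coordinates of the marked map `(f, z, ω)`. -/
def Rat2tm.IsLift (p : Coef × (Fin 3 → Fin 2 → ℂ) × (Fin 2 → Fin 2 → ℂ)) (x : Rat2tm) : Prop :=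
  Represents p.1 x.1.1.1 ∧ (∀ i, IsHom (p.2.1 i) (x.1.2.1 i)) ∧ ∀ j, IsHom (p.2.2 j) (x.1.2.2 j)

/-- The complex structure of `Rat2tm` as a subset of `ℂP⁵ × (ℂP¹)³ × (ℂP¹)²`: a function is
holomorphic near `x` if, in homogeneous coordinates, it is locally the restriction of an
analytic function. -/
def Rat2tm.HolAt (g : Rat2tm → ℂ) (x : Rat2tm) : Prop :=
  ∀ p, Rat2tm.IsLift p x → ∃ G : Coef × (Fin 3 → Fin 2 → ℂ) × (Fin 2 → Fin 2 → ℂ) → ℂ,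
    AnalyticAt ℂ G p ∧ ∀ᶠ q in 𝓝 p, ∀ y, Rat2tm.IsLift q y → g y = G q

/-- The quotient complex structure: a function on the moduli space is holomorphic if its pullback
to the space of marked maps is. -/
def M2fm.HolAt (g : M2fm → ℂ) (m : M2fm) : Prop :=
  ∀ x, Rat2fm.toModuli x = m → Rat2fm.HolAt (g ∘ Rat2fm.toModuli) x

/-- The quotient complex structure: a function on the moduli space is holomorphic if its pullback
to the space of marked maps is. -/
def M2tm.HolAt (g : M2tm → ℂ) (m : M2tm) : Prop :=
  ∀ x, Rat2tm.toModuli x = m → Rat2tm.HolAt (g ∘ Rat2tm.toModuli) x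

/-- The surface `z₁ ^ p + z₂ ^ q + z₃ ^ r = 0` in `ℂ³`. -/
abbrev Brieskorn (p q r : ℕ) := {z : Fin 3 → ℂ // z 0 ^ p + z 1 ^ q + z 2 ^ r = 0}

/-- The holomorphic functions on the surface `z₁ ^ p + z₂ ^ q + z₃ ^ r = 0` are the local
restrictions of analytic functions on `ℂ³`. -/
def Brieskorn.HolAt (p q r : ℕ) (g : Brieskorn p q r → ℂ) (y : Brieskorn p q r) : Prop :=
  ∃ G : (Fin 3 → ℂ) → ℂ, AnalyticAt ℂ G y.1 ∧ ∀ᶠ z in 𝓝 y, g z = G z.1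

section Generic

variable {X Y : Type} [TopologicalSpace X] [TopologicalSpace Y]

/-- The homeomorphism `e` between open subsets of `X` and `Y` identifies the
holomorphic functions. -/
def IsBiholomorphic (HX : (X → ℂ) → X → Prop) (HY : (Y → ℂ) → Y → Prop)
    (e : OpenPartialHomeomorph X Y) : Prop :=
  ∀ x ∈ e.source, ∀ g : Y → ℂ, HY g (e x) ↔ HX (g ∘ e) x

/-- `X` is a (Hausdorff, second countable) smooth complex `n`-manifold whose holomorphic functions
are those given by `H`. -/
def IsComplexManifold (n : ℕ) (H : (X → ℂ) → X → Prop) : Prop :=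
  T2Space X ∧ SecondCountableTopology X ∧
    ∃ _ : ChartedSpace (EuclideanSpace ℂ (Fin n)) X,
      IsManifold 𝓘(ℂ, EuclideanSpace ℂ (Fin n)) ω X ∧
        ∀ (g : X → ℂ) (x : X),
          H g x ↔ ContMDiffAt 𝓘(ℂ, EuclideanSpace ℂ (Fin n)) 𝓘(ℂ) ω g x

/-- Near `x`, the space `X` is biholomorphic to an open subset of `ℂⁿ`. -/
def IsSmoothPoint (n : ℕ) (H : (X → ℂ) → X → Prop) (x : X) : Prop :=
  ∃ e : OpenPartialHomeomorph X (EuclideanSpace ℂ (Fin n)),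
    x ∈ e.source ∧ IsBiholomorphic H (fun g y => AnalyticAt ℂ g y) e

/-- Near `x`, the space `X` is biholomorphic to a neighbourhood of the origin in the surface
`z₁ ^ p + z₂ ^ q + z₃ ^ r = 0`, with `x` corresponding to the origin. -/
def HasSingularityType (p q r : ℕ) (H : (X → ℂ) → X → Prop) (x : X) : Prop :=
  ∃ e : OpenPartialHomeomorph X (Brieskorn p q r),
    x ∈ e.source ∧ (e x).1 = 0 ∧ IsBiholomorphic H (Brieskorn.HolAt p q r) e

/-- `π` is an unramified holomorphic covering with `d` sheets: a covering map whose fibres have `d`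
elements and which is locally biholomorphic. -/
def IsUnramifiedCover (d : ℕ) (HX : (X → ℂ) → X → Prop) (HY : (Y → ℂ) → Y → Prop)
    (π : X → Y) : Prop :=
  IsCoveringMap π ∧ (∀ y, Nat.card (π ⁻¹' {y}) = d) ∧
    ∀ x, ∃ e : OpenPartialHomeomorph X Y,
      x ∈ e.source ∧ Set.EqOn e π e.source ∧ IsBiholomorphic HX HY e

end Generic

end QuadRat

end

open QuadRat

/-! Every complex structure here is read off from homogeneous coordinates: functions on a space
correspond to locally analytic functions of lifts. A chart is then a coordinate map that is analytic
in the lifts, together with an analytic choice of lift over its image (`exists_chart_of_section`).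

For fixed point marked maps, a point that is not fixed is moved to infinity. In affine terms `z q(z)
- p(z) = ∏ (z - zᵢ)` for `f = p / q` with `q` monic, so the three fixed points and the two free
coefficients of `q` are coordinates (`eq_fmSection`). The Jacobian of a lift is a binary quadratic
form whose discriminant is `16 * res`. Hence the two critical points are distinct, depend
analytically on the coefficients (`exists_analytic_critical`), and are permuted by the deck group of
the double covering `forget`.

For totally marked maps, the critical points are put at `0` and `∞`. The fixed points then determine
the map, nondegeneracy means `zᵢ + zⱼ ≠ 0` for `i ≠ j`, and the remaining freedom is `z ↦ λ z`. The
invariants `rᵢⱼ = (zᵢ - zⱼ) / (zᵢ + zⱼ)` separate classes (`injective_m2tm_ratio`). Some fixed point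
`zᵢ` is not critical; scaling it to `1` gives `zₗ = (1 - rᵢₗ) / (1 + rᵢₗ)`, so the two ratios at `i`
form a chart. A stabilizer fixes `0`, `∞` and `zᵢ`, hence is trivial (`free_tm`).

Exchanging the critical points is `z ↦ 1 / z` and negates every `rᵢⱼ`, so the moduli space of fixed
point marked maps is the quotient by this sign. The sign has a single fixed point, where all ratios
vanish and the three fixed points coincide: the class of `z + 1/z`. This locates the non-free orbit
(`nonfree_fm_iff`), and elsewhere `forgetM` is locally biholomorphic. At that class the model is `ℂ²
/ ±1`, identified with the quadratic cone by `coneMap`; an even convergent power series is a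
convergent power series in the degree two monomials, so the holomorphic functions agree
(`cone_holAt_iff`). A smooth chart at the vertex would produce a two-dimensional totally isotropic
subspace of `ℂ³` (`not_isSmoothPoint_cone`). -/

noncomputable section

namespace QuadRat

set_option linter.unusedSectionVars false

/-! ### Spaces described by analytic lifts -/

section Lifts

variable {E E' E'' : Type} [NormedAddCommGroup E] [NormedSpace ℂ E] [NormedAddCommGroup E']
  [NormedSpace ℂ E'] [NormedAddCommGroup E''] [NormedSpace ℂ E''] {X Y Z : Type}

/-- The functions on `X` which, in terms of the lifts given by the relation `L`, are locally
restrictions of analytic functions. -/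
def HolByLifts (L : E → X → Prop) (g : X → ℂ) (x : X) : Prop :=
  ∀ p, L p x → ∃ G : E → ℂ, AnalyticAt ℂ G p ∧ ∀ᶠ q in 𝓝 p, ∀ y, L q y → g y = G q

/-- The map `f` is locally covered by analytic maps between lifts. -/
def LiftsAt (LX : E → X → Prop) (LY : E' → Y → Prop) (f : X → Y) (x : X) : Prop :=
  ∀ p, LX p x → ∃ Φ : E → E', AnalyticAt ℂ Φ p ∧ ∀ᶠ q in 𝓝 p, ∀ y, LX q y → LY (Φ q) (f y)

/-- The relation `L` behaves like a continuous open surjection from a subset of `E` to `X`. -/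
structure IsLiftSystem [TopologicalSpace X] (L : E → X → Prop) : Prop where
  exists_lift : ∀ x, ∃ p, L p x
  eventually_mem : ∀ {p x}, L p x → ∀ {U : Set X}, U ∈ 𝓝 x → ∀ᶠ q in 𝓝 p, ∀ y, L q y → y ∈ U
  eventually_exists : ∀ {p x}, L p x → ∀ {W : Set E}, W ∈ 𝓝 p → ∀ᶠ y in 𝓝 x, ∃ q ∈ W, L q y

lemma LiftsAt.holByLifts {LX : E → X → Prop} {LY : E' → Y → Prop} {f : X → Y} {x : X}
    (hf : LiftsAt LX LY f x) {g : Y → ℂ} (hg : HolByLifts LY g (f x)) :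
    HolByLifts LX (g ∘ f) x := by
  intro p hp
  obtain ⟨Φ, hΦ, h⟩ := hf p hp
  obtain ⟨G, hG, h'⟩ := hg (Φ p) (h.self_of_nhds x hp)
  refine ⟨G ∘ Φ, hG.comp hΦ, ?_⟩
  filter_upwards [h, hΦ.continuousAt.eventually h'] with q h1 h2 y hy
  exact h2 _ (h1 y hy)

lemma LiftsAt.continuousAt [TopologicalSpace X] [TopologicalSpace Y] {LX : E → X → Prop}
    {LY : E' → Y → Prop} (hX : IsLiftSystem LX) (hY : IsLiftSystem LY) {f : X → Y} {x : X}
    (hf : LiftsAt LX LY f x) : ContinuousAt f x := by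
  intro U hU
  rw [Filter.mem_map]
  obtain ⟨p, hp⟩ := hX.exists_lift x
  obtain ⟨Φ, hΦ, h⟩ := hf p hp
  have h1 := hΦ.continuousAt.eventually (hY.eventually_mem (h.self_of_nhds x hp) hU)
  filter_upwards [hX.eventually_exists hp (h.and h1)] with y ⟨q, hq, hy⟩
  exact hq.2 _ (hq.1 y hy)

lemma HolByLifts.congr [TopologicalSpace X] {L : E → X → Prop} (hL : IsLiftSystem L)
    {g g' : X → ℂ} {x : X} (h : g =ᶠ[𝓝 x] g') (hg : HolByLifts L g x) : HolByLifts L g' x := by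
  intro p hp
  obtain ⟨G, hG, h'⟩ := hg p hp
  refine ⟨G, hG, ?_⟩
  filter_upwards [h', hL.eventually_mem hp h] with q h1 h2 y hy
  rw [← h1 y hy, h2 y hy]

/-- A normed space serves as its own space of lifts, so coordinate maps fall under the general
results on lifted maps. -/
lemma isLiftSystem_eq : IsLiftSystem (fun p x : E => p = x) where
  exists_lift x := ⟨x, rfl⟩
  eventually_mem := by
    rintro p _ rfl U hU
    filter_upwards [hU] with q hq y hy
    exact hy ▸ hq
  eventually_exists := by
    rintro p _ rfl W hW
    filter_upwards [hW] with q hq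
    exact ⟨q, hq, rfl⟩

lemma holByLifts_eq {g : E → ℂ} {x : E} :
    HolByLifts (fun p x : E => p = x) g x ↔ AnalyticAt ℂ g x := by
  constructor
  · intro h
    obtain ⟨G, hG, h'⟩ := h x rfl
    refine hG.congr ?_
    filter_upwards [h'] with q hq
    exact (hq q rfl).symm
  · rintro h p rfl
    refine ⟨g, h, Filter.Eventually.of_forall ?_⟩
    rintro q _ rfl
    rfl

lemma LiftsAt.of_analytic {LX : E → X → Prop} {f : X → E'} {x : X} (Φ : E → E')
    (h : ∀ q y, LX q y → Φ q = f y) (hΦ : ∀ q, LX q x → AnalyticAt ℂ Φ q) :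
    LiftsAt LX (fun p y : E' => p = y) f x :=
  fun p hp => ⟨Φ, hΦ p hp, Filter.Eventually.of_forall fun q y hy => h q y hy⟩

lemma IsLiftSystem.prod [TopologicalSpace X] [TopologicalSpace Y] {LX : E → X → Prop}
    {LY : E' → Y → Prop} (hX : IsLiftSystem LX) (hY : IsLiftSystem LY) :
    IsLiftSystem (fun (p : E × E') (x : X × Y) => LX p.1 x.1 ∧ LY p.2 x.2) where
  exists_lift x := by
    obtain ⟨p, hp⟩ := hX.exists_lift x.1
    obtain ⟨q, hq⟩ := hY.exists_lift x.2
    exact ⟨(p, q), hp, hq⟩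
  eventually_mem := by
    rintro ⟨p, p'⟩ ⟨x, x'⟩ ⟨hp, hp'⟩ U hU
    rw [nhds_prod_eq, Filter.mem_prod_iff] at hU
    obtain ⟨A, hA, B, hB, hAB⟩ := hU
    rw [nhds_prod_eq]
    filter_upwards [Filter.prod_mem_prod (hX.eventually_mem hp hA) (hY.eventually_mem hp' hB)]
      with q hq y hy
    exact hAB ⟨hq.1 _ hy.1, hq.2 _ hy.2⟩
  eventually_exists := by
    rintro ⟨p, p'⟩ ⟨x, x'⟩ ⟨hp, hp'⟩ W hW
    rw [nhds_prod_eq, Filter.mem_prod_iff] at hW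
    obtain ⟨A, hA, B, hB, hAB⟩ := hW
    rw [nhds_prod_eq]
    filter_upwards [Filter.prod_mem_prod (hX.eventually_exists hp hA)
      (hY.eventually_exists hp' hB)] with y hy
    obtain ⟨⟨q, hq, h1⟩, ⟨q', hq', h2⟩⟩ := hy
    exact ⟨(q, q'), hAB ⟨hq, hq'⟩, h1, h2⟩

lemma IsLiftSystem.pi {ι : Type} [Fintype ι] [TopologicalSpace X] {L : E → X → Prop}
    (hL : IsLiftSystem L) :
    IsLiftSystem (fun (p : ι → E) (x : ι → X) => ∀ i, L (p i) (x i)) where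
  exists_lift x := by
    choose p hp using fun i => hL.exists_lift (x i)
    exact ⟨p, hp⟩
  eventually_mem := by
    intro p x hp U hU
    rw [nhds_pi, Filter.mem_pi'] at hU
    obtain ⟨I, t, ht, hU⟩ := hU
    have h : ∀ i, ∀ᶠ q in 𝓝 p, ∀ y, L (q i) y → y ∈ t i := fun i =>
      (continuous_apply i).continuousAt.eventually (hL.eventually_mem (hp i) (ht i))
    filter_upwards [Filter.eventually_all.2 h] with q hq y hy
    exact hU fun i _ => hq i _ (hy i)
  eventually_exists := by
    intro p x hp W hW
    rw [nhds_pi, Filter.mem_pi'] at hW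
    obtain ⟨I, t, ht, hW⟩ := hW
    have h : ∀ i, ∀ᶠ y in 𝓝 x, ∃ q ∈ t i, L q (y i) := fun i =>
      (continuous_apply i).continuousAt.eventually (hL.eventually_exists (hp i) (ht i))
    filter_upwards [Filter.eventually_all.2 h] with y hy
    choose q hq hqy using hy
    exact ⟨q, hW fun i _ => hq i, hqy⟩

lemma IsLiftSystem.subtype [TopologicalSpace X] {L : E → X → Prop} (hL : IsLiftSystem L)
    (P : X → Prop) : IsLiftSystem (fun (p : E) (x : {x // P x}) => L p x.1) where
  exists_lift x := hL.exists_lift x.1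
  eventually_mem := by
    intro p x hp U hU
    obtain ⟨V, hV, hVU⟩ := mem_nhds_subtype _ _ _ |>.1 hU
    filter_upwards [hL.eventually_mem hp hV] with q hq y hy
    exact hVU (hq _ hy)
  eventually_exists := by
    intro p x hp W hW
    exact continuous_subtype_val.continuousAt.eventually (hL.eventually_exists hp hW)

/-- Openness of `π` is what supplies nearby lifts of nearby classes. With `holByLifts_quotient` this
places the moduli spaces in the same framework as the spaces of marked maps. -/
lemma IsLiftSystem.quotient [TopologicalSpace X] [TopologicalSpace Y] {L : E → X → Prop}
    (hL : IsLiftSystem L) {π : X → Y} (hπ : IsOpenQuotientMap π) :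
    IsLiftSystem (fun (p : E) (m : Y) => ∃ x, L p x ∧ π x = m) where
  exists_lift m := by
    obtain ⟨x, rfl⟩ := hπ.surjective m
    obtain ⟨p, hp⟩ := hL.exists_lift x
    exact ⟨p, x, hp, rfl⟩
  eventually_mem := by
    rintro p _ ⟨x, hp, rfl⟩ U hU
    filter_upwards [hL.eventually_mem hp (hπ.continuous.continuousAt hU)] with q hq
    rintro _ ⟨x, hx, rfl⟩
    exact hq x hx
  eventually_exists := by
    rintro p _ ⟨x, hp, rfl⟩ W hW
    filter_upwards [hπ.isOpenMap.image_mem_nhds (hL.eventually_exists hp hW)]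
    rintro _ ⟨y, ⟨q, hq, hy⟩, rfl⟩
    exact ⟨q, hq, y, hy, rfl⟩

lemma holByLifts_quotient {L : E → X → Prop} {π : X → Y} {g : Y → ℂ} {m : Y} :
    HolByLifts (fun (p : E) (m : Y) => ∃ x, L p x ∧ π x = m) g m ↔
      ∀ x, π x = m → HolByLifts L (g ∘ π) x := by
  constructor
  · rintro h x rfl p hp
    obtain ⟨G, hG, h'⟩ := h p ⟨x, hp, rfl⟩
    exact ⟨G, hG, h'.mono fun q hq y hy => hq _ ⟨y, hy, rfl⟩⟩
  · rintro h p ⟨x, hp, hx⟩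
    obtain ⟨G, hG, h'⟩ := h x hx p hp
    refine ⟨G, hG, h'.mono ?_⟩
    rintro q hq _ ⟨y, hy, rfl⟩
    exact hq y hy

end Lifts

/-! ### Charts and manifolds -/

section Charts

variable {X Y Z : Type} [TopologicalSpace X] [TopologicalSpace Y] [TopologicalSpace Z]

lemma IsBiholomorphic.trans {HX : (X → ℂ) → X → Prop} {HY : (Y → ℂ) → Y → Prop}
    {HZ : (Z → ℂ) → Z → Prop} {e : OpenPartialHomeomorph X Y} {e' : OpenPartialHomeomorph Y Z}
    (he : IsBiholomorphic HX HY e) (he' : IsBiholomorphic HY HZ e') :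
    IsBiholomorphic HX HZ (e.trans e') := by
  intro x hx g
  rw [OpenPartialHomeomorph.trans_source] at hx
  rw [OpenPartialHomeomorph.coe_trans, Function.comp_apply, he' _ hx.2, he _ hx.1]
  rfl

/-- Locality of `HX` is needed because `g ∘ e.symm ∘ e` agrees with `g` only on the source of `e`.
-/
lemma IsBiholomorphic.symm {HX : (X → ℂ) → X → Prop} {HY : (Y → ℂ) → Y → Prop}
    (hloc : ∀ g g' x, g =ᶠ[𝓝 x] g' → HX g x → HX g' x)
    {e : OpenPartialHomeomorph X Y} (he : IsBiholomorphic HX HY e) :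
    IsBiholomorphic HY HX e.symm := by
  intro y hy g
  have hx : e.symm y ∈ e.source := e.map_target hy
  have h := he _ hx (g ∘ e.symm)
  rw [e.right_inv hy] at h
  have h' : (g ∘ e.symm) ∘ e =ᶠ[𝓝 (e.symm y)] g := by
    filter_upwards [e.open_source.mem_nhds hx] with x hx
    simp [e.left_inv hx]
  rw [h]
  exact ⟨hloc _ _ _ h'.symm, hloc _ _ _ h'⟩

lemma IsSmoothPoint.of_biholomorphic {n : ℕ} {HX : (X → ℂ) → X → Prop}
    {HY : (Y → ℂ) → Y → Prop} {e : OpenPartialHomeomorph X Y} (he : IsBiholomorphic HX HY e)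
    {x : X} (hx : x ∈ e.source) (h : IsSmoothPoint n HY (e x)) : IsSmoothPoint n HX x := by
  obtain ⟨f, hxf, hf⟩ := h
  exact ⟨e.trans f, by simp [hx, hxf], he.trans hf⟩

/-- A parametrization by lifts gives a biholomorphic chart. -/
theorem exists_chart_of_section [Nonempty X] {E V : Type} [NormedAddCommGroup E] [NormedSpace ℂ E]
    [NormedAddCommGroup V] [NormedSpace ℂ V] {L : E → X → Prop} (hL : IsLiftSystem L) (χ : X → V)
    {S : Set X} {T : Set V} (hS : IsOpen S) (hT : IsOpen T) (hinj : Set.InjOn χ S)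
    (hmaps : Set.MapsTo χ S T) (σ : V → E) (hσ : ∀ t ∈ T, AnalyticAt ℂ σ t)
    (hσL : ∀ t ∈ T, ∃ x ∈ S, L (σ t) x ∧ χ x = t)
    (hχ : ∀ x ∈ S, LiftsAt L (fun p y : V => p = y) χ x) :
    ∃ e : OpenPartialHomeomorph X V, e.source = S ∧ e.target = T ∧ (e : X → V) = χ ∧
      IsBiholomorphic (HolByLifts L) (fun g y => AnalyticAt ℂ g y) e := by
  choose! τ hτS hτL hτ using hσL
  refine ⟨⟨⟨⟨χ, τ, S, T, hmaps, hτS, ?_, hτ⟩, ?_, ?_⟩, hS, hT⟩, rfl, rfl, rfl, ?_⟩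
  · intro x hx
    exact hinj (hτS _ (hmaps hx)) hx (hτ _ (hmaps hx))
  · intro x hx
    exact ((hχ x hx).continuousAt hL isLiftSystem_eq).continuousWithinAt
  -- Continuity of the inverse is inherited from `σ`: lifts close to `σ t` lie only over points
  -- close to `τ t`.
  · intro t ht U hU
    rw [Filter.mem_map]
    have h := (hσ t ht).continuousAt.eventually (hL.eventually_mem (hτL t ht) hU)
    filter_upwards [mem_nhdsWithin_of_mem_nhds h, self_mem_nhdsWithin] with s hs hsT
    exact hs _ (hτL s hsT)
  · intro x hx g
    change AnalyticAt ℂ g (χ x) ↔ HolByLifts L (g ∘ χ) x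
    have hx : x ∈ S := hx
    constructor
    · intro hg
      exact (hχ x hx).holByLifts (holByLifts_eq.2 hg)
    -- In the chart, `g` is its analytic expression in lifts composed with the section `σ`.
    · intro h
      have hxT := hmaps hx
      have hx' : τ (χ x) = x := hinj (hτS _ hxT) hx (hτ _ hxT)
      obtain ⟨G, hG, h'⟩ := h (σ (χ x)) (by simpa only [hx'] using hτL _ hxT)
      refine (hG.comp (hσ _ hxT)).congr ?_
      filter_upwards [(hσ _ hxT).continuousAt.eventually h', hT.mem_nhds hxT] with t h1 ht
      have := h1 _ (hτL t ht)
      simp only [Function.comp_apply, hτ t ht] at this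
      exact this.symm

/-- The predicate `H` forces compatibility of the charts: the coordinates of one chart are
`H`-holomorphic, hence analytic when read in any other chart. -/
theorem isComplexManifold_of_isSmoothPoint {n : ℕ} [T2Space X] [SecondCountableTopology X]
    {H : (X → ℂ) → X → Prop} (hloc : ∀ g g' x, g =ᶠ[𝓝 x] g' → H g x → H g' x)
    (h : ∀ x, IsSmoothPoint n H x) : IsComplexManifold n H := by
  refine ⟨inferInstance, inferInstance, ?_⟩
  choose e hxe he using h
  let cs : ChartedSpace (EuclideanSpace ℂ (Fin n)) X :=
    { atlas := Set.range e
      chartAt := e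
      mem_chart_source := hxe
      chart_mem_atlas := fun x => ⟨x, rfl⟩ }
  have key : ∀ a b : X, ∀ y ∈ (e a).target, (e a).symm y ∈ (e b).source →
      AnalyticAt ℂ (e b ∘ (e a).symm) y := by
    intro a b y hy hb
    have hcoord : ∀ i, AnalyticAt ℂ (fun z => (e b ((e a).symm z)) i) y := by
      intro i
      have h1 : H ((fun z : EuclideanSpace ℂ (Fin n) => z i) ∘ e b) ((e a).symm y) :=
        (he b _ hb _).1 ((EuclideanSpace.proj i : EuclideanSpace ℂ (Fin n) →L[ℂ] ℂ).analyticAt _)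
      have h2 := ((he a).symm hloc y hy ((fun z : EuclideanSpace ℂ (Fin n) => z i) ∘ e b)).1 h1
      exact h2
    have h3 : AnalyticAt ℂ (fun z i => (e b ((e a).symm z)) i) y := AnalyticAt.pi hcoord
    exact ((EuclideanSpace.equiv (Fin n) ℂ).symm.toContinuousLinearMap.analyticAt _).comp h3
  have hm : IsManifold 𝓘(ℂ, EuclideanSpace ℂ (Fin n)) ω X := by
    apply isManifold_of_contDiffOn
    rintro _ _ ⟨a, rfl⟩ ⟨b, rfl⟩ y hy
    simp only [modelWithCornersSelf_coe, modelWithCornersSelf_coe_symm, Set.range_id,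
      Set.inter_univ, Set.preimage_id, OpenPartialHomeomorph.trans_source,
      OpenPartialHomeomorph.symm_source] at hy
    have := (key a b y hy.1 hy.2).contDiffAt (n := ω)
    exact this.contDiffWithinAt
  refine ⟨cs, hm, fun g x => ?_⟩
  rw [contMDiffAt_iff]
  have h1 : H g x ↔ AnalyticAt ℂ (g ∘ (e x).symm) (e x x) := by
    have := (he x).symm hloc (e x x) ((e x).map_source (hxe x)) g
    rwa [(e x).left_inv (hxe x)] at this
  have h2 : ContDiffWithinAt ℂ ω (extChartAt 𝓘(ℂ) (g x) ∘ g ∘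
      (extChartAt 𝓘(ℂ, EuclideanSpace ℂ (Fin n)) x).symm)
      (Set.range 𝓘(ℂ, EuclideanSpace ℂ (Fin n)))
      (extChartAt 𝓘(ℂ, EuclideanSpace ℂ (Fin n)) x x) ↔
      AnalyticAt ℂ (g ∘ (e x).symm) (e x x) := by
    simp only [extChartAt, modelWithCornersSelf_coe, Set.range_id, contDiffWithinAt_univ]
    exact ⟨fun h => h.analyticAt, fun h => h.contDiffAt⟩
  rw [h1, h2]
  refine ⟨fun h => ⟨?_, h⟩, fun h => h.2⟩
  have h3 : ContinuousAt ((g ∘ (e x).symm) ∘ e x) x :=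
    h.continuousAt.comp ((e x).continuousAt (hxe x))
  refine h3.congr ?_
  filter_upwards [(e x).open_source.mem_nhds (hxe x)] with y hy
  simp [(e x).left_inv hy]

end Charts

/-! ### Homogeneous coordinates on the sphere -/

lemma ne_zero_iff (v : Fin 2 → ℂ) : v ≠ 0 ↔ v 0 ≠ 0 ∨ v 1 ≠ 0 := by
  rw [Ne, funext_iff, Fin.forall_fin_two]
  simp only [Pi.zero_apply]
  tauto

lemma isHom_proj {v : Fin 2 → ℂ} (hv : v ≠ 0) : IsHom v (proj v) := ⟨hv, rfl⟩

lemma isHom_hc (z : OnePoint ℂ) : IsHom (hc z) z := ⟨hc_ne_zero z, proj_hc z⟩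

lemma IsHom.exists_smul {v : Fin 2 → ℂ} {z : OnePoint ℂ} (h : IsHom v z) :
    ∃ a : ℂ, a ≠ 0 ∧ v = a • hc z := by
  obtain ⟨hv, rfl⟩ := h
  exact exists_smul_hc hv

lemma proj_eq_iff {v w : Fin 2 → ℂ} (hv : v ≠ 0) (hw : w ≠ 0) :
    proj v = proj w ↔ wedge v w = 0 := by
  rw [ne_zero_iff] at hv hw
  unfold proj wedge
  split_ifs with h1 h2 h2
  · simp [h1, h2]
  · simp only [OnePoint.infty_ne_coe, false_iff]
    simp only [h1, not_true, or_false, ne_eq] at hv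
    simp [h1, h2, hv]
  · simp only [OnePoint.coe_ne_infty, false_iff]
    simp only [h2, not_true, or_false, ne_eq] at hw
    simp [h1, h2, hw]
  · rw [OnePoint.coe_eq_coe, div_eq_div_iff h1 h2, sub_eq_zero, mul_comm (v 1)]

lemma wedge_self (v : Fin 2 → ℂ) : wedge v v = 0 := by simp [wedge, mul_comm]

lemma wedge_swap (v w : Fin 2 → ℂ) : wedge v w = -wedge w v := by simp [wedge]; ring

lemma ne_zero_of_wedge {v w : Fin 2 → ℂ} (h : wedge v w ≠ 0) : v ≠ 0 ∧ w ≠ 0 :=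
  ⟨fun h' => h (by simp [h', wedge]), fun h' => h (by simp [h', wedge])⟩

lemma IsHom.eq_iff_wedge {v w : Fin 2 → ℂ} {x y : OnePoint ℂ} (hv : IsHom v x) (hw : IsHom w y) :
    x = y ↔ wedge v w = 0 := by
  obtain ⟨hv, rfl⟩ := hv
  obtain ⟨hw, rfl⟩ := hw
  exact proj_eq_iff hv hw

lemma isHom_mulVec (g : GL (Fin 2) ℂ) {v : Fin 2 → ℂ} {z : OnePoint ℂ} (h : IsHom v z) :
    IsHom (g.1.mulVec v) (g • z) := by
  obtain ⟨hv, rfl⟩ := h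
  exact ⟨mulVec_ne_zero g hv, (smul_proj g hv).symm⟩

lemma continuousAt_proj {v : Fin 2 → ℂ} (hv : v ≠ 0) : ContinuousAt proj v := by
  by_cases h1 : v 1 = 0
  · have h0 : v 0 ≠ 0 := by
      rw [ne_zero_iff] at hv
      simpa [h1] using hv
    have hp : proj v = OnePoint.infty := by simp [proj, h1]
    rw [ContinuousAt, hp]
    rw [OnePoint.hasBasis_nhds_infty.tendsto_right_iff]
    rintro s ⟨-, hs⟩
    obtain ⟨R, hR⟩ := hs.isBounded.exists_norm_le
    -- This open condition holds at `v` since `v 1 = 0`, and it pushes `w 0 / w 1` outside the ball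
    -- of radius `R`.
    have : ∀ᶠ w : Fin 2 → ℂ in 𝓝 v, R * ‖w 1‖ < ‖w 0‖ := by
      refine ContinuousAt.eventually_lt
        (continuous_const.mul (continuous_apply 1).norm).continuousAt
        (continuous_apply 0).norm.continuousAt ?_
      simpa [h1] using h0
    filter_upwards [this] with w hw
    by_cases hw1 : w 1 = 0
    · right
      simp [proj, hw1]
    · left
      refine ⟨w 0 / w 1, fun hmem => ?_, by simp [proj, hw1]⟩
      have := hR _ hmem
      rw [norm_div, div_le_iff₀ (norm_pos_iff.2 hw1)] at this
      linarith
  · have h : (fun w : Fin 2 → ℂ => ((w 0 / w 1 : ℂ) : OnePoint ℂ)) =ᶠ[𝓝 v] proj := by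
      filter_upwards [(continuous_apply 1).continuousAt.eventually_ne h1] with w hw
      simp [proj, hw]
    refine ContinuousAt.congr ?_ h
    have h2 : ContinuousAt (fun w : Fin 2 → ℂ => w 0 / w 1) v :=
      (continuous_apply 0).continuousAt.div (continuous_apply 1).continuousAt h1
    exact OnePoint.continuous_coe.continuousAt.comp h2

lemma isLiftSystem_isHom : IsLiftSystem IsHom where
  exists_lift z := ⟨_, isHom_hc z⟩
  eventually_mem := by
    rintro v _ ⟨hv, rfl⟩ U hU
    filter_upwards [continuousAt_proj hv hU] with w hw
    rintro _ ⟨-, rfl⟩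
    exact hw
  eventually_exists := by
    rintro v _ ⟨hv, rfl⟩ W hW
    by_cases h1 : v 1 = 0
    · have h0 : v 0 ≠ 0 := by
        rw [ne_zero_iff] at hv
        simpa [h1] using hv
      have hp : proj v = OnePoint.infty := by simp [proj, h1]
      rw [hp]
      -- Near infinity the first homogeneous coordinate is frozen at `v 0`; near a finite point,
      -- below, the second one is frozen at `v 1`.
      let q : OnePoint ℂ → Fin 2 → ℂ := fun z => z.elim v (fun t => ![v 0, v 0 * t⁻¹])
      have hq : ContinuousAt q ∞ := by
        rw [OnePoint.continuousAt_infty', Filter.coclosedCompact_eq_cocompact,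
          ← Metric.cobounded_eq_cocompact]
        have h3 : Filter.Tendsto (fun t : ℂ => ![v 0, v 0 * t⁻¹]) (Bornology.cobounded ℂ)
            (𝓝 ![v 0, v 0 * 0]) := by
          rw [tendsto_pi_nhds, Fin.forall_fin_two]
          exact ⟨tendsto_const_nhds, Filter.tendsto_inv₀_cobounded.const_mul _⟩
        have h4 : ![v 0, v 0 * 0] = v := by
          ext i; fin_cases i <;> simp [h1]
        rw [h4] at h3
        exact h3
      have hne : ∀ᶠ z : OnePoint ℂ in 𝓝 ∞, z ≠ ((0 : ℂ) : OnePoint ℂ) :=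
        eventually_ne_nhds (OnePoint.infty_ne_coe 0)
      filter_upwards [hq hW, hne] with z hz hz0
      refine ⟨q z, hz, ?_⟩
      induction z using OnePoint.rec with
      | infty => exact ⟨hv, hp⟩
      | coe t =>
        have ht : t ≠ 0 := fun h => hz0 (by rw [h])
        refine ⟨(ne_zero_iff _).2 (Or.inl (by simpa [q] using h0)), ?_⟩
        simp [q, proj, h0, ht]
        field_simp
    · have hp : proj v = ((v 0 / v 1 : ℂ) : OnePoint ℂ) := by simp [proj, h1]
      rw [hp, OnePoint.nhds_coe_eq, Filter.eventually_map]
      have hq : ContinuousAt (fun t : ℂ => ![t * v 1, v 1]) (v 0 / v 1) := by fun_prop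
      have hv' : ![v 0 / v 1 * v 1, v 1] = v := by
        ext i; fin_cases i <;> simp [h1]
      filter_upwards [hq (by simpa only [hv'] using hW)] with t ht
      refine ⟨_, ht, (ne_zero_iff _).2 (Or.inr (by simpa using h1)), ?_⟩
      simp [proj, h1]

instance : SecondCountableTopology (OnePoint ℂ) := by
  let π : {v : Fin 2 → ℂ // v ≠ 0} → OnePoint ℂ := fun v => proj v.1
  have hcont : Continuous π := continuous_iff_continuousAt.2 fun v =>
    (continuousAt_proj v.2).comp continuous_subtype_val.continuousAt
  have ho : IsOpenMap π := by
    rw [isOpenMap_iff_nhds_le]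
    intro v W hW
    obtain ⟨W', hW', hWW⟩ := (mem_nhds_subtype _ _ _).1 (Filter.mem_map.1 hW)
    filter_upwards [isLiftSystem_isHom.eventually_exists (isHom_proj v.2) hW'] with z ⟨q, hq, h⟩
    have := hWW (show (⟨q, h.1⟩ : {v : Fin 2 → ℂ // v ≠ 0}) ∈ _ from hq)
    simpa [π, h.2] using this
  have hsurj : Function.Surjective π := fun z => ⟨⟨hc z, hc_ne_zero z⟩, proj_hc z⟩
  exact (ho.isQuotientMap hcont hsurj).secondCountableTopology ho

/-! ### Resultant and Jacobian -/

/-- The resultant of the two quadratic forms with coefficients `c`. -/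
def res (c : Coef) : ℂ :=
  (c 0 0 * c 1 2 - c 0 2 * c 1 0) ^ 2 -
    (c 0 0 * c 1 1 - c 0 1 * c 1 0) * (c 0 1 * c 1 2 - c 0 2 * c 1 1)

/-- The Jacobian determinant of `quadForm c`. -/
def jac (c : Coef) (v : Fin 2 → ℂ) : ℂ :=
  2 * (c 0 0 * c 1 1 - c 0 1 * c 1 0) * v 0 ^ 2 + 4 * (c 0 0 * c 1 2 - c 0 2 * c 1 0) * (v 0 * v 1)
    + 2 * (c 0 1 * c 1 2 - c 0 2 * c 1 1) * v 1 ^ 2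

lemma det_fderiv_eq_jac (c : Coef) (v : Fin 2 → ℂ) :
    (fderiv ℂ (quadForm c) v).det = jac c v := by
  rw [det_fderiv_quadForm, jac]; ring

/-- By the quadratic formula the form with coefficients `a, b, c` splits as `wedge v r * wedge v s`,
so nonzero `r` and `s` span its zero lines. -/
lemma exists_factor (a b c : ℂ) : ∃ r s : Fin 2 → ℂ,
    a = r 1 * s 1 ∧ b = -(r 1 * s 0 + r 0 * s 1) ∧ c = r 0 * s 0 := by
  by_cases ha : a = 0
  · exact ⟨![-1, 0], ![-c, b], by simp [ha], by simp, by simp⟩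
  · obtain ⟨d, hd⟩ := IsAlgClosed.exists_pow_nat_eq (b ^ 2 - 4 * a * c) (n := 2) (by norm_num)
    refine ⟨![(-b + d) / (2 * a), 1], ![(-b - d) / 2, a], by simp, ?_, ?_⟩
    · simp only [Matrix.cons_val_zero, Matrix.cons_val_one]
      field_simp
      ring
    · simp only [Matrix.cons_val_zero]
      field_simp
      linear_combination hd

lemma exists_zero_of_factor {r s : Fin 2 → ℂ} :
    ∃ v : Fin 2 → ℂ, v ≠ 0 ∧
      r 1 * s 1 * v 0 ^ 2 + -(r 1 * s 0 + r 0 * s 1) * (v 0 * v 1) + r 0 * s 0 * v 1 ^ 2 = 0 := by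
  by_cases hr : r = 0
  · exact ⟨![1, 0], (ne_zero_iff _).2 (by simp), by simp [hr]⟩
  · exact ⟨r, hr, by ring⟩

/-- If the first form is `wedge v r * wedge v s`, the resultant is the product of the values of the
second form at `r` and `s`. Conversely, eliminating at a common zero makes the resultant vanish. -/
lemma nondeg_iff (c : Coef) : Nondeg c ↔ res c ≠ 0 := by
  constructor
  · intro h hres
    obtain ⟨r, s, ha, hb, hc'⟩ := exists_factor (c 0 0) (c 0 1) (c 0 2)
    have hex : ∀ v : Fin 2 → ℂ, v ≠ 0 → c 0 0 * v 0 ^ 2 + c 0 1 * (v 0 * v 1) + c 0 2 * v 1 ^ 2 = 0 →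
        c 1 0 * v 0 ^ 2 + c 1 1 * (v 0 * v 1) + c 1 2 * v 1 ^ 2 = 0 → False := by
      intro v hv h0 h1
      refine h v hv (funext fun i => ?_)
      fin_cases i
      · exact h0
      · exact h1
    have hzero : c 0 0 = 0 → c 0 1 = 0 → c 0 2 = 0 → False := by
      intro h0 h1 h2
      obtain ⟨r', s', ha', hb', hc''⟩ := exists_factor (c 1 0) (c 1 1) (c 1 2)
      obtain ⟨v, hv, hv'⟩ := exists_zero_of_factor (r := r') (s := s')
      exact hex v hv (by simp [h0, h1, h2]) (by rw [ha', hb', hc'', hv'])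
    by_cases hr : r = 0
    · exact hzero (by simp [ha, hr]) (by simp [hb, hr]) (by simp [hc', hr])
    by_cases hs : s = 0
    · exact hzero (by simp [ha, hs]) (by simp [hb, hs]) (by simp [hc', hs])
    have hprod : (c 1 0 * r 0 ^ 2 + c 1 1 * (r 0 * r 1) + c 1 2 * r 1 ^ 2) *
        (c 1 0 * s 0 ^ 2 + c 1 1 * (s 0 * s 1) + c 1 2 * s 1 ^ 2) = 0 := by
      rw [← hres, res, ha, hb, hc']
      ring
    rcases mul_eq_zero.1 hprod with h1 | h1
    · exact hex r hr (by rw [ha, hb, hc']; ring) h1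
    · exact hex s hs (by rw [ha, hb, hc']; ring) h1
  · intro h v hv hF
    apply h
    have hA : c 0 0 * v 0 ^ 2 + c 0 1 * (v 0 * v 1) + c 0 2 * v 1 ^ 2 = 0 := congrFun hF 0
    have hB : c 1 0 * v 0 ^ 2 + c 1 1 * (v 0 * v 1) + c 1 2 * v 1 ^ 2 = 0 := congrFun hF 1
    rw [ne_zero_iff] at hv
    have h1 : v 1 * ((c 0 0 * c 1 1 - c 0 1 * c 1 0) * v 0 +
        (c 0 0 * c 1 2 - c 0 2 * c 1 0) * v 1) = 0 := by
      linear_combination c 0 0 * hB - c 1 0 * hA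
    have h2 : v 0 * ((c 0 0 * c 1 2 - c 0 2 * c 1 0) * v 0 +
        (c 0 1 * c 1 2 - c 0 2 * c 1 1) * v 1) = 0 := by
      linear_combination c 1 2 * hA - c 0 2 * hB
    by_cases hv1 : v 1 = 0
    · have hv0 : v 0 ≠ 0 := by simpa [hv1] using hv
      simp [hv1, hv0] at hA hB
      simp [res, hA, hB]
    by_cases hv0 : v 0 = 0
    · simp [hv1, hv0] at hA hB
      simp [res, hA, hB]
    have h1' := (mul_eq_zero.1 h1).resolve_left hv1
    have h2' := (mul_eq_zero.1 h2).resolve_left hv0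
    have : res c * v 0 = 0 := by
      rw [res]
      linear_combination (c 0 0 * c 1 2 - c 0 2 * c 1 0) * h2' -
        (c 0 1 * c 1 2 - c 0 2 * c 1 1) * h1'
    exact (mul_eq_zero.1 this).resolve_right hv0

lemma continuous_res : Continuous res := by unfold res; fun_prop

lemma quadForm_smul_coef (k : ℂ) (c : Coef) (v : Fin 2 → ℂ) :
    quadForm (k • c) v = k • quadForm c v := by
  ext i; simp [quadForm]; ring

lemma jac_smul_coef (k : ℂ) (c : Coef) (v : Fin 2 → ℂ) : jac (k • c) v = k ^ 2 * jac c v := by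
  simp [jac]; ring

lemma jac_smul (c : Coef) (k : ℂ) (v : Fin 2 → ℂ) : jac c (k • v) = k ^ 2 * jac c v := by
  simp [jac]; ring

lemma Represents.smul {c : Coef} {f : OnePoint ℂ → OnePoint ℂ} (h : Represents c f) {k : ℂ}
    (hk : k ≠ 0) : Represents (k • c) f := by
  refine ⟨fun v hv => ?_, ?_⟩
  · rw [quadForm_smul_coef]
    exact smul_ne_zero hk (h.1 v hv)
  · rw [← h.2]
    funext z
    rw [ratMap, quadForm_smul_coef, proj_smul hk, ratMap]

/-- The forms of `d` are `v 1` times linear forms `L₀, L₁`, and the hypothesis becomes `F₀ L₁ = F₁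
L₀`. Its four coefficients are a linear system for `L₀, L₁` given, up to signs and ordering, by the
Sylvester matrix of `F₀, F₁`. -/
lemma eq_zero_of_wedge_quadForm_eq_zero {c d : Coef} (hc : res c ≠ 0)
    (h : ∀ v, wedge (quadForm c v) (quadForm d v) = 0) (h0 : d 0 0 = 0) (h1 : d 1 0 = 0) :
    d = 0 := by
  -- The quartic form is divisible by `v 1`, so four further points recover its four remaining
  -- coefficients.
  have e1 := h ![1, 1]
  have e2 := h ![1, -1]
  have e3 := h ![1, 2]
  have e4 := h ![0, 1]
  simp only [wedge, quadForm, h0, h1, Matrix.cons_val_zero, Matrix.cons_val_one] at e1 e2 e3 e4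
  have k3 : c 0 2 * d 1 2 - c 1 2 * d 0 2 = 0 := by linear_combination e4
  have k0 : c 0 0 * d 1 1 - c 1 0 * d 0 1 = 0 := by
    linear_combination 2 * e4 + e1 - (1 / 6 : ℂ) * e3 - (1 / 3) * e2
  have k1 : c 0 0 * d 1 2 + c 0 1 * d 1 1 - c 1 0 * d 0 2 - c 1 1 * d 0 1 = 0 := by
    linear_combination (1 / 2 : ℂ) * e1 + (1 / 2) * e2 - e4
  have k2 : c 0 1 * d 1 2 + c 0 2 * d 1 1 - c 1 1 * d 0 2 - c 1 2 * d 0 1 = 0 := by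
    linear_combination e1 - k0 - k1 - k3
  let M : Matrix (Fin 4) (Fin 4) ℂ :=
    !![-c 1 0, 0, c 0 0, 0; -c 1 1, -c 1 0, c 0 1, c 0 0; -c 1 2, -c 1 1, c 0 2, c 0 1;
      0, -c 1 2, 0, c 0 2]
  have hdet : M.det = res c := by
    simp [M, Matrix.det_succ_row_zero, Fin.sum_univ_succ, Fin.succAbove, res]
    ring
  have hz : ![d 0 1, d 0 2, d 1 1, d 1 2] = 0 := by
    apply Matrix.eq_zero_of_mulVec_eq_zero (M := M) (by rwa [hdet])
    ext i
    fin_cases i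
    · simp [M, Matrix.mulVec, dotProduct, Fin.sum_univ_succ]; linear_combination k0
    · simp [M, Matrix.mulVec, dotProduct, Fin.sum_univ_succ]; linear_combination k1
    · simp [M, Matrix.mulVec, dotProduct, Fin.sum_univ_succ]; linear_combination k2
    · simp [M, Matrix.mulVec, dotProduct, Fin.sum_univ_succ]; linear_combination k3
  ext i j
  have z0 := congrFun hz 0
  have z1 := congrFun hz 1
  have z2 := congrFun hz 2
  have z3 := congrFun hz 3
  simp at z0 z1 z2 z3
  fin_cases i <;> fin_cases j <;> simp [h0, h1, z0, z1, z2, z3]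

/-- The coefficients of a quadratic rational map are unique up to a scalar. -/
lemma Represents.exists_smul {c d : Coef} {f : OnePoint ℂ → OnePoint ℂ} (hc' : Represents c f)
    (hd : Represents d f) : ∃ k : ℂ, k ≠ 0 ∧ d = k • c := by
  have hw : ∀ v, wedge (quadForm c v) (quadForm d v) = 0 := by
    intro v
    by_cases hv : v = 0
    · simp [hv, quadForm, wedge]
    · rw [← proj_eq_iff (hc'.1 v hv) (hd.1 v hv), ← ratMap_proj c hv, ← ratMap_proj d hv,
        hc'.2, hd.2]
  have h10 : (![1, 0] : Fin 2 → ℂ) ≠ 0 := (ne_zero_iff _).2 (by simp)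
  have hne := hc'.1 _ h10
  have hw0 := hw ![1, 0]
  -- The scalar is read off from the common image of `[1 : 0]`; subtracting `k • c` then kills the
  -- coefficients of `v 0 ^ 2`.
  have : ∃ k : ℂ, d 0 0 = k * c 0 0 ∧ d 1 0 = k * c 1 0 := by
    rw [ne_zero_iff] at hne
    simp [quadForm, wedge] at hne hw0
    rcases hne with h | h
    · exact ⟨d 0 0 / c 0 0, by field_simp, by field_simp; linear_combination hw0⟩
    · exact ⟨d 1 0 / c 1 0, by field_simp; linear_combination -hw0, by field_simp⟩
  obtain ⟨k, hk0, hk1⟩ := this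
  have hdk : d - k • c = 0 := by
    refine eq_zero_of_wedge_quadForm_eq_zero ((nondeg_iff c).1 hc'.1) (fun v => ?_) ?_ ?_
    · have := hw v
      simp only [wedge, quadForm, Pi.sub_apply, Pi.smul_apply, smul_eq_mul] at this ⊢
      linear_combination this
    · simp [hk0]
    · simp [hk1]
  have hdk' : d = k • c := sub_eq_zero.1 hdk
  refine ⟨k, fun h => ?_, hdk'⟩
  apply hd.1 _ h10
  rw [hdk', h, quadForm_smul_coef, zero_smul]

/-! ### The space of quadratic rational maps -/

/-- Coefficients are unique up to a scalar, so the saturation of an open set is a union of preimages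
of it under scalings. -/
lemma isOpenMap_ofCoef : IsOpenMap Rat2.ofCoef := by
  intro U hU
  have hs : Rat2.ofCoef ⁻¹' (Rat2.ofCoef '' U) = ⋃ k : {k : ℂ // k ≠ 0},
      (fun c : {c : Coef // Nondeg c} =>
        (⟨k.1 • c.1, (Represents.smul ⟨c.2, rfl⟩ k.2).1⟩ : {c : Coef // Nondeg c})) ⁻¹' U := by
    ext c
    simp only [Set.mem_preimage, Set.mem_image, Set.mem_iUnion]
    constructor
    · rintro ⟨d, hd, h⟩
      obtain ⟨k, hk, h'⟩ := Represents.exists_smul (c := c.1) (d := d.1) ⟨c.2, rfl⟩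
        ⟨d.2, congrArg Subtype.val h⟩
      refine ⟨⟨k, hk⟩, ?_⟩
      have : d = ⟨k • c.1, (Represents.smul ⟨c.2, rfl⟩ hk).1⟩ := Subtype.ext h'
      rwa [← this]
    · rintro ⟨k, hk⟩
      exact ⟨_, hk, Subtype.ext (Represents.smul ⟨c.2, rfl⟩ k.2).2⟩
  change IsOpen (Rat2.ofCoef ⁻¹' (Rat2.ofCoef '' U))
  rw [hs]
  refine isOpen_iUnion fun k => hU.preimage ?_
  have h : Continuous fun c : {c : Coef // Nondeg c} => k.1 • c.1 :=
    continuous_subtype_val.const_smul k.1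
  exact h.subtype_mk _

lemma continuous_ofCoef : Continuous Rat2.ofCoef := continuous_coinduced_rng

lemma surjective_ofCoef : Function.Surjective Rat2.ofCoef := by
  rintro ⟨f, c, hf⟩
  exact ⟨⟨c, hf.1⟩, Subtype.ext hf.2⟩

instance : SecondCountableTopology Rat2 :=
  (isOpenMap_ofCoef.isQuotientMap continuous_ofCoef
    surjective_ofCoef).secondCountableTopology isOpenMap_ofCoef

lemma continuous_eval (z : OnePoint ℂ) : Continuous fun f : Rat2 => f.1 z := by
  refine continuous_coinduced_dom.2 (continuous_iff_continuousAt.2 fun c => ?_)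
  refine ContinuousAt.comp (f := fun c : {c : Coef // Nondeg c} => quadForm c.1 (hc z)) (g := proj)
    (continuousAt_proj (c.2 _ (hc_ne_zero z))) (Continuous.continuousAt ?_)
  have h : ∀ i j, Continuous fun c : {c : Coef // Nondeg c} => c.1 i j := fun i j =>
    (continuous_apply_apply i j).comp continuous_subtype_val
  refine continuous_pi fun i => ?_
  exact (((h i 0).mul continuous_const).add ((h i 1).mul continuous_const)).add
    ((h i 2).mul continuous_const)

/-- Evaluation at all points injects the space continuously into a product of spheres. -/
instance : T2Space Rat2 := by
  have : Continuous fun f : Rat2 => f.1 := continuous_pi continuous_eval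
  exact T2Space.of_injective_continuous (f := fun f : Rat2 => f.1) Subtype.val_injective this

lemma isLiftSystem_rat2 : IsLiftSystem (fun (c : Coef) (f : Rat2) => Represents c f.1) where
  exists_lift f := f.2
  eventually_mem := by
    rintro c f hf U hU
    have hfc : Rat2.ofCoef ⟨c, hf.1⟩ = f := Subtype.ext hf.2
    have := continuous_ofCoef.continuousAt (x := ⟨c, hf.1⟩) (by rwa [hfc])
    obtain ⟨V, hV, hVU⟩ := (mem_nhds_subtype _ _ _).1 (Filter.mem_map.1 this)
    filter_upwards [hV] with d hd y hy
    have hfd : Rat2.ofCoef ⟨d, hy.1⟩ = y := Subtype.ext hy.2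
    have : Rat2.ofCoef ⟨d, hy.1⟩ ∈ U :=
      hVU (show (⟨d, hy.1⟩ : {c : Coef // Nondeg c}) ∈ _ from hd)
    rwa [hfd] at this
  eventually_exists := by
    rintro c f hf W hW
    have hfc : Rat2.ofCoef ⟨c, hf.1⟩ = f := Subtype.ext hf.2
    have h1 : Subtype.val ⁻¹' W ∈ 𝓝 (⟨c, hf.1⟩ : {c : Coef // Nondeg c}) :=
      continuous_subtype_val.continuousAt hW
    have h2 := isOpenMap_ofCoef.image_mem_nhds h1
    rw [hfc] at h2
    filter_upwards [h2]
    rintro _ ⟨d, hd, rfl⟩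
    exact ⟨d.1, hd, d.2, rfl⟩

lemma isLiftSystem_fm : IsLiftSystem Rat2fm.IsLift :=
  (isLiftSystem_rat2.prod isLiftSystem_isHom.pi).subtype _

lemma isLiftSystem_tm : IsLiftSystem Rat2tm.IsLift :=
  (isLiftSystem_rat2.prod (isLiftSystem_isHom.pi.prod isLiftSystem_isHom.pi)).subtype _

/-! ### Markings in terms of lifts -/

/-- The fixed points of `quadForm c` are the lines spanned by the `w i`, with multiplicity. -/
def FixedBy (c : Coef) (w : Fin 3 → Fin 2 → ℂ) : Prop :=
  ∃ k : ℂ, k ≠ 0 ∧ ∀ v, wedge v (quadForm c v) = k * ∏ i, wedge v (w i)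

/-- All choices of homogeneous coordinates differ by scalars, which are absorbed into the constant
`k`; the marking can thus be tested on any lift. -/
lemma isFixedMarking_iff {c : Coef} {f : OnePoint ℂ → OnePoint ℂ} {z : Fin 3 → OnePoint ℂ}
    {w : Fin 3 → Fin 2 → ℂ} (hf : Represents c f) (hw : ∀ i, IsHom (w i) (z i)) :
    IsFixedMarking f z ↔ FixedBy c w := by
  choose a ha haw using fun i => (hw i).exists_smul
  have hprod : ∀ v, ∏ i, wedge v (w i) = (∏ i, a i) * ∏ i, wedge v (hc (z i)) := by
    intro v
    rw [← Finset.prod_mul_distrib]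
    refine Finset.prod_congr rfl fun i _ => ?_
    rw [haw i, wedge_smul_right]
  have hA : ∏ i, a i ≠ 0 := Finset.prod_ne_zero_iff.2 fun i _ => ha i
  constructor
  · rintro ⟨d, hd, k, hk, h⟩
    obtain ⟨l, hl, rfl⟩ := hd.exists_smul hf
    refine ⟨l * k * (∏ i, a i)⁻¹, mul_ne_zero (mul_ne_zero hl hk) (inv_ne_zero hA), fun v => ?_⟩
    rw [quadForm_smul_coef, wedge_smul_right, h, hprod]
    field_simp
  · rintro ⟨k, hk, h⟩
    refine ⟨c, hf, k * ∏ i, a i, mul_ne_zero hk hA, fun v => ?_⟩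
    rw [h, hprod, mul_assoc]

lemma isCritical_iff {c : Coef} {f : OnePoint ℂ → OnePoint ℂ} {p : OnePoint ℂ}
    {u : Fin 2 → ℂ} (hf : Represents c f) (hu : IsHom u p) :
    IsCritical f p ↔ jac c u = 0 := by
  obtain ⟨a, ha, rfl⟩ := hu.exists_smul
  rw [jac_smul, mul_eq_zero, or_iff_right (pow_ne_zero 2 ha)]
  constructor
  · rintro ⟨d, hd, h⟩
    obtain ⟨l, hl, rfl⟩ := hd.exists_smul hf
    rw [jac_smul_coef, ← det_fderiv_eq_jac, h, mul_zero]
  · intro h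
    exact ⟨c, hf, by rw [det_fderiv_eq_jac, h]⟩

/-- The symmetric bilinear form of the quadratic form `jac c`. -/
def jacPolar (c : Coef) (u v : Fin 2 → ℂ) : ℂ :=
  4 * ((c 0 0 * c 1 1 - c 0 1 * c 1 0) * (u 0 * v 0) +
    (c 0 0 * c 1 2 - c 0 2 * c 1 0) * (u 0 * v 1 + u 1 * v 0) +
    (c 0 1 * c 1 2 - c 0 2 * c 1 1) * (u 1 * v 1))

/-- The discriminant of `jac c` is `16 * res c`. At a zero `u` of `jac c` this shows that the polar
form with any transverse `v` is nonzero, so critical points are simple. -/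
lemma jacPolar_sq (c : Coef) (u v : Fin 2 → ℂ) :
    jacPolar c u v ^ 2 = 16 * res c * wedge u v ^ 2 + 4 * jac c u * jac c v := by
  simp only [jacPolar, res, wedge, jac]; ring

/-- This is `jac c` evaluated on Cramer's rule `wedge u u' • v = wedge v u' • u - wedge v u • u'`.
-/
lemma jac_mul_wedge_sq (c : Coef) (u u' v : Fin 2 → ℂ) :
    jac c v * wedge u u' ^ 2 = jac c u * wedge v u' ^ 2 + jac c u' * wedge v u ^ 2 -
      jacPolar c u u' * (wedge v u * wedge v u') := by
  simp only [jacPolar, wedge, jac]; ring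

lemma jac_eq_zero_iff {c : Coef} (hres : res c ≠ 0) {u : Fin 2 → Fin 2 → ℂ}
    (hu : wedge (u 0) (u 1) ≠ 0) (h : ∀ j, jac c (u j) = 0) (v : Fin 2 → ℂ) :
    jac c v = 0 ↔ wedge v (u 0) = 0 ∨ wedge v (u 1) = 0 := by
  have hB : jacPolar c (u 0) (u 1) ≠ 0 := by
    intro hB
    have := jacPolar_sq c (u 0) (u 1)
    rw [hB, h 0, h 1] at this
    have h' : 16 * res c * wedge (u 0) (u 1) ^ 2 ≠ 0 :=
      mul_ne_zero (mul_ne_zero (by norm_num) hres) (pow_ne_zero 2 hu)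
    exact h' (by linear_combination -this)
  have := jac_mul_wedge_sq c (u 0) (u 1) v
  rw [h 0, h 1] at this
  rw [← mul_eq_zero]
  constructor
  · intro hv
    rw [hv] at this
    have h2 : jacPolar c (u 0) (u 1) * (wedge v (u 0) * wedge v (u 1)) = 0 := by
      linear_combination this
    exact (mul_eq_zero.1 h2).resolve_left hB
  · intro hv
    rw [hv] at this
    have h2 : jac c v * wedge (u 0) (u 1) ^ 2 = 0 := by linear_combination this
    exact (mul_eq_zero.1 h2).resolve_right (pow_ne_zero 2 hu)

lemma isCriticalMarking_iff {c : Coef} {f : OnePoint ℂ → OnePoint ℂ} {m : Fin 2 → OnePoint ℂ}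
    {u : Fin 2 → Fin 2 → ℂ} (hf : Represents c f) (hu : ∀ j, IsHom (u j) (m j)) :
    IsCriticalMarking f m ↔ wedge (u 0) (u 1) ≠ 0 ∧ ∀ j, jac c (u j) = 0 := by
  rw [IsCriticalMarking, Ne, (hu 0).eq_iff_wedge (hu 1)]
  refine and_congr_right fun hw => ?_
  constructor
  · intro h j
    rw [← isCritical_iff hf (hu j), h]
    fin_cases j <;> simp
  · intro h p
    rw [isCritical_iff hf (isHom_hc p), jac_eq_zero_iff ((nondeg_iff c).1 hf.1) hw h,
      (isHom_hc p).eq_iff_wedge (hu 0), (isHom_hc p).eq_iff_wedge (hu 1)]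

/-- The zeros come from splitting `jac c`. If the two factors were proportional, the discriminant
`16 * res c`, which is the square of their wedge, would vanish. -/
lemma exists_critical {c : Coef} (hres : res c ≠ 0) :
    ∃ u : Fin 2 → Fin 2 → ℂ, wedge (u 0) (u 1) ≠ 0 ∧ ∀ j, jac c (u j) = 0 := by
  obtain ⟨r, s, h0, h1, h2⟩ := exists_factor (2 * (c 0 0 * c 1 1 - c 0 1 * c 1 0))
    (4 * (c 0 0 * c 1 2 - c 0 2 * c 1 0)) (2 * (c 0 1 * c 1 2 - c 0 2 * c 1 1))
  refine ⟨![r, s], ?_, ?_⟩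
  · intro hw
    simp only [Matrix.cons_val_zero, Matrix.cons_val_one, wedge] at hw
    have : 16 * res c = 0 := by
      calc 16 * res c = (4 * (c 0 0 * c 1 2 - c 0 2 * c 1 0)) ^ 2 -
            4 * (2 * (c 0 0 * c 1 1 - c 0 1 * c 1 0)) * (2 * (c 0 1 * c 1 2 - c 0 2 * c 1 1)) := by
            rw [res]; ring
        _ = (r 0 * s 1 - r 1 * s 0) ^ 2 := by rw [h0, h1, h2]; ring
        _ = 0 := by rw [hw]; ring
    exact hres (by linear_combination (1 / 16 : ℂ) * this)
  · intro j
    fin_cases j <;> simp only [jac, h0, h1, h2] <;> simp <;> ring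

/-! ### Lifts of marked maps -/

lemma Rat2fm.IsLift.fixedBy {p : Coef × (Fin 3 → Fin 2 → ℂ)} {x : Rat2fm}
    (h : Rat2fm.IsLift p x) : FixedBy p.1 p.2 :=
  (isFixedMarking_iff h.1 h.2).1 x.2

lemma Rat2fm.IsLift.eq {p : Coef × (Fin 3 → Fin 2 → ℂ)} {x y : Rat2fm}
    (hx : Rat2fm.IsLift p x) (hy : Rat2fm.IsLift p y) : x = y := by
  refine Subtype.ext (Prod.ext (Subtype.ext ?_) (funext fun i => ?_))
  · rw [← hx.1.2, ← hy.1.2]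
  · rw [← (hx.2 i).2, ← (hy.2 i).2]

lemma Rat2fm.exists_isLift {c : Coef} {w : Fin 3 → Fin 2 → ℂ} (hres : res c ≠ 0)
    (hw : ∀ i, w i ≠ 0) (h : FixedBy c w) : ∃ x, Rat2fm.IsLift (c, w) x := by
  have hr : Represents c (ratMap c) := ⟨(nondeg_iff c).2 hres, rfl⟩
  exact ⟨⟨(⟨ratMap c, c, hr⟩, fun i => proj (w i)),
    (isFixedMarking_iff hr fun i => isHom_proj (hw i)).2 h⟩, hr, fun i => isHom_proj (hw i)⟩

lemma Rat2tm.IsLift.forget {c : Coef} {w : Fin 3 → Fin 2 → ℂ} {u : Fin 2 → Fin 2 → ℂ} {x : Rat2tm}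
    (h : Rat2tm.IsLift (c, w, u) x) : Rat2fm.IsLift (c, w) (forget x) :=
  ⟨h.1, h.2.1⟩

lemma Rat2tm.IsLift.critical {p : Coef × (Fin 3 → Fin 2 → ℂ) × (Fin 2 → Fin 2 → ℂ)} {x : Rat2tm}
    (h : Rat2tm.IsLift p x) : wedge (p.2.2 0) (p.2.2 1) ≠ 0 ∧ ∀ j, jac p.1 (p.2.2 j) = 0 :=
  (isCriticalMarking_iff h.1 h.2.2).1 x.2.2

lemma Rat2tm.IsLift.eq {p : Coef × (Fin 3 → Fin 2 → ℂ) × (Fin 2 → Fin 2 → ℂ)} {x y : Rat2tm}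
    (hx : Rat2tm.IsLift p x) (hy : Rat2tm.IsLift p y) : x = y := by
  refine Subtype.ext (Prod.ext (Subtype.ext ?_) (Prod.ext (funext fun i => ?_)
    (funext fun j => ?_)))
  · rw [← hx.1.2, ← hy.1.2]
  · rw [← (hx.2.1 i).2, ← (hy.2.1 i).2]
  · rw [← (hx.2.2 j).2, ← (hy.2.2 j).2]

lemma Rat2fm.IsLift.exists_tm {c : Coef} {w : Fin 3 → Fin 2 → ℂ} {y : Rat2fm}
    (h : Rat2fm.IsLift (c, w) y) {u : Fin 2 → Fin 2 → ℂ} (hu : wedge (u 0) (u 1) ≠ 0)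
    (hj : ∀ j, jac c (u j) = 0) : ∃ x, Rat2tm.IsLift (c, w, u) x ∧ QuadRat.forget x = y := by
  have hu0 : ∀ j, u j ≠ 0 := by
    intro j
    have := ne_zero_of_wedge hu
    fin_cases j
    · exact this.1
    · exact this.2
  refine ⟨⟨(y.1.1, y.1.2, fun j => proj (u j)), y.2,
    (isCriticalMarking_iff h.1 fun j => isHom_proj (hu0 j)).2 ⟨hu, hj⟩⟩,
    ⟨h.1, h.2, fun j => isHom_proj (hu0 j)⟩, rfl⟩

lemma surjective_forget : Function.Surjective forget := by
  intro y
  obtain ⟨⟨c, w⟩, h⟩ := isLiftSystem_fm.exists_lift y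
  obtain ⟨u, hu, hj⟩ := exists_critical ((nondeg_iff c).1 h.1.1)
  obtain ⟨x, -, hx⟩ := h.exists_tm hu hj
  exact ⟨x, hx⟩

/-! ### The action of Möbius transformations -/

/-- The Möbius transformation given by an invertible matrix. -/
def mobius (g : GL (Fin 2) ℂ) : Rat1 := ⟨MulAction.toPermHom (GL (Fin 2) ℂ) (OnePoint ℂ) g, g, rfl⟩

lemma exists_mobius (g : Rat1) : ∃ A, g = mobius A := by
  obtain ⟨_, A, rfl⟩ := g
  exact ⟨A, rfl⟩

lemma Rat2fm.IsLift.mobius (g : GL (Fin 2) ℂ) {p : Coef × (Fin 3 → Fin 2 → ℂ)} {x : Rat2fm}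
    (h : Rat2fm.IsLift p x) :
    Rat2fm.IsLift (conjCoef g.1 (g⁻¹).1 p.1, fun i => g.1.mulVec (p.2 i)) (mobius g • x) :=
  ⟨represents_conj g h.1, fun i => isHom_mulVec g (h.2 i)⟩

lemma Rat2tm.IsLift.mobius (g : GL (Fin 2) ℂ)
    {p : Coef × (Fin 3 → Fin 2 → ℂ) × (Fin 2 → Fin 2 → ℂ)} {x : Rat2tm}
    (h : Rat2tm.IsLift p x) :
    Rat2tm.IsLift (conjCoef g.1 (g⁻¹).1 p.1, fun i => g.1.mulVec (p.2.1 i),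
      fun j => g.1.mulVec (p.2.2 j)) (mobius g • x) :=
  ⟨represents_conj g h.1, fun i => isHom_mulVec g (h.2.1 i), fun j => isHom_mulVec g (h.2.2 j)⟩

lemma analyticAt_of_contDiff {E F : Type} [NormedAddCommGroup E] [NormedSpace ℂ E]
    [NormedAddCommGroup F] [NormedSpace ℂ F] {f : E → F} (h : ContDiff ℂ ω f) (x : E) :
    AnalyticAt ℂ f x :=
  h.contDiffAt.analyticAt

lemma contDiff_mulVec (A : Matrix (Fin 2) (Fin 2) ℂ) :
    ContDiff ℂ ω (fun v : Fin 2 → ℂ => A.mulVec v) := by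
  rw [contDiff_pi]
  intro i
  simp only [Matrix.mulVec, dotProduct]
  fun_prop

lemma contDiff_conjCoef (A B : Matrix (Fin 2) (Fin 2) ℂ) : ContDiff ℂ ω (conjCoef A B) := by
  rw [contDiff_pi]
  intro i
  rw [contDiff_pi]
  intro j
  fin_cases j <;> simp only [conjCoef, Fin.sum_univ_two] <;> simp <;> fun_prop

lemma liftsAt_fm_smul (g : Rat1) (x : Rat2fm) :
    LiftsAt Rat2fm.IsLift Rat2fm.IsLift (fun y => g • y) x := by
  obtain ⟨A, rfl⟩ := exists_mobius g
  intro p _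
  refine ⟨fun q => (conjCoef A.1 (A⁻¹).1 q.1, fun i => A.1.mulVec (q.2 i)),
    analyticAt_of_contDiff ?_ p, Filter.Eventually.of_forall fun q y hy => hy.mobius A⟩
  refine ((contDiff_conjCoef _ _).comp contDiff_fst).prodMk (contDiff_pi.2 fun i => ?_)
  exact (contDiff_mulVec A.1).comp ((contDiff_apply ℂ _ i).comp contDiff_snd)

lemma liftsAt_tm_smul (g : Rat1) (x : Rat2tm) :
    LiftsAt Rat2tm.IsLift Rat2tm.IsLift (fun y => g • y) x := by
  obtain ⟨A, rfl⟩ := exists_mobius g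
  intro p _
  refine ⟨fun q => (conjCoef A.1 (A⁻¹).1 q.1, fun i => A.1.mulVec (q.2.1 i),
    fun j => A.1.mulVec (q.2.2 j)),
    analyticAt_of_contDiff ?_ p, Filter.Eventually.of_forall fun q y hy => hy.mobius A⟩
  refine ((contDiff_conjCoef _ _).comp contDiff_fst).prodMk
    ((contDiff_pi.2 fun i => ?_).prodMk (contDiff_pi.2 fun i => ?_))
  · exact (contDiff_mulVec A.1).comp ((contDiff_apply ℂ _ i).comp (contDiff_fst.comp contDiff_snd))
  · exact (contDiff_mulVec A.1).comp ((contDiff_apply ℂ _ i).comp (contDiff_snd.comp contDiff_snd))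

instance : ContinuousConstSMul Rat1 Rat2fm where
  continuous_const_smul g := continuous_iff_continuousAt.2 fun x =>
    (liftsAt_fm_smul g x).continuousAt isLiftSystem_fm isLiftSystem_fm

instance : ContinuousConstSMul Rat1 Rat2tm where
  continuous_const_smul g := continuous_iff_continuousAt.2 fun x =>
    (liftsAt_tm_smul g x).continuousAt isLiftSystem_tm isLiftSystem_tm

lemma isBiholomorphic_fm_smul (g : Rat1) : IsBiholomorphic Rat2fm.HolAt Rat2fm.HolAt
    (Homeomorph.smul g : Rat2fm ≃ₜ Rat2fm).toOpenPartialHomeomorph := by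
  intro x _ h
  constructor
  · intro hh
    exact (liftsAt_fm_smul g x).holByLifts hh
  · intro hh
    have h1 := (liftsAt_fm_smul g⁻¹ (g • x)).holByLifts (g := h ∘ fun y => g • y)
      (by rw [inv_smul_smul]; exact hh)
    have h2 : (h ∘ fun y : Rat2fm => g • y) ∘ (fun y => g⁻¹ • y) = h := by
      funext y; simp
    rw [h2] at h1
    exact h1

lemma isOpenQuotientMap_toModuli_fm : IsOpenQuotientMap Rat2fm.toModuli :=
  MulAction.isOpenQuotientMap_quotientMk

lemma isOpenQuotientMap_toModuli_tm : IsOpenQuotientMap Rat2tm.toModuli :=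
  MulAction.isOpenQuotientMap_quotientMk

/-! ### Charts of the space of fixed point marked maps -/

/-- The fixed points and the normalized denominator of a map that does not fix `OnePoint.infty`. -/
def fmCoord (p : Coef × (Fin 3 → Fin 2 → ℂ)) : EuclideanSpace ℂ (Fin 5) :=
  !₂[p.2 0 0 / p.2 0 1, p.2 1 0 / p.2 1 1, p.2 2 0 / p.2 2 1, p.1 1 1 / p.1 1 0,
    p.1 1 2 / p.1 1 0]

/-- The marked map with given finite fixed points and normalized denominator. -/
def fmSection (t : EuclideanSpace ℂ (Fin 5)) : Coef × (Fin 3 → Fin 2 → ℂ) :=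
  (![![t 3 + (t 0 + t 1 + t 2), t 4 - (t 0 * t 1 + t 0 * t 2 + t 1 * t 2), t 0 * t 1 * t 2],
    ![1, t 3, t 4]], ![![t 0, 1], ![t 1, 1], ![t 2, 1]])

lemma fixedBy_fmSection (t : EuclideanSpace ℂ (Fin 5)) :
    FixedBy (fmSection t).1 (fmSection t).2 := by
  refine ⟨1, one_ne_zero, fun v => ?_⟩
  simp [fmSection, Fin.prod_univ_three, wedge, quadForm]
  ring

/-- The normalizations force the constant in `FixedBy` to be `1`; comparing the other coefficients
of `z q(z) - p(z) = ∏ (z - zᵢ)` expresses the numerator through the denominator and the fixed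
points. -/
lemma eq_fmSection {c : Coef} {w : Fin 3 → Fin 2 → ℂ} (h : FixedBy c w) (hc1 : c 1 0 = 1)
    (hw : ∀ i, w i 1 = 1) : (c, w) = fmSection (fmCoord (c, w)) := by
  obtain ⟨k, -, h⟩ := h
  have e0 := h ![1, 0]
  have e1 := h ![0, 1]
  have e2 := h ![1, 1]
  have e3 := h ![1, -1]
  simp [Fin.prod_univ_three, wedge, quadForm, hw, hc1] at e0 e1 e2 e3
  subst e0
  have h02 : c 0 2 = w 0 0 * w 1 0 * w 2 0 := by linear_combination e1
  have h00 : c 0 0 = c 1 1 + (w 0 0 + w 1 0 + w 2 0) := by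
    linear_combination (-1 / 2 : ℂ) * e2 + (1 / 2 : ℂ) * e3 - h02
  have h01 : c 0 1 = c 1 2 - (w 0 0 * w 1 0 + w 0 0 * w 2 0 + w 1 0 * w 2 0) := by
    linear_combination -e2 - h00 - h02
  refine Prod.ext (funext fun i => funext fun j => ?_) (funext fun i => funext fun j => ?_)
  · fin_cases i <;> fin_cases j <;> simp [fmSection, fmCoord, hw, hc1, h00, h01, h02]
  · fin_cases i <;> fin_cases j <;> simp [fmSection, fmCoord, hw]

lemma Rat2fm.IsLift.smul {c : Coef} {w : Fin 3 → Fin 2 → ℂ} {x : Rat2fm}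
    (h : Rat2fm.IsLift (c, w) x) {k : ℂ} (hk : k ≠ 0) {a : Fin 3 → ℂ} (ha : ∀ i, a i ≠ 0) :
    Rat2fm.IsLift (k • c, fun i => a i • w i) x :=
  ⟨h.1.smul hk, fun i => ⟨smul_ne_zero (ha i) (h.2 i).1, by rw [proj_smul (ha i)]; exact (h.2 i).2⟩⟩

lemma Rat2fm.IsLift.coef_ne_zero {p : Coef × (Fin 3 → Fin 2 → ℂ)} {x : Rat2fm}
    (h : Rat2fm.IsLift p x) : x.1.1.1 OnePoint.infty ≠ OnePoint.infty ↔ p.1 1 0 ≠ 0 := by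
  have : x.1.1.1 OnePoint.infty = proj (quadForm p.1 ![1, 0]) := by
    rw [← h.1.2]; rfl
  rw [this, proj]
  simp [quadForm]

lemma FixedBy.snd_ne_zero {c : Coef} {w : Fin 3 → Fin 2 → ℂ} (h : FixedBy c w) (hc1 : c 1 0 ≠ 0)
    (i : Fin 3) : w i 1 ≠ 0 := by
  obtain ⟨k, -, h⟩ := h
  have e0 := h ![1, 0]
  simp [wedge, quadForm] at e0
  rw [e0] at hc1
  exact (Finset.prod_ne_zero_iff.1 (right_ne_zero_of_mul hc1)) i (Finset.mem_univ i)

lemma Rat2fm.IsLift.fmSection {p : Coef × (Fin 3 → Fin 2 → ℂ)} {x : Rat2fm}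
    (h : Rat2fm.IsLift p x) (hx : x.1.1.1 OnePoint.infty ≠ OnePoint.infty) : Rat2fm.IsLift (fmSection (fmCoord p)) x := by
  obtain ⟨c, w⟩ := p
  have hc1 := h.coef_ne_zero.1 hx
  have hw := h.fixedBy.snd_ne_zero hc1
  simp only at hc1 hw
  have h' := h.smul (inv_ne_zero hc1) (a := fun i => (w i 1)⁻¹) fun i => inv_ne_zero (hw i)
  have he := eq_fmSection h'.fixedBy (by simp [hc1]) (by simp [hw])
  have hcoord : fmCoord ((c 1 0)⁻¹ • c, fun i => (w i 1)⁻¹ • w i) = fmCoord (c, w) := by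
    ext i
    fin_cases i <;> simp [fmCoord, hc1, hw] <;> field_simp
  rw [← hcoord, ← he]
  exact h'

lemma isSmoothPoint_fm_of_ne {x : Rat2fm} (hx : x.1.1.1 OnePoint.infty ≠ OnePoint.infty) :
    IsSmoothPoint 5 Rat2fm.HolAt x := by
  choose ℓ hℓ using isLiftSystem_fm.exists_lift
  have : Nonempty Rat2fm := ⟨tripleFixed⟩
  let S : Set Rat2fm := {y | y.1.1.1 OnePoint.infty ≠ OnePoint.infty}
  have hS : IsOpen S := by
    have : Continuous fun y : Rat2fm => y.1.1.1 OnePoint.infty :=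
      (continuous_eval OnePoint.infty).comp (continuous_fst.comp continuous_subtype_val)
    exact isOpen_ne.preimage this
  -- Every coordinate is a quotient of entries of one homogeneous vector, so the arbitrary choice of
  -- lift `ℓ` does not matter.
  have hcoord : ∀ (q : Coef × (Fin 3 → Fin 2 → ℂ)) (y : Rat2fm), Rat2fm.IsLift q y →
      fmCoord q = fmCoord (ℓ y) := by
    intro q y hq
    obtain ⟨k, hk, hk'⟩ := hq.1.exists_smul (hℓ y).1
    choose a ha ha' using fun i => (hq.2 i).exists_smul
    choose b hb hb' using fun i => ((hℓ y).2 i).exists_smul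
    ext i
    fin_cases i <;> simp [fmCoord, hk', ha', hb', mul_div_mul_left, hk, ha, hb]
  have hfun : ContDiff ℂ ω fmSection := by
    have ht : ∀ i, ContDiff ℂ ω fun t : EuclideanSpace ℂ (Fin 5) => t i := fun i =>
      (EuclideanSpace.proj i : EuclideanSpace ℂ (Fin 5) →L[ℂ] ℂ).contDiff
    refine ContDiff.prodMk (contDiff_pi.2 fun i => contDiff_pi.2 fun j => ?_)
      (contDiff_pi.2 fun i => contDiff_pi.2 fun j => ?_)
    · fin_cases i <;> fin_cases j <;> simp <;> fun_prop
    · fin_cases i <;> fin_cases j <;> simp <;> fun_prop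
  have hsec : ∀ y ∈ S, Rat2fm.IsLift (fmSection (fmCoord (ℓ y))) y := fun y hy =>
    (hℓ y).fmSection hy
  obtain ⟨e, he, -, -, he'⟩ := exists_chart_of_section isLiftSystem_fm
    (fun y => fmCoord (ℓ y)) (S := S) (T := {t | res (fmSection t).1 ≠ 0}) hS
    (isOpen_ne.preimage (continuous_res.comp (continuous_fst.comp hfun.continuous)))
    (fun y hy y' hy' h => by
      have h1 := hsec y hy
      have h2 := hsec y' hy'
      simp only at h
      rw [h] at h1
      exact h1.eq h2)
    (fun y hy => (nondeg_iff _).1 (hsec y hy).1.1) fmSection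
    (fun t _ => analyticAt_of_contDiff hfun t)
    (fun t ht => by
      obtain ⟨y, hy⟩ := Rat2fm.exists_isLift ht (w := (fmSection t).2) (fun i => by
        rw [ne_zero_iff]; right; fin_cases i <;> simp [fmSection]) (fixedBy_fmSection t)
      refine ⟨y, hy.coef_ne_zero.2 (by simp [fmSection]), hy, ?_⟩
      rw [← hcoord _ y hy]
      ext i
      fin_cases i <;> simp [fmCoord, fmSection])
    (fun y hy => by
      refine LiftsAt.of_analytic fmCoord (fun q z hz => hcoord q z hz) fun q hq => ?_
      have hc1 := hq.coef_ne_zero.1 hy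
      have hw := hq.fixedBy.snd_ne_zero hc1
      have h1 : ∀ i j, AnalyticAt ℂ (fun q : Coef × (Fin 3 → Fin 2 → ℂ) => q.1 i j) q :=
        fun i j => analyticAt_of_contDiff (by fun_prop) q
      have h2 : ∀ i j, AnalyticAt ℂ (fun q : Coef × (Fin 3 → Fin 2 → ℂ) => q.2 i j) q :=
        fun i j => analyticAt_of_contDiff (by fun_prop) q
      have h3 : AnalyticAt ℂ (fun q : Coef × (Fin 3 → Fin 2 → ℂ) =>
          (![q.2 0 0 / q.2 0 1, q.2 1 0 / q.2 1 1, q.2 2 0 / q.2 2 1, q.1 1 1 / q.1 1 0,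
            q.1 1 2 / q.1 1 0] : Fin 5 → ℂ)) q := by
        refine AnalyticAt.pi fun i => ?_
        fin_cases i
        · exact (h2 0 0).div (h2 0 1) (hw 0)
        · exact (h2 1 0).div (h2 1 1) (hw 1)
        · exact (h2 2 0).div (h2 2 1) (hw 2)
        · exact (h1 1 1).div (h1 1 0) hc1
        · exact (h1 1 2).div (h1 1 0) hc1
      exact ((EuclideanSpace.equiv (Fin 5) ℂ).symm.toContinuousLinearMap.analyticAt _).comp h3)
  exact ⟨e, he ▸ hx, he'⟩

lemma exists_smul_eq_infty (q : OnePoint ℂ) : ∃ g : GL (Fin 2) ℂ, g • q = OnePoint.infty := by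
  induction q using OnePoint.rec with
  | infty => exact ⟨1, one_smul _ _⟩
  | coe t =>
    refine ⟨Matrix.GeneralLinearGroup.mkOfDetNeZero !![0, 1; 1, -t] (by simp), ?_⟩
    rw [smul_eq_proj]
    simp [proj, hc, Matrix.GeneralLinearGroup.mkOfDetNeZero]

/-- A point outside the marked list is not fixed; a Möbius transformation taking it to infinity is
biholomorphic on marked maps and reduces to the previous chart. -/
lemma isSmoothPoint_fm (x : Rat2fm) : IsSmoothPoint 5 Rat2fm.HolAt x := by
  obtain ⟨q, hq⟩ : ∃ q, q ∉ Set.range x.1.2 := (Set.finite_range x.1.2).exists_notMem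
  have hfix : x.1.1.1 q ≠ q := by
    obtain ⟨c, hr, k, hk, h⟩ := x.2
    have hne : wedge (hc q) (quadForm c (hc q)) ≠ 0 := by
      rw [h]
      refine mul_ne_zero hk (Finset.prod_ne_zero_iff.2 fun i _ => ?_)
      rw [Ne, ← (isHom_hc q).eq_iff_wedge (isHom_hc (x.1.2 i))]
      exact fun h' => hq ⟨i, h'.symm⟩
    intro h'
    apply hne
    rw [← (isHom_hc q).eq_iff_wedge (isHom_proj (hr.1 _ (hc_ne_zero q)))]
    conv_lhs => rw [← h', ← hr.2]
    rfl
  obtain ⟨g, hg⟩ := exists_smul_eq_infty q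
  refine (isSmoothPoint_fm_of_ne (x := mobius g • x) ?_).of_biholomorphic
    (isBiholomorphic_fm_smul (mobius g)) (Set.mem_univ x)
  intro h'
  have h'' : g • x.1.1.1 (g⁻¹ • OnePoint.infty) = OnePoint.infty := h'
  rw [← hg, inv_smul_smul] at h''
  exact hfix (MulAction.injective g h'')

instance : SecondCountableTopology Rat2fm :=
  Topology.IsEmbedding.subtypeVal.secondCountableTopology

instance : SecondCountableTopology Rat2tm :=
  Topology.IsEmbedding.subtypeVal.secondCountableTopology

theorem isComplexManifold_fm : IsComplexManifold 5 Rat2fm.HolAt :=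
  isComplexManifold_of_isSmoothPoint (fun _ _ _ h hg => HolByLifts.congr isLiftSystem_fm h hg)
    isSmoothPoint_fm

/-! ### Analytic dependence of the critical points -/

lemma exists_wedge_ne_zero {u : Fin 2 → ℂ} (hu : u ≠ 0) : ∃ n, wedge u n ≠ 0 := by
  rcases (ne_zero_iff u).1 hu with h | h
  · exact ⟨![0, 1], by simpa [wedge] using h⟩
  · exact ⟨![1, 0], by simpa [wedge] using h⟩

lemma jac_add_smul (c : Coef) (u n : Fin 2 → ℂ) (t : ℂ) :
    jac c (u + t • n) = jac c u + t * jacPolar c u n + t ^ 2 * jac c n := by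
  simp [jac, jacPolar]; ring

/-- Near a function value `b ^ 2 ≠ 0`, an analytic function has an analytic square root. -/
lemma exists_analytic_sqrt {E : Type} [NormedAddCommGroup E] [NormedSpace ℂ E] {D : E → ℂ} {x : E}
    (hD : AnalyticAt ℂ D x) {b : ℂ} (hb : b ≠ 0) (hx : D x = b ^ 2) :
    ∃ s : E → ℂ, AnalyticAt ℂ s x ∧ s x = b ∧ ∀ᶠ y in 𝓝 x, s y ^ 2 = D y := by
  have hb2 : b ^ 2 ≠ 0 := pow_ne_zero 2 hb
  have hq : AnalyticAt ℂ (fun y => D y / b ^ 2) x := hD.div analyticAt_const hb2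
  have h1 : D x / b ^ 2 = 1 := by rw [hx, div_self hb2]
  -- Dividing by `b ^ 2` moves the value at `x` to `1`, inside the slit plane where the logarithm is
  -- analytic.
  refine ⟨fun y => b * Complex.exp (Complex.log (D y / b ^ 2) / 2), ?_, ?_, ?_⟩
  · refine analyticAt_const.mul (AnalyticAt.cexp ?_)
    exact (hq.clog (by rw [h1]; exact Complex.one_mem_slitPlane)).div analyticAt_const two_ne_zero
  · simp [h1]
  · have : ∀ᶠ y in 𝓝 x, D y / b ^ 2 ≠ 0 :=
      hq.continuousAt.eventually_ne (by rw [h1]; exact one_ne_zero)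
    filter_upwards [this] with y hy
    rw [mul_pow, ← Complex.exp_nat_mul]
    have : ((2 : ℕ) : ℂ) * (Complex.log (D y / b ^ 2) / 2) = Complex.log (D y / b ^ 2) := by
      push_cast; ring
    rw [this, Complex.exp_log hy]
    field_simp

/-- On a line `u + t • n` transverse to `u`, the form `jac d` is quadratic in `t`, with the simple
root `t = 0` at `d = c`. Its discriminant is nonzero there, so a branch of the root is analytic. -/
lemma exists_analytic_critical {c : Coef} (hres : res c ≠ 0) {u : Fin 2 → ℂ} (hu : u ≠ 0)
    (h : jac c u = 0) : ∃ U : Coef → Fin 2 → ℂ, AnalyticAt ℂ U c ∧ U c = u ∧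
      ∀ᶠ d in 𝓝 c, jac d (U d) = 0 := by
  obtain ⟨n, hn⟩ := exists_wedge_ne_zero hu
  have hjac : ∀ v, AnalyticAt ℂ (fun d => jac d v) c := fun v =>
    analyticAt_of_contDiff (by unfold jac; fun_prop) c
  have hpol : AnalyticAt ℂ (fun d => jacPolar d u n) c :=
    analyticAt_of_contDiff (by unfold jacPolar; fun_prop) c
  have hB : jacPolar c u n ≠ 0 := by
    intro hB
    have := jacPolar_sq c u n
    rw [hB, h] at this
    have h' : 16 * res c * wedge u n ^ 2 ≠ 0 :=
      mul_ne_zero (mul_ne_zero (by norm_num) hres) (pow_ne_zero 2 hn)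
    exact h' (by linear_combination -this)
  have hD : AnalyticAt ℂ (fun d => jacPolar d u n ^ 2 - 4 * jac d u * jac d n) c :=
    (hpol.pow 2).sub ((analyticAt_const.mul (hjac u)).mul (hjac n))
  obtain ⟨s, hs, hs0, hs2⟩ := exists_analytic_sqrt hD hB (by simp [h])
  have hden : AnalyticAt ℂ (fun d => jacPolar d u n + s d) c := hpol.add hs
  have hden0 : jacPolar c u n + s c ≠ 0 := by
    rw [hs0, ← two_mul]
    exact mul_ne_zero two_ne_zero hB
  -- The rationalized quadratic formula is used because the leading coefficient `jac d n` may
  -- vanish.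
  refine ⟨fun d => u + (-2 * jac d u / (jacPolar d u n + s d)) • n, ?_, ?_, ?_⟩
  · exact analyticAt_const.add
      (((analyticAt_const.mul (hjac u)).div hden hden0).smul analyticAt_const)
  · simp [h]
  · filter_upwards [hs2, hden.continuousAt.eventually_ne hden0] with d h2 hd
    rw [jac_add_smul]
    field_simp
    linear_combination jac d u * h2

/-- A local analytic section of `forget` at the level of lifts; openness and local biholomorphy of
`forget` both rest on it. -/
lemma Rat2tm.IsLift.exists_analytic {c : Coef} {w : Fin 3 → Fin 2 → ℂ} {u : Fin 2 → Fin 2 → ℂ}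
    {x : Rat2tm} (h : Rat2tm.IsLift (c, w, u) x) :
    ∃ U : Coef → Fin 2 → Fin 2 → ℂ, AnalyticAt ℂ U c ∧ U c = u ∧
      ∀ᶠ d in 𝓝 c, ∀ w' y, Rat2fm.IsLift (d, w') y →
        ∃ x', Rat2tm.IsLift (d, w', U d) x' ∧ QuadRat.forget x' = y := by
  have hres := (nondeg_iff c).1 h.1.1
  choose U hU hUu hUj using fun j => exists_analytic_critical hres (h.2.2 j).1 (h.critical.2 j)
  have hUa : AnalyticAt ℂ (fun d j => U j d) c := AnalyticAt.pi hU
  refine ⟨fun d j => U j d, hUa, funext hUu, ?_⟩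
  have hwedge : ∀ᶠ d in 𝓝 c, wedge (U 0 d) (U 1 d) ≠ 0 := by
    have hcont : ContinuousAt (fun d => wedge (U 0 d) (U 1 d)) c := by
      have := fun j i => (continuous_apply i).continuousAt.comp (hU j).continuousAt
      exact ((this 0 0).mul (this 1 1)).sub ((this 0 1).mul (this 1 0))
    refine hcont.eventually_ne ?_
    rw [hUu 0, hUu 1]
    exact h.critical.1
  filter_upwards [hwedge, Filter.eventually_all.2 hUj] with d h1 h2 w' y hy
  exact hy.exists_tm h1 h2

/-! ### The covering of the space of fixed point marked maps -/

lemma liftsAt_forget (x : Rat2tm) : LiftsAt Rat2tm.IsLift Rat2fm.IsLift forget x := fun p _ =>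
  ⟨fun q => (q.1, q.2.1), analyticAt_of_contDiff (by fun_prop) p,
    Filter.Eventually.of_forall fun _ _ hy => ⟨hy.1, hy.2.1⟩⟩

lemma continuous_forget : Continuous forget := continuous_iff_continuousAt.2 fun x =>
  (liftsAt_forget x).continuousAt isLiftSystem_tm isLiftSystem_fm

lemma isOpenMap_forget : IsOpenMap forget := by
  rw [isOpenMap_iff_nhds_le]
  intro x N hN
  obtain ⟨⟨c, w, u⟩, h⟩ := isLiftSystem_tm.exists_lift x
  obtain ⟨U, hU, hUc, hex⟩ := h.exists_analytic
  have hcont : ContinuousAt (fun q : Coef × (Fin 3 → Fin 2 → ℂ) => (q.1, q.2, U q.1)) (c, w) :=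
    continuousAt_fst.prodMk (continuousAt_snd.prodMk
      (ContinuousAt.comp (f := Prod.fst) (g := U) hU.continuousAt continuousAt_fst))
  have h1 := isLiftSystem_tm.eventually_mem h (Filter.mem_map.1 hN)
  rw [← hUc] at h1
  have h2 := hcont.eventually h1
  have h3 := continuousAt_fst (p := (c, w)) |>.eventually hex
  filter_upwards [isLiftSystem_fm.eventually_exists h.forget (h2.and h3)] with y ⟨q, ⟨hq1, hq2⟩, hy⟩
  obtain ⟨x', hx', rfl⟩ := hq2 q.2 y hy
  exact hq1 x' hx'

lemma holAt_forget_iff (g : Rat2fm → ℂ) (x : Rat2tm) :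
    Rat2fm.HolAt g (forget x) ↔ Rat2tm.HolAt (g ∘ forget) x := by
  refine ⟨fun h => (liftsAt_forget x).holByLifts h, ?_⟩
  rintro hg ⟨c, w⟩ hp
  obtain ⟨⟨c', w', u⟩, h'⟩ := isLiftSystem_tm.exists_lift x
  have h : Rat2tm.IsLift (c, w, u) x := by
    refine ⟨hp.1, hp.2, h'.2.2⟩
  obtain ⟨U, hU, hUc, hex⟩ := h.exists_analytic
  obtain ⟨G, hG, hGe⟩ := hg _ h
  have han : AnalyticAt ℂ (fun q : Coef × (Fin 3 → Fin 2 → ℂ) => (q.1, q.2, U q.1)) (c, w) :=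
    analyticAt_fst.prod (analyticAt_snd.prod
      (AnalyticAt.comp (f := Prod.fst) (g := U) hU analyticAt_fst))
  rw [← hUc] at hG hGe
  refine ⟨_, AnalyticAt.comp (g := G) hG han, ?_⟩
  filter_upwards [han.continuousAt.eventually hGe,
    continuousAt_fst (p := (c, w)) |>.eventually hex] with q h1 h2 y hy
  obtain ⟨x', hx', rfl⟩ := h2 q.2 y hy
  exact h1 x' hx'

lemma isCriticalMarking_iff_exists {f : OnePoint ℂ → OnePoint ℂ} {m : Fin 2 → OnePoint ℂ} :
    IsCriticalMarking f m ↔ Function.Injective m ∧ ∀ p, IsCritical f p ↔ ∃ j, p = m j := by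
  simp only [IsCriticalMarking, Fin.exists_fin_two]
  refine and_congr_left fun _ => ?_
  constructor
  · intro h i j hij
    fin_cases i <;> fin_cases j <;> simp_all
  · intro h h'
    exact absurd (h h') (by decide)

/-- Permutations of the two critical points act on totally marked maps. -/
instance : MulAction (Equiv.Perm (Fin 2)) Rat2tm where
  smul σ x := ⟨(x.1.1, x.1.2.1, x.1.2.2 ∘ σ.symm), x.2.1, by
    have h := isCriticalMarking_iff_exists.1 x.2.2
    refine isCriticalMarking_iff_exists.2 ⟨h.1.comp σ.symm.injective, fun p => ?_⟩
    rw [h.2]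
    exact (σ.symm.surjective.exists (p := fun j => p = x.1.2.2 j))⟩
  one_smul _ := rfl
  mul_smul _ _ _ := rfl

lemma perm_eq (σ : Equiv.Perm (Fin 2)) : σ = 1 ∨ σ = Equiv.swap 0 1 := by
  revert σ; decide

lemma forget_perm_smul (σ : Equiv.Perm (Fin 2)) (x : Rat2tm) : forget (σ • x) = forget x := rfl

lemma forget_eq_iff {x y : Rat2tm} :
    forget x = forget y ↔ ∃ σ : Equiv.Perm (Fin 2), σ • y = x := by
  constructor
  · intro h
    have h1 : x.1.1 = y.1.1 := congrArg (fun t : Rat2fm => t.1.1) h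
    have h2 : x.1.2.1 = y.1.2.1 := congrArg (fun t : Rat2fm => t.1.2) h
    have hx := x.2.2
    have hy := y.2.2
    rw [h1] at hx
    have h3 := (hy.2 _).1 ((hx.2 (x.1.2.2 0)).2 (Or.inl rfl))
    have h4 := (hy.2 _).1 ((hx.2 (x.1.2.2 1)).2 (Or.inr rfl))
    have hne := hx.1
    rcases h3 with h3 | h3
    · have h4' : x.1.2.2 1 = y.1.2.2 1 := h4.resolve_left fun h => hne (h3.trans h.symm)
      refine ⟨1, Subtype.ext (Prod.ext h1.symm (Prod.ext h2.symm (funext fun j => ?_)))⟩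
      fin_cases j
      · exact h3.symm
      · exact h4'.symm
    · have h4' : x.1.2.2 1 = y.1.2.2 0 := h4.resolve_right fun h => hne (h3.trans h.symm)
      refine ⟨Equiv.swap 0 1, Subtype.ext (Prod.ext h1.symm (Prod.ext h2.symm (funext fun j => ?_)))⟩
      fin_cases j
      · exact h3.symm
      · exact h4'.symm
  · rintro ⟨σ, rfl⟩
    rfl

/-- The fibres are orbits because a map determines its critical set up to order. Confining the two
critical points to disjoint open sets gives a neighbourhood disjoint from its swap. -/
lemma isQuotientCoveringMap_forget : IsQuotientCoveringMap forget (Equiv.Perm (Fin 2)) where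
  toIsQuotientMap := isOpenMap_forget.isQuotientMap continuous_forget surjective_forget
  continuous_const_smul σ := by
    refine Continuous.subtype_mk (Continuous.prodMk ?_ (Continuous.prodMk ?_ ?_)) _
    · exact continuous_fst.comp continuous_subtype_val
    · exact continuous_fst.comp (continuous_snd.comp continuous_subtype_val)
    · exact continuous_pi fun j => (continuous_apply _).comp
        (continuous_snd.comp (continuous_snd.comp continuous_subtype_val))
  apply_eq_iff_mem_orbit := forget_eq_iff
  disjoint x := by
    obtain ⟨A, B, hA, hB, h0, h1, hAB⟩ := t2_separation x.2.2.1
    have hcont : ∀ j, Continuous fun y : Rat2tm => y.1.2.2 j := fun j =>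
      (continuous_apply j).comp (continuous_snd.comp (continuous_snd.comp continuous_subtype_val))
    refine ⟨(fun y : Rat2tm => y.1.2.2 0) ⁻¹' A ∩ (fun y : Rat2tm => y.1.2.2 1) ⁻¹' B,
      (((hA.preimage (hcont 0)).inter (hB.preimage (hcont 1))).mem_nhds ⟨h0, h1⟩), ?_⟩
    rintro σ ⟨_, ⟨y, hy, rfl⟩, hy'⟩
    rcases perm_eq σ with h | h
    · exact h
    · subst h
      exact (Set.disjoint_left.1 hAB (show y.1.2.2 1 ∈ A from hy'.1) hy.2).elim

theorem isUnramifiedCover_forget :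
    IsUnramifiedCover 2 Rat2tm.HolAt Rat2fm.HolAt forget := by
  have hcov := isQuotientCoveringMap_forget.isCoveringMap
  refine ⟨hcov, fun y => ?_, fun x => ?_⟩
  · obtain ⟨x, hx⟩ := surjective_forget y
    rw [Nat.card_congr (isQuotientCoveringMap_forget.fiberEquivGroup ⟨x, hx⟩)]
    simp [Nat.card_eq_fintype_card, Fintype.card_perm]
  · obtain ⟨e, hx, he⟩ := hcov.isLocalHomeomorph x
    refine ⟨e, hx, fun y _ => by rw [he], fun y _ g => ?_⟩
    rw [← he]
    exact holAt_forget_iff g y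

theorem isComplexManifold_tm : IsComplexManifold 5 Rat2tm.HolAt := by
  refine isComplexManifold_of_isSmoothPoint
    (fun _ _ _ h hg => HolByLifts.congr isLiftSystem_tm h hg) fun x => ?_
  obtain ⟨e, hx, -, he⟩ := isUnramifiedCover_forget.2.2 x
  exact (isSmoothPoint_fm (e x)).of_biholomorphic he hx

/-! ### Invariants of totally marked maps -/

/-- The space of homogeneous coordinates of totally marked maps. -/
abbrev TmLift := Coef × (Fin 3 → Fin 2 → ℂ) × (Fin 2 → Fin 2 → ℂ)

/-- Denominator of `ratio`. -/
def ratioDen (p : TmLift) (i j : Fin 3) : ℂ :=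
  wedge (p.2.1 i) (p.2.2 0) * wedge (p.2.1 j) (p.2.2 1) +
    wedge (p.2.1 j) (p.2.2 0) * wedge (p.2.1 i) (p.2.2 1)

/-- Numerator of `ratio`. -/
def ratioNum (p : TmLift) (i j : Fin 3) : ℂ :=
  wedge (p.2.1 i) (p.2.2 0) * wedge (p.2.1 j) (p.2.2 1) -
    wedge (p.2.1 j) (p.2.2 0) * wedge (p.2.1 i) (p.2.2 1)

/-- The invariant `(zᵢ - zⱼ) / (zᵢ + zⱼ)` of the fixed points `zᵢ`, `zⱼ`, in a coordinate in which
the critical points are `0` and `∞`. -/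
def ratio (p : TmLift) (i j : Fin 3) : ℂ := ratioNum p i j / ratioDen p i j

/-- The quadratic map with critical points `0`, `∞` and given fixed points. -/
def coefOfFixed (w : Fin 3 → Fin 2 → ℂ) : Coef :=
  ![![w 0 0 * w 1 1 * w 2 1 + w 0 1 * w 1 0 * w 2 1 + w 0 1 * w 1 1 * w 2 0, 0,
      w 0 0 * w 1 0 * w 2 0],
    ![w 0 1 * w 1 1 * w 2 1, 0,
      w 0 0 * w 1 0 * w 2 1 + w 0 0 * w 1 1 * w 2 0 + w 0 1 * w 1 0 * w 2 0]]

/-- Homogeneous coordinates of the points `0` and `∞`. -/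
def stdCrit : Fin 2 → Fin 2 → ℂ := ![![0, 1], ![1, 0]]

lemma fixedBy_coefOfFixed (w : Fin 3 → Fin 2 → ℂ) : FixedBy (coefOfFixed w) w := by
  refine ⟨1, one_ne_zero, fun v => ?_⟩
  simp [coefOfFixed, Fin.prod_univ_three, wedge, quadForm]
  ring

lemma jac_coefOfFixed (w : Fin 3 → Fin 2 → ℂ) (j : Fin 2) :
    jac (coefOfFixed w) (stdCrit j) = 0 := by
  fin_cases j <;> simp [coefOfFixed, jac, stdCrit]

/-- In affine terms, the map with critical points `0, ∞` and fixed points `zᵢ` is nondegenerate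
exactly when all sums `zᵢ + zⱼ`, `i ≠ j`, are nonzero. These sums are the denominators of the
ratios. -/
lemma res_coefOfFixed (w : Fin 3 → Fin 2 → ℂ) : res (coefOfFixed w) =
    ((w 0 0 * w 1 1 + w 1 0 * w 0 1) * (w 0 0 * w 2 1 + w 2 0 * w 0 1) *
      (w 1 0 * w 2 1 + w 2 0 * w 1 1)) ^ 2 := by
  simp [coefOfFixed, res]
  ring

/-- Vanishing of `jac c` at `0` and `∞` kills two of the three minors of `c`; the third is then
nonzero and forces both middle coefficients to vanish. The fixed point cubic determines the rest. -/
lemma exists_eq_smul_coefOfFixed {c : Coef} {w : Fin 3 → Fin 2 → ℂ} (hres : res c ≠ 0)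
    (h : FixedBy c w) (hj : ∀ j, jac c (stdCrit j) = 0) :
    ∃ k : ℂ, k ≠ 0 ∧ c = k • coefOfFixed w := by
  have hs : c 0 1 * c 1 2 - c 0 2 * c 1 1 = 0 := by
    have := hj 0
    simpa [jac, stdCrit] using this
  have hp : c 0 0 * c 1 1 - c 0 1 * c 1 0 = 0 := by
    have := hj 1
    simpa [jac, stdCrit] using this
  have hq : c 0 0 * c 1 2 - c 0 2 * c 1 0 ≠ 0 := by
    intro hq
    apply hres
    rw [res, hs, hp, hq]; ring
  have h01 : c 0 1 = 0 := by
    have : c 0 1 * (c 0 0 * c 1 2 - c 0 2 * c 1 0) = 0 := by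
      linear_combination c 0 0 * hs + c 0 2 * hp
    exact (mul_eq_zero.1 this).resolve_right hq
  have h11 : c 1 1 = 0 := by
    have : c 1 1 * (c 0 0 * c 1 2 - c 0 2 * c 1 0) = 0 := by
      linear_combination c 1 0 * hs + c 1 2 * hp
    exact (mul_eq_zero.1 this).resolve_right hq
  obtain ⟨k, hk, h⟩ := h
  refine ⟨k, hk, ?_⟩
  have e0 := h ![1, 0]
  have e1 := h ![0, 1]
  have e2 := h ![1, 1]
  have e3 := h ![1, -1]
  simp [Fin.prod_univ_three, wedge, quadForm, h01, h11] at e0 e1 e2 e3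
  have h02 : c 0 2 = k * (w 0 0 * w 1 0 * w 2 0) := by linear_combination e1
  ext i j
  fin_cases i <;> fin_cases j
  · simp [coefOfFixed]
    linear_combination (-1 / 2 : ℂ) * e2 + (1 / 2 : ℂ) * e3 - h02
  · simp [coefOfFixed, h01]
  · simp [coefOfFixed, h02]
  · simp [coefOfFixed, e0]
  · simp [coefOfFixed, h11]
  · simp [coefOfFixed]
    linear_combination (1 / 2 : ℂ) * e2 + (1 / 2 : ℂ) * e3 - e0

lemma Rat2tm.IsLift.smul {c : Coef} {w : Fin 3 → Fin 2 → ℂ} {u : Fin 2 → Fin 2 → ℂ} {x : Rat2tm}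
    (h : Rat2tm.IsLift (c, w, u) x) {k : ℂ} (hk : k ≠ 0) {a : Fin 3 → ℂ} (ha : ∀ i, a i ≠ 0)
    {b : Fin 2 → ℂ} (hb : ∀ j, b j ≠ 0) :
    Rat2tm.IsLift (k • c, fun i => a i • w i, fun j => b j • u j) x :=
  ⟨h.1.smul hk,
    fun i => ⟨smul_ne_zero (ha i) (h.2.1 i).1, by rw [proj_smul (ha i)]; exact (h.2.1 i).2⟩,
    fun j => ⟨smul_ne_zero (hb j) (h.2.2 j).1, by rw [proj_smul (hb j)]; exact (h.2.2 j).2⟩⟩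

lemma wedge_smul_smul (v w : Fin 2 → ℂ) (a b : ℂ) : wedge (a • v) (b • w) = a * b * wedge v w := by
  simp [wedge]; ring

/-- A totally marked map can be moved so that its critical points are `0` and `∞`, with prescribed
scaling. -/
lemma Rat2tm.IsLift.exists_std {c : Coef} {w : Fin 3 → Fin 2 → ℂ} {u : Fin 2 → Fin 2 → ℂ}
    {x : Rat2tm} (h : Rat2tm.IsLift (c, w, u) x) {s t : ℂ} (hs : s ≠ 0) (ht : t ≠ 0)
    {a : Fin 3 → ℂ} (ha : ∀ i, a i ≠ 0) : ∃ g : GL (Fin 2) ℂ, Rat2tm.IsLift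
      (coefOfFixed fun i => a i • ![s * wedge (w i) (u 0), t * wedge (w i) (u 1)],
        fun i => a i • ![s * wedge (w i) (u 0), t * wedge (w i) (u 1)], stdCrit)
      (QuadRat.mobius g • x) := by
  have hD := h.critical.1
  simp only at hD
  -- The rows are multiples of the linear forms vanishing at `u 0` and at `u 1`, so these points go
  -- to `0` and `∞`.
  let g : GL (Fin 2) ℂ := Matrix.GeneralLinearGroup.mkOfDetNeZero
    !![s * u 0 1, -(s * u 0 0); t * u 1 1, -(t * u 1 0)] (by
      rw [Matrix.det_fin_two_of]
      have : s * u 0 1 * -(t * u 1 0) - -(s * u 0 0) * (t * u 1 1) =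
        s * t * wedge (u 0) (u 1) := by simp [wedge]; ring
      rw [this]
      exact mul_ne_zero (mul_ne_zero hs ht) hD)
  have hg : ∀ v, g.1.mulVec v = ![s * wedge v (u 0), t * wedge v (u 1)] := by
    intro v
    ext i
    fin_cases i <;>
      simp [g, Matrix.GeneralLinearGroup.mkOfDetNeZero, wedge, Matrix.vecHead, Matrix.vecTail] <;>
      ring
  refine ⟨g, ?_⟩
  have h1 := h.mobius g
  have h2 := h1.smul one_ne_zero ha
    (b := ![(t * wedge (u 0) (u 1))⁻¹, (s * wedge (u 1) (u 0))⁻¹]) (by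
      have hD' : wedge (u 1) (u 0) ≠ 0 := by rw [wedge_swap]; exact neg_ne_zero.2 hD
      intro j
      fin_cases j
      · exact inv_ne_zero (mul_ne_zero ht hD)
      · exact inv_ne_zero (mul_ne_zero hs hD'))
  have hu : (fun j => ![(t * wedge (u 0) (u 1))⁻¹, (s * wedge (u 1) (u 0))⁻¹] j •
      g.1.mulVec (u j)) = stdCrit := by
    have hD' : wedge (u 1) (u 0) ≠ 0 := by rw [wedge_swap]; exact neg_ne_zero.2 hD
    ext j i
    fin_cases j <;> fin_cases i <;> simp [hg, stdCrit, wedge_self] <;> field_simp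
  simp only [hu] at h2
  simp only [hg] at h2
  obtain ⟨k, hk, hk'⟩ := exists_eq_smul_coefOfFixed ((nondeg_iff _).1 h2.1.1) h2.forget.fixedBy
    h2.critical.2
  have h3 := h2.smul (inv_ne_zero hk) (a := 1) (by simp) (b := 1) (by simp)
  simp only at hk'
  rw [hk', smul_smul, inv_mul_cancel₀ hk, one_smul] at h3
  simpa using h3

/-- After normalizing the critical points, the three denominators are the factors of the resultant
in `res_coefOfFixed`. -/
lemma Rat2tm.IsLift.ratioDen_ne_zero {p : TmLift} {x : Rat2tm} (h : Rat2tm.IsLift p x)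
    {i j : Fin 3} (hij : i ≠ j) : ratioDen p i j ≠ 0 := by
  obtain ⟨c, w, u⟩ := p
  obtain ⟨g, hg⟩ := h.exists_std one_ne_zero one_ne_zero (a := 1) (by simp)
  have hres := (nondeg_iff _).1 hg.1.1
  simp only at hres
  rw [res_coefOfFixed] at hres
  simp only [ne_eq, Pi.one_apply, one_smul, one_mul, Matrix.cons_val_zero, Matrix.cons_val_one,
    pow_eq_zero_iff two_ne_zero, mul_eq_zero, not_or] at hres
  obtain ⟨⟨h01, h02⟩, h12⟩ := hres
  have hsymm : ∀ i j, ratioDen (c, w, u) i j = ratioDen (c, w, u) j i := fun i j => by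
    simp only [ratioDen]; ring
  change ratioDen (c, w, u) 0 1 ≠ 0 at h01
  change ratioDen (c, w, u) 0 2 ≠ 0 at h02
  change ratioDen (c, w, u) 1 2 ≠ 0 at h12
  have h10 := hsymm 1 0 ▸ h01
  have h20 := hsymm 2 0 ▸ h02
  have h21 := hsymm 2 1 ▸ h12
  fin_cases i <;> fin_cases j <;> first | exact absurd rfl hij | assumption

lemma Rat2tm.IsLift.ratio_eq {p q : TmLift} {x : Rat2tm} (hp : Rat2tm.IsLift p x)
    (hq : Rat2tm.IsLift q x) (i j : Fin 3) : ratio p i j = ratio q i j := by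
  have key : ∀ p, Rat2tm.IsLift p x → ratio p i j =
      ratio (p.1, fun i => hc (x.1.2.1 i), fun j => hc (x.1.2.2 j)) i j := by
    intro p hp
    choose a ha ha' using fun i => (hp.2.1 i).exists_smul
    choose b hb hb' using fun j => (hp.2.2 j).exists_smul
    have hne : a i * a j * b 0 * b 1 ≠ 0 := by simp [ha, hb]
    have hn : ratioNum p i j = a i * a j * b 0 * b 1 *
        ratioNum (p.1, fun i => hc (x.1.2.1 i), fun j => hc (x.1.2.2 j)) i j := by
      simp only [ratioNum, ha', hb', wedge_smul_smul]; ring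
    have hd : ratioDen p i j = a i * a j * b 0 * b 1 *
        ratioDen (p.1, fun i => hc (x.1.2.1 i), fun j => hc (x.1.2.2 j)) i j := by
      simp only [ratioDen, ha', hb', wedge_smul_smul]; ring
    rw [ratio, hn, hd, mul_div_mul_left _ _ hne, ratio]
  rw [key p hp, key q hq]
  rfl

/-- The invariants `ratio` of a totally marked map. -/
def Rat2tm.ratio (x : Rat2tm) (i j : Fin 3) : ℂ :=
  QuadRat.ratio (isLiftSystem_tm.exists_lift x).choose i j

lemma Rat2tm.IsLift.ratio_eq' {p : TmLift} {x : Rat2tm} (hp : Rat2tm.IsLift p x) (i j : Fin 3) :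
    QuadRat.ratio p i j = x.ratio i j :=
  hp.ratio_eq (isLiftSystem_tm.exists_lift x).choose_spec i j

lemma ratio_smul (g : Rat1) (x : Rat2tm) (i j : Fin 3) : (g • x).ratio i j = x.ratio i j := by
  obtain ⟨A, rfl⟩ := exists_mobius g
  obtain ⟨p, hp⟩ := isLiftSystem_tm.exists_lift x
  rw [← (hp.mobius A).ratio_eq', ← hp.ratio_eq']
  have hne : A.1.det ^ 2 ≠ 0 := pow_ne_zero 2 A.det_ne_zero
  rw [ratio, ratio, ← mul_div_mul_left (ratioNum p i j) _ hne]
  congr 1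
  · simp only [ratioNum, wedge_mulVec]; ring
  · simp only [ratioDen, wedge_mulVec]; ring

/-- Exchanging `0` and `∞` is `z ↦ 1 / z`, which negates `(zᵢ - zⱼ) / (zᵢ + zⱼ)`. -/
lemma ratio_perm_swap (x : Rat2tm) (i j : Fin 3) :
    ((Equiv.swap 0 1 : Equiv.Perm (Fin 2)) • x).ratio i j = -x.ratio i j := by
  obtain ⟨⟨c, w, u⟩, hp⟩ := isLiftSystem_tm.exists_lift x
  have h : Rat2tm.IsLift (c, w, u ∘ Equiv.swap 0 1)
      ((Equiv.swap 0 1 : Equiv.Perm (Fin 2)) • x) :=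
    ⟨hp.1, hp.2.1, fun j => hp.2.2 (Equiv.swap 0 1 j)⟩
  rw [← h.ratio_eq', ← hp.ratio_eq', ratio, ratio, ← neg_div]
  congr 1
  · simp [ratioNum]; ring
  · simp [ratioDen]; ring

/-- The invariants as functions on the moduli space. -/
def M2tm.ratio (m : M2tm) (i j : Fin 3) : ℂ :=
  Quotient.lift (fun x : Rat2tm => x.ratio i j) (by
    rintro _ x ⟨g, rfl⟩
    exact ratio_smul g x i j) m

lemma ratio_toModuli (x : Rat2tm) (i j : Fin 3) : M2tm.ratio x.toModuli i j = x.ratio i j := rfl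

lemma toModuli_eq_iff {x y : Rat2tm} : x.toModuli = y.toModuli ↔ ∃ g : Rat1, g • y = x :=
  Quotient.eq

lemma toModuli_fm_eq_iff {x y : Rat2fm} : x.toModuli = y.toModuli ↔ ∃ g : Rat1, g • y = x :=
  Quotient.eq

/-! ### Charts of the moduli space of totally marked maps -/

/-- Lifts of points of the moduli space. -/
def M2tm.IsLift (p : TmLift) (m : M2tm) : Prop := ∃ x, Rat2tm.IsLift p x ∧ x.toModuli = m

lemma isLiftSystem_m2tm : IsLiftSystem M2tm.IsLift :=
  isLiftSystem_tm.quotient isOpenQuotientMap_toModuli_tm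

lemma m2tm_holAt_iff {g : M2tm → ℂ} {m : M2tm} : M2tm.HolAt g m ↔ HolByLifts M2tm.IsLift g m :=
  holByLifts_quotient.symm

lemma M2tm.IsLift.ratio_eq {p : TmLift} {m : M2tm} (h : M2tm.IsLift p m) (i j : Fin 3) :
    QuadRat.ratio p i j = m.ratio i j := by
  obtain ⟨x, hx, rfl⟩ := h
  exact hx.ratio_eq' i j

lemma M2tm.IsLift.analyticAt_ratio {p : TmLift} {m : M2tm} (h : M2tm.IsLift p m) {i j : Fin 3}
    (hij : i ≠ j) : AnalyticAt ℂ (fun q => QuadRat.ratio q i j) p := by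
  obtain ⟨x, hx, rfl⟩ := h
  refine AnalyticAt.div (analyticAt_of_contDiff ?_ p) (analyticAt_of_contDiff ?_ p)
    (hx.ratioDen_ne_zero hij)
  · unfold ratioNum wedge; fun_prop
  · unfold ratioDen wedge; fun_prop

lemma continuous_ratio {i j : Fin 3} (hij : i ≠ j) : Continuous fun m : M2tm => m.ratio i j :=
  continuous_iff_continuousAt.2 fun _ =>
    (LiftsAt.of_analytic (fun q => ratio q i j) (fun _ _ hq => hq.ratio_eq i j)
      fun _ hq => hq.analyticAt_ratio hij).continuousAt isLiftSystem_m2tm isLiftSystem_eq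

/-- The marked map in normal form: critical points `0` and `∞`, fixed points
`(1 - ρ l) / (1 + ρ l)`. -/
def tmSection (ρ : Fin 3 → ℂ) : TmLift :=
  (coefOfFixed fun l => ![1 - ρ l, 1 + ρ l], fun l => ![1 - ρ l, 1 + ρ l], stdCrit)

lemma exists_isLift_tmSection {ρ : Fin 3 → ℂ} (h : ∀ i j, i ≠ j → ρ i * ρ j ≠ 1) :
    ∃ x, Rat2tm.IsLift (tmSection ρ) x := by
  have hne : ∀ i j, i ≠ j → (1 - ρ i) * (1 + ρ j) + (1 - ρ j) * (1 + ρ i) ≠ 0 := by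
    intro i j hij h0
    exact h i j hij (by linear_combination (-1 / 2 : ℂ) * h0)
  have hw : ∀ l, ![1 - ρ l, 1 + ρ l] ≠ 0 := by
    intro l hl
    have h0 := congrFun hl 0
    have h1 := congrFun hl 1
    simp at h0 h1
    have : (2 : ℂ) = 0 := by linear_combination h0 + h1
    exact two_ne_zero this
  have hres : res (coefOfFixed fun l => ![1 - ρ l, 1 + ρ l]) ≠ 0 := by
    rw [res_coefOfFixed]
    exact pow_ne_zero 2 (mul_ne_zero (mul_ne_zero (hne 0 1 (by decide)) (hne 0 2 (by decide)))
      (hne 1 2 (by decide)))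
  obtain ⟨y, hy⟩ := Rat2fm.exists_isLift hres hw (fixedBy_coefOfFixed _)
  obtain ⟨x, hx, -⟩ := hy.exists_tm (u := stdCrit) (by simp [stdCrit, wedge]) (jac_coefOfFixed _)
  exact ⟨x, hx⟩

/-- This is the subtraction formula of the hyperbolic tangent. When `ρ i = 0` it returns `ρ j`, so
`tmSection` inverts the ratios at `i`. -/
lemma ratio_tmSection (ρ : Fin 3 → ℂ) (i j : Fin 3) :
    ratio (tmSection ρ) i j = (ρ j - ρ i) / (1 - ρ i * ρ j) := by
  have h1 : ratioNum (tmSection ρ) i j = -2 * (ρ j - ρ i) := by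
    simp [ratioNum, tmSection, wedge, stdCrit]; ring
  have h2 : ratioDen (tmSection ρ) i j = -2 * (1 - ρ i * ρ j) := by
    simp [ratioDen, tmSection, wedge, stdCrit]; ring
  rw [ratio, h1, h2, mul_div_mul_left _ _ (by norm_num)]

/-- The difference between the product and `1` has numerator `-2` times the two wedges times the
nonzero `ratioDen p j k`. The product is thus `1` exactly when the `i`-th fixed point is critical.
-/
lemma M2tm.IsLift.ratio_mul_ratio {p : TmLift} {m : M2tm} (h : M2tm.IsLift p m) {i j k : Fin 3}
    (hij : i ≠ j) (hik : i ≠ k) (hjk : j ≠ k) : m.ratio i j * m.ratio i k ≠ 1 ↔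
      wedge (p.2.1 i) (p.2.2 0) ≠ 0 ∧ wedge (p.2.1 i) (p.2.2 1) ≠ 0 := by
  rw [← h.ratio_eq, ← h.ratio_eq]
  obtain ⟨x, hx, rfl⟩ := h
  have hd1 := hx.ratioDen_ne_zero hij
  have hd2 := hx.ratioDen_ne_zero hik
  have hd3 := hx.ratioDen_ne_zero hjk
  rw [QuadRat.ratio, QuadRat.ratio, div_mul_div_comm, Ne,
    div_eq_one_iff_eq (mul_ne_zero hd1 hd2), ← sub_eq_zero,
    show ratioNum p i j * ratioNum p i k - ratioDen p i j * ratioDen p i k =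
      -2 * (wedge (p.2.1 i) (p.2.2 0) * wedge (p.2.1 i) (p.2.2 1)) * ratioDen p j k by
        simp only [ratioNum, ratioDen]; ring]
  simp [hd3]

lemma M2tm.IsLift.tmSection {p : TmLift} {m : M2tm} (h : M2tm.IsLift p m) {i : Fin 3}
    (h0 : wedge (p.2.1 i) (p.2.2 0) ≠ 0) (h1 : wedge (p.2.1 i) (p.2.2 1) ≠ 0) :
    M2tm.IsLift (tmSection fun l => m.ratio i l) m := by
  have hr := h.ratio_eq i
  obtain ⟨x, hx, rfl⟩ := h
  obtain ⟨c, w, u⟩ := p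
  simp only at h0 h1
  have hden : ∀ l, ratioDen (c, w, u) i l ≠ 0 := by
    intro l
    by_cases hl : i = l
    · subst hl
      simp only [ratioDen, ← two_mul]
      exact mul_ne_zero two_ne_zero (mul_ne_zero h0 h1)
    · exact hx.ratioDen_ne_zero hl
  obtain ⟨g, hg⟩ := hx.exists_std (inv_ne_zero h0) (inv_ne_zero h1)
    -- The scalings in `exists_std` send the `i`-th fixed point to `1`; this factor then makes the
    -- coordinates of the `l`-th one exactly `(1 - r, 1 + r)`.
    (a := fun l => 2 * (wedge (w i) (u 0) * wedge (w i) (u 1)) / ratioDen (c, w, u) i l)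
    (fun l => div_ne_zero (mul_ne_zero two_ne_zero (mul_ne_zero h0 h1)) (hden l))
  refine ⟨_, ?_, toModuli_eq_iff.2 ⟨mobius g, rfl⟩⟩
  have hw : (fun l => (2 * (wedge (w i) (u 0) * wedge (w i) (u 1)) / ratioDen (c, w, u) i l) •
      ![(wedge (w i) (u 0))⁻¹ * wedge (w l) (u 0), (wedge (w i) (u 1))⁻¹ * wedge (w l) (u 1)]) =
      fun l => ![1 - x.toModuli.ratio i l, 1 + x.toModuli.ratio i l] := by
    funext l
    rw [← hr l, QuadRat.ratio]
    have := hden l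
    ext n
    fin_cases n
    · simp
      field_simp
      simp only [ratioDen, ratioNum]; ring
    · simp
      field_simp
      simp only [ratioDen, ratioNum]; ring
  rw [hw] at hg
  exact hg

/-- Two of the marked fixed points cannot sit at the same critical point, since their `ratioDen`
would vanish; so the two critical points cannot account for all three indices. -/
lemma M2tm.exists_good (m : M2tm) : ∃ i : Fin 3, m.ratio i (i + 1) * m.ratio i (i + 2) ≠ 1 := by
  obtain ⟨p, hp⟩ := isLiftSystem_m2tm.exists_lift m
  have hgood : ∀ i : Fin 3, m.ratio i (i + 1) * m.ratio i (i + 2) ≠ 1 ↔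
      wedge (p.2.1 i) (p.2.2 0) ≠ 0 ∧ wedge (p.2.1 i) (p.2.2 1) ≠ 0 := fun i =>
    hp.ratio_mul_ratio (by fin_cases i <;> decide) (by fin_cases i <;> decide)
      (by fin_cases i <;> decide)
  simp only [hgood]
  by_contra! hcon
  obtain ⟨x, hx, rfl⟩ := hp
  have h01 := hx.ratioDen_ne_zero (i := 0) (j := 1) (by decide)
  have h02 := hx.ratioDen_ne_zero (i := 0) (j := 2) (by decide)
  have h12 := hx.ratioDen_ne_zero (i := 1) (j := 2) (by decide)
  simp only [ratioDen] at h01 h02 h12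
  have hc0 := hcon 0
  have hc1 := hcon 1
  have hc2 := hcon 2
  by_cases a0 : wedge (p.2.1 0) (p.2.2 0) = 0 <;> by_cases a1 : wedge (p.2.1 1) (p.2.2 0) = 0 <;>
    by_cases a2 : wedge (p.2.1 2) (p.2.2 0) = 0 <;> simp_all

/-- With a noncritical fixed point scaled to `1`, the normal form is a lift of the class and depends
only on the ratios. -/
lemma injective_m2tm_ratio : Function.Injective M2tm.ratio := by
  intro m m' h
  obtain ⟨i, hi⟩ := m.exists_good
  have hi' := hi
  rw [h] at hi'
  obtain ⟨p, hp⟩ := isLiftSystem_m2tm.exists_lift m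
  obtain ⟨p', hp'⟩ := isLiftSystem_m2tm.exists_lift m'
  have d1 : i ≠ i + 1 := by fin_cases i <;> decide
  have d2 : i ≠ i + 2 := by fin_cases i <;> decide
  have d3 : i + 1 ≠ i + 2 := by fin_cases i <;> decide
  rw [hp.ratio_mul_ratio d1 d2 d3] at hi
  rw [hp'.ratio_mul_ratio d1 d2 d3] at hi'
  obtain ⟨x, hx, rfl⟩ := hp.tmSection hi.1 hi.2
  obtain ⟨y, hy, rfl⟩ := hp'.tmSection hi'.1 hi'.2
  rw [h] at hx
  rw [hx.eq hy]

lemma M2tm.ratio_self (m : M2tm) (i : Fin 3) : m.ratio i i = 0 := by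
  obtain ⟨p, hp⟩ := isLiftSystem_m2tm.exists_lift m
  rw [← hp.ratio_eq, QuadRat.ratio, ratioNum, sub_self, zero_div]

instance : T2Space M2tm := by
  refine T2Space.of_injective_continuous injective_m2tm_ratio
    (continuous_pi fun i => continuous_pi fun j => ?_)
  by_cases hij : i = j
  · subst hij
    simp only [M2tm.ratio_self]
    exact continuous_const
  · exact continuous_ratio hij

instance : SecondCountableTopology M2tm := ContinuousConstSMul.secondCountableTopology

/-- The pair `(s, t)` as a function with value `0` at `i`. -/
def extendZero (i : Fin 3) (s t : ℂ) : Fin 3 → ℂ :=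
  fun l => if l = i then 0 else if l = i + 1 then s else t

lemma extendZero_ratio (m : M2tm) (i : Fin 3) :
    extendZero i (m.ratio i (i + 1)) (m.ratio i (i + 2)) = fun l => m.ratio i l := by
  funext l
  have h0 := m.ratio_self i
  fin_cases i <;> fin_cases l <;> simp_all [extendZero]

/-- The charts of the moduli space of totally marked maps. -/
theorem exists_chart_m2tm (i : Fin 3) :
    ∃ e : OpenPartialHomeomorph M2tm (EuclideanSpace ℂ (Fin 2)),
      e.source = {m | m.ratio i (i + 1) * m.ratio i (i + 2) ≠ 1} ∧
      e.target = {t | t 0 * t 1 ≠ 1} ∧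
      (e : M2tm → EuclideanSpace ℂ (Fin 2)) =
        (fun m => !₂[m.ratio i (i + 1), m.ratio i (i + 2)]) ∧
      IsBiholomorphic M2tm.HolAt (fun g y => AnalyticAt ℂ g y) e := by
  have d1 : i ≠ i + 1 := by fin_cases i <;> decide
  have d2 : i ≠ i + 2 := by fin_cases i <;> decide
  have d3 : i + 1 ≠ i + 2 := by fin_cases i <;> decide
  have : Nonempty M2tm := ⟨(surjective_forget tripleFixed).choose.toModuli⟩
  have ht : ∀ i, ContDiff ℂ ω fun t : EuclideanSpace ℂ (Fin 2) => t i := fun i =>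
    (EuclideanSpace.proj i : EuclideanSpace ℂ (Fin 2) →L[ℂ] ℂ).contDiff
  have hsec : ∀ m : M2tm, m.ratio i (i + 1) * m.ratio i (i + 2) ≠ 1 →
      M2tm.IsLift (tmSection fun l => m.ratio i l) m := by
    intro m hm
    obtain ⟨p, hp⟩ := isLiftSystem_m2tm.exists_lift m
    rw [hp.ratio_mul_ratio d1 d2 d3] at hm
    exact hp.tmSection hm.1 hm.2
  obtain ⟨e, h1, h2, h3, h4⟩ := exists_chart_of_section isLiftSystem_m2tm
    (fun m => !₂[m.ratio i (i + 1), m.ratio i (i + 2)])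
    (S := {m | m.ratio i (i + 1) * m.ratio i (i + 2) ≠ 1}) (T := {t | t 0 * t 1 ≠ 1})
    (isOpen_ne.preimage ((continuous_ratio d1).mul (continuous_ratio d2)))
    (isOpen_ne.preimage ((ht 0).continuous.mul (ht 1).continuous))
    (fun m hm m' hm' h => by
      have e0 := congrArg (fun t : EuclideanSpace ℂ (Fin 2) => t 0) h
      have e1 := congrArg (fun t : EuclideanSpace ℂ (Fin 2) => t 1) h
      simp at e0 e1
      obtain ⟨x, hx, rfl⟩ := hsec m hm
      obtain ⟨y, hy, rfl⟩ := hsec m' hm'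
      rw [← extendZero_ratio] at hx hy
      rw [e0, e1] at hx
      rw [hx.eq hy])
    (fun m hm => by simpa using hm)
    (fun t => tmSection (extendZero i (t 0) (t 1)))
    (fun t _ => by
      refine analyticAt_of_contDiff ?_ t
      have h0 : ∀ l, ContDiff ℂ ω fun t : EuclideanSpace ℂ (Fin 2) =>
          extendZero i (t 0) (t 1) l := by
        intro l
        unfold extendZero
        split_ifs
        · exact contDiff_const
        · exact ht 0
        · exact ht 1
      refine ContDiff.prodMk (contDiff_pi.2 fun a => contDiff_pi.2 fun b => ?_)
        ((contDiff_pi.2 fun a => contDiff_pi.2 fun b => ?_).prodMk contDiff_const)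
      · fin_cases a <;> fin_cases b <;> simp [coefOfFixed] <;> fun_prop
      · fin_cases b <;> simp <;> fun_prop)
    (fun t ht => by
      have hT : t 0 * t 1 ≠ 1 := ht
      -- The entry at `i` is zero, so the only product that could equal `1` is `t 0 * t 1`.
      obtain ⟨x, hx⟩ := exists_isLift_tmSection (ρ := extendZero i (t 0) (t 1)) (by
        have hT' : t 1 * t 0 ≠ 1 := by rwa [mul_comm]
        intro a b hab
        fin_cases i <;> fin_cases a <;> fin_cases b <;> simp_all [extendZero])
      have hl : M2tm.IsLift (tmSection (extendZero i (t 0) (t 1))) x.toModuli := ⟨x, hx, rfl⟩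
      have hr : ∀ l, x.toModuli.ratio i l = extendZero i (t 0) (t 1) l := by
        intro l
        rw [← hl.ratio_eq, ratio_tmSection]
        simp [extendZero]
      have hr1 : x.toModuli.ratio i (i + 1) = t 0 := by
        rw [hr]; simp [extendZero]
      have hr2 : x.toModuli.ratio i (i + 2) = t 1 := by
        rw [hr]; simp [extendZero]
      refine ⟨x.toModuli, ?_, hl, ?_⟩
      · change x.toModuli.ratio i (i + 1) * x.toModuli.ratio i (i + 2) ≠ 1
        rwa [hr1, hr2]
      · ext n
        fin_cases n
        · exact hr1
        · exact hr2)
    (fun m _ => by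
      refine LiftsAt.of_analytic (fun q => !₂[ratio q i (i + 1), ratio q i (i + 2)])
        (fun q z hz => by rw [hz.ratio_eq, hz.ratio_eq]) fun q hq => ?_
      have h3 : AnalyticAt ℂ (fun q : TmLift =>
          (![ratio q i (i + 1), ratio q i (i + 2)] : Fin 2 → ℂ)) q := by
        refine AnalyticAt.pi fun n => ?_
        fin_cases n
        · exact hq.analyticAt_ratio d1
        · exact hq.analyticAt_ratio d2
      exact ((EuclideanSpace.equiv (Fin 2) ℂ).symm.toContinuousLinearMap.analyticAt _).comp h3)
  refine ⟨e, h1, h2, h3, fun x hx g => ?_⟩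
  rw [m2tm_holAt_iff]
  exact h4 x hx g

lemma m2tm_holAt_congr (g g' : M2tm → ℂ) (m : M2tm) (h : g =ᶠ[𝓝 m] g') (hg : M2tm.HolAt g m) :
    M2tm.HolAt g' m :=
  m2tm_holAt_iff.2 ((m2tm_holAt_iff.1 hg).congr isLiftSystem_m2tm h)

lemma isSmoothPoint_m2tm (m : M2tm) : IsSmoothPoint 2 M2tm.HolAt m := by
  obtain ⟨i, hi⟩ := m.exists_good
  obtain ⟨e, h1, -, -, h4⟩ := exists_chart_m2tm i
  exact ⟨e, h1 ▸ hi, h4⟩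

theorem isComplexManifold_m2tm : IsComplexManifold 2 M2tm.HolAt :=
  isComplexManifold_of_isSmoothPoint m2tm_holAt_congr isSmoothPoint_m2tm

/-! ### Stabilizers -/

lemma exists_mulVec_eq_smul {A : GL (Fin 2) ℂ} {z : OnePoint ℂ} (h : A • z = z) {v : Fin 2 → ℂ}
    (hv : IsHom v z) : ∃ a : ℂ, a ≠ 0 ∧ A.1.mulVec v = a • v := by
  have h1 := isHom_mulVec A hv
  rw [h] at h1
  obtain ⟨a, ha, h1⟩ := h1.exists_smul
  obtain ⟨b, hb, h2⟩ := hv.exists_smul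
  refine ⟨a * b⁻¹, mul_ne_zero ha (inv_ne_zero hb), ?_⟩
  rw [h1, h2, smul_smul, mul_assoc, inv_mul_cancel₀ hb, mul_one]

/-- The matrix has eigenvectors `u 0`, `u 1` and `w i`, where the `i`-th fixed point is not
critical. Since `w i` has both components nonzero in the basis `u 0, u 1`, all eigenvalues agree and
the matrix is scalar. -/
theorem free_tm (g : Rat1) (x : Rat2tm) (h : g • x = x) : g = 1 := by
  obtain ⟨A, rfl⟩ := exists_mobius g
  have hz : ∀ i, A • x.1.2.1 i = x.1.2.1 i := fun i =>
    congrFun (congrArg (fun y : Rat2tm => y.1.2.1) h) i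
  have hω : ∀ j, A • x.1.2.2 j = x.1.2.2 j := fun j =>
    congrFun (congrArg (fun y : Rat2tm => y.1.2.2) h) j
  obtain ⟨⟨c, w, u⟩, hp⟩ := isLiftSystem_tm.exists_lift x
  obtain ⟨i, hi⟩ := x.toModuli.exists_good
  rw [M2tm.IsLift.ratio_mul_ratio (p := (c, w, u)) ⟨x, hp, rfl⟩ (by fin_cases i <;> decide)
    (by fin_cases i <;> decide) (by fin_cases i <;> decide)] at hi
  obtain ⟨hi0, hi1⟩ := hi
  have hD := hp.critical.1
  simp only at hi0 hi1 hD
  obtain ⟨a, ha, hau⟩ := exists_mulVec_eq_smul (hω 0) (hp.2.2 0)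
  obtain ⟨b, hb, hbu⟩ := exists_mulVec_eq_smul (hω 1) (hp.2.2 1)
  obtain ⟨d, hd, hdw⟩ := exists_mulVec_eq_smul (hz i) (hp.2.1 i)
  simp only at hau hbu hdw
  have hexp : ∀ v, wedge (u 0) (u 1) • A.1.mulVec v =
      (wedge v (u 1) * a) • u 0 - (wedge v (u 0) * b) • u 1 := by
    intro v
    have : wedge (u 0) (u 1) • v = wedge v (u 1) • u 0 - wedge v (u 0) • u 1 := by
      ext n; fin_cases n <;> simp [wedge] <;> ring
    rw [← Matrix.mulVec_smul, this, Matrix.mulVec_sub, Matrix.mulVec_smul, Matrix.mulVec_smul,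
      hau, hbu, smul_smul, smul_smul]
  have hw := hexp (w i)
  rw [hdw] at hw
  have hw0 := congrFun hw 0
  have hw1 := congrFun hw 1
  simp only [Pi.smul_apply, Pi.sub_apply, smul_eq_mul] at hw0 hw1
  have hda : d = a := by
    have : (d - a) * (wedge (w i) (u 1) * wedge (u 0) (u 1)) = 0 := by
      have h1 : wedge (w i) (u 1) = w i 0 * u 1 1 - w i 1 * u 1 0 := rfl
      have h2 : wedge (u 0) (u 1) = u 0 0 * u 1 1 - u 0 1 * u 1 0 := rfl
      linear_combination u 1 1 * hw0 - u 1 0 * hw1 + d * wedge (u 0) (u 1) * h1 -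
        a * wedge (w i) (u 1) * h2
    exact sub_eq_zero.1 ((mul_eq_zero.1 this).resolve_right (mul_ne_zero hi1 hD))
  have hdb : d = b := by
    have : (d - b) * (wedge (w i) (u 0) * wedge (u 0) (u 1)) = 0 := by
      have h1 : wedge (w i) (u 0) = w i 0 * u 0 1 - w i 1 * u 0 0 := rfl
      have h2 : wedge (u 0) (u 1) = u 0 0 * u 1 1 - u 0 1 * u 1 0 := rfl
      linear_combination u 0 1 * hw0 - u 0 0 * hw1 + d * wedge (u 0) (u 1) * h1 -
        b * wedge (w i) (u 0) * h2
    exact sub_eq_zero.1 ((mul_eq_zero.1 this).resolve_right (mul_ne_zero hi0 hD))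
  have hA : ∀ v, A.1.mulVec v = a • v := by
    intro v
    have h1 := hexp v
    rw [← hdb, hda] at h1
    have : wedge (u 0) (u 1) • A.1.mulVec v = wedge (u 0) (u 1) • (a • v) := by
      rw [h1]
      ext n; fin_cases n <;> simp [wedge] <;> ring
    exact smul_right_injective _ hD this
  refine Subtype.ext (Equiv.ext fun z => ?_)
  change A • z = z
  rw [smul_eq_proj, hA, proj_smul ha, proj_hc]

lemma ratio_eq_zero_of_forget_eq {x : Rat2tm} (h : forget x = tripleFixed) (i j : Fin 3) :
    x.ratio i j = 0 := by
  have hz : x.1.2.1 = fun _ => OnePoint.infty := congrArg (fun t : Rat2fm => t.1.2) h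
  obtain ⟨⟨c, w, u⟩, hp⟩ := isLiftSystem_tm.exists_lift x
  have hl : Rat2tm.IsLift (c, fun i => hc (x.1.2.1 i), u) x :=
    ⟨hp.1, fun i => isHom_hc _, hp.2.2⟩
  rw [← hl.ratio_eq', ratio, ratioNum]
  simp [hz]

lemma swap_smul_ne (x : Rat2tm) : (Equiv.swap 0 1 : Equiv.Perm (Fin 2)) • x ≠ x := by
  intro h
  have : x.1.2.2 1 = x.1.2.2 0 := congrFun (congrArg (fun y : Rat2tm => y.1.2.2) h) 0
  exact x.2.2.1 this.symm

lemma forget_smul (g : Rat1) (x : Rat2tm) : forget (g • x) = g • forget x := rfl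

/-- By freeness on totally marked maps, a nontrivial stabilizer must exchange the critical points.
It preserves the ratios while the exchange negates them, so they all vanish, and this determines the
class. Conversely, vanishing ratios make the swapped map conjugate to the original, by an element
that is nontrivial because the swap moves the marking. -/
theorem nonfree_fm_iff (x : Rat2fm) :
    (∃ g : Rat1, g ≠ 1 ∧ g • x = x) ↔ x ∈ MulAction.orbit Rat1 tripleFixed := by
  obtain ⟨x₀, hx₀⟩ := surjective_forget tripleFixed
  constructor
  · rintro ⟨g, hg, hgx⟩
    obtain ⟨y, rfl⟩ := surjective_forget x
    rw [← forget_smul, forget_eq_iff] at hgx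
    obtain ⟨σ, hσ⟩ := hgx
    rcases perm_eq σ with rfl | rfl
    · rw [one_smul] at hσ
      exact (hg (free_tm g y hσ.symm)).elim
    · have hr : y.toModuli.ratio = x₀.toModuli.ratio := by
        funext i j
        rw [ratio_toModuli, ratio_toModuli, ratio_eq_zero_of_forget_eq hx₀]
        have h1 := ratio_perm_swap y i j
        rw [hσ, ratio_smul] at h1
        linear_combination (1 / 2 : ℂ) * h1
      obtain ⟨h, rfl⟩ := toModuli_eq_iff.1 (injective_m2tm_ratio hr)
      exact ⟨h, by rw [← hx₀]; rfl⟩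
  · rintro ⟨h, rfl⟩
    have hr : ((Equiv.swap 0 1 : Equiv.Perm (Fin 2)) • h • x₀).toModuli.ratio =
        (h • x₀).toModuli.ratio := by
      funext i j
      rw [ratio_toModuli, ratio_toModuli, ratio_perm_swap, ratio_smul,
        ratio_eq_zero_of_forget_eq hx₀, neg_zero]
    obtain ⟨g, hg⟩ := toModuli_eq_iff.1 (injective_m2tm_ratio hr)
    refine ⟨g, ?_, ?_⟩
    · rintro rfl
      rw [one_smul] at hg
      exact swap_smul_ne _ hg.symm
    · have := congrArg forget hg
      rwa [forget_perm_smul, forget_smul, forget_smul, hx₀] at this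

/-! ### The quadratic cone as a quotient of the plane -/

/-- The parametrization `(s, t) ↦ (s² - t², 2 s t, i (s² + t²))` of the cone
`z₁² + z₂² + z₃² = 0`. -/
def coneMap (v : EuclideanSpace ℂ (Fin 2)) : Brieskorn 2 2 2 :=
  ⟨![v 0 ^ 2 - v 1 ^ 2, 2 * (v 0 * v 1), Complex.I * (v 0 ^ 2 + v 1 ^ 2)], by
    simp only [Matrix.cons_val_zero, Matrix.cons_val_one, Matrix.cons_val]
    linear_combination (v 0 ^ 2 + v 1 ^ 2) ^ 2 * Complex.I_sq⟩

lemma contDiff_coord {n : ℕ} (i : Fin n) :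
    ContDiff ℂ ω fun t : EuclideanSpace ℂ (Fin n) => t i :=
  (EuclideanSpace.proj i : EuclideanSpace ℂ (Fin n) →L[ℂ] ℂ).contDiff

lemma contDiff_coneMap : ContDiff ℂ ω fun v => (coneMap v).1 := by
  have h0 := contDiff_coord (n := 2) 0
  have h1 := contDiff_coord (n := 2) 1
  refine contDiff_pi.2 fun i => ?_
  fin_cases i <;> simp [coneMap] <;> fun_prop

lemma continuous_coneMap : Continuous coneMap :=
  Continuous.subtype_mk contDiff_coneMap.continuous _

lemma coneMap_neg (v : EuclideanSpace ℂ (Fin 2)) : coneMap (-v) = coneMap v := by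
  simp [coneMap]

lemma coneMap_sq_fst (v : EuclideanSpace ℂ (Fin 2)) :
    ((coneMap v).1 0 - Complex.I * (coneMap v).1 2) / 2 = v 0 ^ 2 := by
  simp only [coneMap, Matrix.cons_val_zero, Matrix.cons_val]
  linear_combination (-(v 0 ^ 2 + v 1 ^ 2) / 2) * Complex.I_sq

lemma coneMap_sq_snd (v : EuclideanSpace ℂ (Fin 2)) :
    (-(coneMap v).1 0 - Complex.I * (coneMap v).1 2) / 2 = v 1 ^ 2 := by
  simp only [coneMap, Matrix.cons_val_zero, Matrix.cons_val]
  linear_combination (-(v 0 ^ 2 + v 1 ^ 2) / 2) * Complex.I_sq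

lemma coneMap_mul (v : EuclideanSpace ℂ (Fin 2)) : (coneMap v).1 1 / 2 = v 0 * v 1 := by
  simp [coneMap]

lemma coneMap_eq_of {z : Brieskorn 2 2 2} {v : EuclideanSpace ℂ (Fin 2)}
    (h0 : v 0 ^ 2 = (z.1 0 - Complex.I * z.1 2) / 2)
    (h1 : v 1 ^ 2 = (-z.1 0 - Complex.I * z.1 2) / 2) (h2 : v 0 * v 1 = z.1 1 / 2) :
    coneMap v = z := by
  refine Subtype.ext (funext fun i => ?_)
  fin_cases i
  · simp [coneMap, h0, h1]; ring
  · simp [coneMap, h2]; ring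
  · simp [coneMap, h0, h1]
    linear_combination -z.1 2 * Complex.I_sq

/-- In the linear coordinates corresponding to `s²`, `t²` and `s t`, the cone is given by `x y =
w²`. -/
lemma cone_mul (z : Brieskorn 2 2 2) : (z.1 0 - Complex.I * z.1 2) / 2 *
    ((-z.1 0 - Complex.I * z.1 2) / 2) = (z.1 1 / 2) ^ 2 := by
  linear_combination (-1 / 4 : ℂ) * z.2 + (z.1 2 ^ 2 / 4) * Complex.I_sq

lemma surjective_coneMap : Function.Surjective coneMap := by
  intro z
  obtain ⟨s, hs⟩ := IsAlgClosed.exists_pow_nat_eq ((z.1 0 - Complex.I * z.1 2) / 2) (n := 2)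
    (by norm_num)
  obtain ⟨t, ht⟩ := IsAlgClosed.exists_pow_nat_eq ((-z.1 0 - Complex.I * z.1 2) / 2) (n := 2)
    (by norm_num)
  have hst : (s * t) ^ 2 = (z.1 1 / 2) ^ 2 := by rw [mul_pow, hs, ht, cone_mul]
  rcases sq_eq_sq_iff_eq_or_eq_neg.1 hst with h | h
  · exact ⟨!₂[s, t], coneMap_eq_of (by simpa using hs) (by simpa using ht) (by simpa using h)⟩
  · refine ⟨!₂[s, -t], coneMap_eq_of (by simpa using hs) (by simpa using ht) ?_⟩
    simp only [Matrix.cons_val_zero, Matrix.cons_val_one]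
    linear_combination -h

lemma coneMap_eq_iff {v w : EuclideanSpace ℂ (Fin 2)} :
    coneMap v = coneMap w ↔ v = w ∨ v = -w := by
  constructor
  · intro h
    have h0 : v 0 ^ 2 = w 0 ^ 2 := by rw [← coneMap_sq_fst, ← coneMap_sq_fst, h]
    have h1 : v 1 ^ 2 = w 1 ^ 2 := by rw [← coneMap_sq_snd, ← coneMap_sq_snd, h]
    have h2 : v 0 * v 1 = w 0 * w 1 := by rw [← coneMap_mul, ← coneMap_mul, h]
    have hext : ∀ a b : EuclideanSpace ℂ (Fin 2), a 0 = b 0 → a 1 = b 1 → a = b := by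
      intro a b ha hb
      ext i
      fin_cases i
      · exact ha
      · exact hb
    by_cases hw : w 0 = 0
    · have hv : v 0 = 0 := by simpa [hw] using h0
      rcases sq_eq_sq_iff_eq_or_eq_neg.1 h1 with h | h
      · exact Or.inl (hext _ _ (by rw [hv, hw]) h)
      · exact Or.inr (hext _ _ (by simp [hv, hw]) (by simpa using h))
    · rcases sq_eq_sq_iff_eq_or_eq_neg.1 h0 with h | h
      · rw [h] at h2
        exact Or.inl (hext _ _ h (mul_left_cancel₀ hw h2))
      · refine Or.inr (hext _ _ (by simpa using h) ?_)
        rw [h] at h2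
        apply mul_left_cancel₀ hw
        simp only [PiLp.neg_apply]
        linear_combination -h2
  · rintro (rfl | rfl)
    · rfl
    · exact coneMap_neg w

/-- Quadratic growth makes `coneMap` proper, hence closed. -/
lemma norm_sq_le_coneMap (v : EuclideanSpace ℂ (Fin 2)) : ‖v‖ ^ 2 ≤ 2 * ‖(coneMap v).1‖ := by
  have h0 : ‖v 0‖ ^ 2 ≤ ‖(coneMap v).1‖ := by
    rw [← norm_pow, ← coneMap_sq_fst, norm_div, Complex.norm_ofNat,
      div_le_iff₀ (by norm_num : (0 : ℝ) < 2)]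
    refine (norm_sub_le _ _).trans ?_
    rw [norm_mul, Complex.norm_I, one_mul]
    linarith [norm_le_pi_norm (coneMap v).1 0, norm_le_pi_norm (coneMap v).1 2]
  have h1 : ‖v 1‖ ^ 2 ≤ ‖(coneMap v).1‖ := by
    rw [← norm_pow, ← coneMap_sq_snd, norm_div, Complex.norm_ofNat,
      div_le_iff₀ (by norm_num : (0 : ℝ) < 2)]
    refine (norm_sub_le _ _).trans ?_
    rw [norm_mul, Complex.norm_I, one_mul, norm_neg]
    linarith [norm_le_pi_norm (coneMap v).1 0, norm_le_pi_norm (coneMap v).1 2]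
  rw [EuclideanSpace.norm_sq_eq, Fin.sum_univ_two]
  linarith

lemma isClosedMap_coneMap : IsClosedMap coneMap := by
  have hproper : IsProperMap fun v => (coneMap v).1 := by
    rw [isProperMap_iff_tendsto_cocompact]
    refine ⟨contDiff_coneMap.continuous, ?_⟩
    rw [← Metric.cobounded_eq_cocompact, ← Metric.cobounded_eq_cocompact,
      ← tendsto_norm_atTop_iff_cobounded]
    have h1 : Filter.Tendsto (fun v : EuclideanSpace ℂ (Fin 2) => ‖v‖ ^ 2 / 2)
        (Bornology.cobounded _) Filter.atTop :=
      ((Filter.tendsto_pow_atTop two_ne_zero).comp tendsto_norm_cobounded_atTop).atTop_div_const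
        (by norm_num)
    refine Filter.tendsto_atTop_mono (fun v => ?_) h1
    have := norm_sq_le_coneMap v
    linarith
  intro K hK
  have h := hproper.isClosedMap K hK
  have : coneMap '' K = Subtype.val ⁻¹' ((fun v => (coneMap v).1) '' K) := by
    ext z
    constructor
    · rintro ⟨v, hv, rfl⟩
      exact ⟨v, hv, rfl⟩
    · rintro ⟨v, hv, h⟩
      exact ⟨v, hv, Subtype.ext h⟩
  rw [this]
  exact h.preimage continuous_subtype_val

/-- The fibres are the pairs `±v`, so the complement of the image of `U` is the image of the closed
set `(U ∪ -U)ᶜ`. -/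
lemma isOpenMap_coneMap : IsOpenMap coneMap := by
  intro U hU
  have hclosed : IsClosed (U ∪ -U)ᶜ := (hU.union hU.neg).isClosed_compl
  have : coneMap '' U = (coneMap '' (U ∪ -U)ᶜ)ᶜ := by
    ext z
    constructor
    · rintro ⟨v, hv, rfl⟩ ⟨w, hw, h⟩
      apply hw
      rcases coneMap_eq_iff.1 h with rfl | rfl
      · exact Or.inl hv
      · exact Or.inr (by simpa using hv)
    · intro hz
      obtain ⟨v, rfl⟩ := surjective_coneMap z
      by_cases hv : v ∈ U ∪ -U
      · rcases hv with hv | hv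
        · exact ⟨v, hv, rfl⟩
        · exact ⟨-v, hv, coneMap_neg v⟩
      · exact (hz ⟨v, hv, rfl⟩).elim
  rw [this]
  exact (isClosedMap_coneMap _ hclosed).isOpen_compl

/-! ### Even analytic functions -/

section Even

/-- The monomials of degree two in the coordinates. -/
def quadMonomials (v : EuclideanSpace ℂ (Fin 2)) : (Fin 2 → Fin 2) → ℂ := fun k => ∏ b, v (k b)

/-- The standard basis vectors selected by a sequence of pairs of indices. -/
def basisSeq {m : ℕ} (k : Fin m → Fin 2 → Fin 2) (l : Fin (m * 2)) : EuclideanSpace ℂ (Fin 2) :=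
  EuclideanSpace.single (k (finProdFinEquiv.symm l).1 (finProdFinEquiv.symm l).2) 1

/-- The even part of a power series in two variables, as a power series in the monomials of
degree two. -/
def evenSeries (p : FormalMultilinearSeries ℂ (EuclideanSpace ℂ (Fin 2)) ℂ) :
    FormalMultilinearSeries ℂ ((Fin 2 → Fin 2) → ℂ) ℂ := fun m =>
  ∑ k : Fin m → Fin 2 → Fin 2, p (m * 2) (basisSeq k) •
    (ContinuousMultilinearMap.mkPiAlgebra ℂ (Fin m) ℂ).compContinuousLinearMap
      fun l => ContinuousLinearMap.proj (k l)

/-- Expanding `v` in the standard basis gives a sum over index sequences of length `2 m`; cutting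
each into consecutive pairs turns it into a sequence of `m` quadratic monomials. -/
lemma evenSeries_apply (p : FormalMultilinearSeries ℂ (EuclideanSpace ℂ (Fin 2)) ℂ) (m : ℕ)
    (v : EuclideanSpace ℂ (Fin 2)) :
    (evenSeries p m fun _ => quadMonomials v) = p (m * 2) fun _ => v := by
  have hv : v = ∑ i, v i • EuclideanSpace.single i (1 : ℂ) := by
    ext j
    fin_cases j <;> simp [Fin.sum_univ_two]
  have h1 : (p (m * 2) fun _ => v) = ∑ r : Fin (m * 2) → Fin 2,
      (∏ l, v (r l)) • p (m * 2) fun l => EuclideanSpace.single (r l) (1 : ℂ) := by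
    conv_lhs => rw [hv]
    rw [ContinuousMultilinearMap.map_sum]
    refine Finset.sum_congr rfl fun r _ => ?_
    rw [ContinuousMultilinearMap.map_smul_univ]
  let Eqv : (Fin m → Fin 2 → Fin 2) ≃ (Fin (m * 2) → Fin 2) :=
    (Equiv.curry (Fin m) (Fin 2) (Fin 2)).symm.trans
      (Equiv.arrowCongr finProdFinEquiv (Equiv.refl _))
  rw [h1, ← Eqv.sum_comp]
  simp only [evenSeries, sum_apply, smul_apply,
    ContinuousMultilinearMap.compContinuousLinearMap_apply,
    ContinuousMultilinearMap.mkPiAlgebra_apply, ContinuousLinearMap.proj_apply, smul_eq_mul]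
  refine Finset.sum_congr rfl fun k _ => ?_
  rw [mul_comm]
  congr 1
  rw [← finProdFinEquiv.prod_comp, Fintype.prod_prod_type]
  refine Finset.prod_congr rfl fun a _ => Finset.prod_congr rfl fun b _ => ?_
  simp [Eqv, Function.uncurry]

lemma norm_evenSeries_le (p : FormalMultilinearSeries ℂ (EuclideanSpace ℂ (Fin 2)) ℂ) (m : ℕ) :
    ‖evenSeries p m‖ ≤ 4 ^ m * ‖p (m * 2)‖ := by
  have hterm : ∀ k : Fin m → Fin 2 → Fin 2, ‖p (m * 2) (basisSeq k) •
      (ContinuousMultilinearMap.mkPiAlgebra ℂ (Fin m) ℂ).compContinuousLinearMap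
        fun l => (ContinuousLinearMap.proj (k l) : ((Fin 2 → Fin 2) → ℂ) →L[ℂ] ℂ)‖ ≤
      ‖p (m * 2)‖ := by
    intro k
    refine ContinuousMultilinearMap.opNorm_le_bound (norm_nonneg _) fun M => ?_
    simp only [smul_apply,
      ContinuousMultilinearMap.compContinuousLinearMap_apply,
      ContinuousMultilinearMap.mkPiAlgebra_apply, ContinuousLinearMap.proj_apply, norm_smul]
    refine mul_le_mul ?_ ?_ (norm_nonneg _) (norm_nonneg _)
    · refine ((p (m * 2)).le_opNorm _).trans ?_
      simp [basisSeq]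
    · rw [norm_prod]
      exact Finset.prod_le_prod (fun _ _ => norm_nonneg _) fun l _ => norm_le_pi_norm (M l) (k l)
  refine (norm_sum_le _ _).trans ((Finset.sum_le_sum fun k _ => hterm k).trans ?_)
  simp

lemma evenSeries_radius_pos {p : FormalMultilinearSeries ℂ (EuclideanSpace ℂ (Fin 2)) ℂ}
    (hp : 0 < p.radius) : 0 < (evenSeries p).radius := by
  obtain ⟨r, hr0, hr⟩ := ENNReal.lt_iff_exists_nnreal_btwn.1 hp
  have hr0' : 0 < r := by exact_mod_cast hr0
  obtain ⟨C, hC, hpC⟩ := p.norm_le_div_pow_of_pos_of_lt_radius hr0' hr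
  -- The square appears because degree `m` uses the coefficient of degree `2 m`; the `4` absorbs the
  -- `4 ^ m` sequences of index pairs.
  have hle : ((r ^ 2 / 4 : NNReal) : ENNReal) ≤ (evenSeries p).radius := by
    refine FormalMultilinearSeries.le_radius_of_bound _ C fun m => ?_
    have h1 := norm_evenSeries_le p m
    have h2 := hpC (m * 2)
    have hr1 : (0 : ℝ) < r := by exact_mod_cast hr0'
    calc ‖evenSeries p m‖ * ((r ^ 2 / 4 : NNReal) : ℝ) ^ m
        ≤ 4 ^ m * (C / (r : ℝ) ^ (m * 2)) * ((r ^ 2 / 4 : NNReal) : ℝ) ^ m := by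
          gcongr
          exact h1.trans (by gcongr)
      _ = C := by
          push_cast
          rw [div_pow, mul_comm m 2, pow_mul]
          have : ((r : ℝ) ^ 2) ^ m ≠ 0 := by positivity
          field_simp
  refine lt_of_lt_of_le ?_ hle
  have : 0 < r ^ 2 / 4 := by positivity
  exact_mod_cast this

/-- Averaging the expansions at `v` and `-v` removes the odd terms, and the even ones regroup into a
convergent series in the quadratic monomials. -/
lemma exists_analytic_of_even {f : EuclideanSpace ℂ (Fin 2) → ℂ} (hf : AnalyticAt ℂ f 0)
    (heven : ∀ v, f (-v) = f v) : ∃ G : ((Fin 2 → Fin 2) → ℂ) → ℂ, AnalyticAt ℂ G 0 ∧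
      ∀ᶠ v in 𝓝 0, f v = G (quadMonomials v) := by
  obtain ⟨p, r, hp⟩ := hf
  have hpos : 0 < p.radius := hp.r_pos.trans_le hp.r_le
  refine ⟨(evenSeries p).sum,
    ((evenSeries p).hasFPowerSeriesOnBall (evenSeries_radius_pos hpos)).analyticAt, ?_⟩
  filter_upwards [Metric.eball_mem_nhds (0 : EuclideanSpace ℂ (Fin 2)) hp.r_pos] with v hv
  have hv' : -v ∈ Metric.eball (0 : EuclideanSpace ℂ (Fin 2)) r := by
    simpa using hv
  have h1 := hp.hasSum hv
  have h2 := hp.hasSum hv'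
  simp only [zero_add, heven] at h1 h2
  have h3 : HasSum (fun n => (1 / 2 : ℂ) * ((p n fun _ => v) + (p n fun _ => -v))) (f v) := by
    have hfv : (1 / 2 : ℂ) * (f v + f v) = f v := by ring
    have := (h1.add h2).mul_left (1 / 2 : ℂ)
    rwa [hfv] at this
  have hneg : ∀ n, (p n fun _ => -v) = (-1) ^ n * p n fun _ => v := by
    intro n
    have := (p n).map_smul_univ (fun _ => (-1 : ℂ)) fun _ => v
    simpa using this
  have h4 : HasSum (fun m : ℕ => p (m * 2) fun _ => v) (f v) := by
    have hinj : Function.Injective fun m : ℕ => m * 2 := fun a b h => by simpa using h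
    rw [← hinj.hasSum_iff] at h3
    · convert h3 using 1
      funext m
      simp only [Function.comp_apply]
      rw [hneg, mul_comm m 2, pow_mul]
      norm_num
      ring
    · intro n hn
      have hodd : Odd n := by
        rw [← Nat.not_even_iff_odd]
        rintro ⟨k, hk⟩
        exact hn ⟨k, by simp only; omega⟩
      rw [hneg, hodd.neg_one_pow]
      ring
  rw [← h4.tsum_eq, FormalMultilinearSeries.sum]
  exact tsum_congr fun m => (evenSeries_apply p m v).symm

end Even

/-! ### Holomorphic functions on the cone -/

/-- The monomials of degree two in terms of the coordinates of the cone. -/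
def coneMonomials (z : Fin 3 → ℂ) : (Fin 2 → Fin 2) → ℂ := fun k =>
  if k 0 = k 1 then
    if k 0 = 0 then (z 0 - Complex.I * z 2) / 2 else (-z 0 - Complex.I * z 2) / 2
  else z 1 / 2

lemma coneMonomials_coneMap (v : EuclideanSpace ℂ (Fin 2)) :
    coneMonomials (coneMap v).1 = quadMonomials v := by
  funext k
  simp only [coneMonomials, quadMonomials, Fin.prod_univ_two, coneMap_sq_fst, coneMap_sq_snd,
    coneMap_mul]
  generalize k 0 = a
  generalize k 1 = b
  fin_cases a <;> fin_cases b <;> simp [sq, mul_comm]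

lemma contDiff_coneMonomials : ContDiff ℂ ω coneMonomials := by
  refine contDiff_pi.2 fun k => ?_
  unfold coneMonomials
  split_ifs <;> fun_prop

lemma analyticAt_toLp {E : Type} [NormedAddCommGroup E] [NormedSpace ℂ E] {a b : E → ℂ} {x : E}
    (ha : AnalyticAt ℂ a x) (hb : AnalyticAt ℂ b x) :
    AnalyticAt ℂ (fun y => (!₂[a y, b y] : EuclideanSpace ℂ (Fin 2))) x := by
  have h3 : AnalyticAt ℂ (fun y => (![a y, b y] : Fin 2 → ℂ)) x := by
    refine AnalyticAt.pi fun n => ?_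
    fin_cases n
    · exact ha
    · exact hb
  exact ((EuclideanSpace.equiv (Fin 2) ℂ).symm.toContinuousLinearMap.analyticAt _).comp h3

lemma cone_holAt_of_section {g : Brieskorn 2 2 2 → ℂ} {v : EuclideanSpace ℂ (Fin 2)}
    (hg : AnalyticAt ℂ (g ∘ coneMap) v) {ψ : (Fin 3 → ℂ) → EuclideanSpace ℂ (Fin 2)}
    (hψ : AnalyticAt ℂ ψ (coneMap v).1) (hv : ψ (coneMap v).1 = v)
    (h : ∀ᶠ z : Brieskorn 2 2 2 in 𝓝 (coneMap v), coneMap (ψ z.1) = z) :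
    Brieskorn.HolAt 2 2 2 g (coneMap v) := by
  refine ⟨(g ∘ coneMap) ∘ ψ, AnalyticAt.comp (by rwa [hv]) hψ, ?_⟩
  filter_upwards [h] with z hz
  simp [hz]

/-- Away from the vertex, a branch of the square root gives `s` or `t`, and `s t` gives the other,
so `coneMap` has a local analytic section. At the vertex the evenness of `g ∘ coneMap` replaces the
section. -/
lemma cone_holAt_iff (g : Brieskorn 2 2 2 → ℂ) (v : EuclideanSpace ℂ (Fin 2)) :
    Brieskorn.HolAt 2 2 2 g (coneMap v) ↔ AnalyticAt ℂ (g ∘ coneMap) v := by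
  constructor
  · rintro ⟨G, hG, h⟩
    refine (AnalyticAt.comp (g := G) (f := fun v => (coneMap v).1) hG
      (analyticAt_of_contDiff contDiff_coneMap v)).congr ?_
    filter_upwards [continuous_coneMap.continuousAt.eventually h] with w hw
    exact hw.symm
  · intro hg
    by_cases h0 : v 0 = 0
    · by_cases h1 : v 1 = 0
      · have hv : v = 0 := by
          ext i
          fin_cases i
          · exact h0
          · exact h1
        subst hv
        obtain ⟨G, hG, h⟩ := exists_analytic_of_even hg fun v => by simp [coneMap_neg]
        have hz : coneMonomials (coneMap 0).1 = 0 := by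
          rw [coneMonomials_coneMap]
          funext k
          simp [quadMonomials]
        refine ⟨G ∘ coneMonomials, AnalyticAt.comp (by rwa [hz])
          (analyticAt_of_contDiff contDiff_coneMonomials _), ?_⟩
        filter_upwards [isOpenMap_coneMap.image_mem_nhds h]
        rintro _ ⟨w, hw, rfl⟩
        rw [Function.comp_apply, coneMonomials_coneMap]
        exact hw
      · obtain ⟨t, ht, ht0, ht2⟩ := exists_analytic_sqrt
          (D := fun z : Fin 3 → ℂ => (-z 0 - Complex.I * z 2) / 2) (x := (coneMap v).1)
          (analyticAt_of_contDiff (by fun_prop) _) h1 (coneMap_sq_snd v)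
        have hs : AnalyticAt ℂ (fun z : Fin 3 → ℂ => z 1 / (2 * t z)) (coneMap v).1 :=
          (analyticAt_of_contDiff (by fun_prop) _).div (analyticAt_const.mul ht)
            (by rw [ht0]; exact mul_ne_zero two_ne_zero h1)
        refine cone_holAt_of_section hg (analyticAt_toLp hs ht) ?_ ?_
        · ext i
          fin_cases i
          · have := coneMap_mul v
            simp only [Fin.zero_eta, Matrix.cons_val_zero, ht0]
            field_simp
            linear_combination 2 * this
          · simp [ht0]
        · have hne : ∀ᶠ z in 𝓝 (coneMap v).1, t z ≠ 0 :=
            ht.continuousAt.eventually_ne (by rwa [ht0])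
          filter_upwards [continuous_subtype_val.continuousAt.eventually hne,
            continuous_subtype_val.continuousAt.eventually ht2] with z hz hz2
          have hm := cone_mul z
          rw [← hz2] at hm
          refine coneMap_eq_of ?_ ?_ ?_
          · simp only [Matrix.cons_val_zero]
            rw [div_pow, div_eq_iff (pow_ne_zero 2 (mul_ne_zero two_ne_zero hz))]
            linear_combination -4 * hm
          · simpa using hz2
          · simp only [Matrix.cons_val_zero, Matrix.cons_val_one]
            field_simp
    · obtain ⟨s, hs, hs0, hs2⟩ := exists_analytic_sqrt
        (D := fun z : Fin 3 → ℂ => (z 0 - Complex.I * z 2) / 2) (x := (coneMap v).1)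
        (analyticAt_of_contDiff (by fun_prop) _) h0 (coneMap_sq_fst v)
      have ht : AnalyticAt ℂ (fun z : Fin 3 → ℂ => z 1 / (2 * s z)) (coneMap v).1 :=
        (analyticAt_of_contDiff (by fun_prop) _).div (analyticAt_const.mul hs)
          (by rw [hs0]; exact mul_ne_zero two_ne_zero h0)
      refine cone_holAt_of_section hg (analyticAt_toLp hs ht) ?_ ?_
      · ext i
        fin_cases i
        · simp [hs0]
        · have := coneMap_mul v
          simp only [Fin.mk_one, Matrix.cons_val_one, Matrix.cons_val_fin_one, hs0]
          field_simp
          linear_combination 2 * this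
      · have hne : ∀ᶠ z in 𝓝 (coneMap v).1, s z ≠ 0 :=
          hs.continuousAt.eventually_ne (by rwa [hs0])
        filter_upwards [continuous_subtype_val.continuousAt.eventually hne,
          continuous_subtype_val.continuousAt.eventually hs2] with z hz hz2
        have hm := cone_mul z
        rw [← hz2] at hm
        refine coneMap_eq_of ?_ ?_ ?_
        · simpa using hz2
        · simp only [Matrix.cons_val_one, Matrix.cons_val_fin_one]
          rw [div_pow, div_eq_iff (pow_ne_zero 2 (mul_ne_zero two_ne_zero hz))]
          linear_combination -4 * hm
        · simp only [Matrix.cons_val_zero, Matrix.cons_val_one]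
          field_simp

/-! ### The cone is singular at the origin -/

/-- A totally isotropic subspace of `ℂ³` has dimension at most one: every component of `A × B` has
square zero. -/
lemma exists_relation_of_isotropic {A B : Fin 3 → ℂ} (hAA : A 0 ^ 2 + A 1 ^ 2 + A 2 ^ 2 = 0)
    (hBB : B 0 ^ 2 + B 1 ^ 2 + B 2 ^ 2 = 0) (hAB : A 0 * B 0 + A 1 * B 1 + A 2 * B 2 = 0) :
    ∃ a b : ℂ, (a ≠ 0 ∨ b ≠ 0) ∧ ∀ j, a * A j + b * B j = 0 := by
  by_cases hA : ∀ j, A j = 0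
  · exact ⟨1, 0, by simp, by simp [hA]⟩
  push Not at hA
  have hcross : A 0 * B 1 - A 1 * B 0 = 0 ∧ A 0 * B 2 - A 2 * B 0 = 0 ∧
      A 1 * B 2 - A 2 * B 1 = 0 := by
    -- Up to sign, these six relations are the components of `A × (A × B) = 0` and `B × (A × B) =
    -- 0`.
    have a1 : A 1 * (A 0 * B 1 - A 1 * B 0) + A 2 * (A 0 * B 2 - A 2 * B 0) = 0 := by
      linear_combination A 0 * hAB - B 0 * hAA
    have a2 : A 2 * (A 1 * B 2 - A 2 * B 1) - A 0 * (A 0 * B 1 - A 1 * B 0) = 0 := by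
      linear_combination A 1 * hAB - B 1 * hAA
    have a3 : A 0 * (A 0 * B 2 - A 2 * B 0) + A 1 * (A 1 * B 2 - A 2 * B 1) = 0 := by
      linear_combination B 2 * hAA - A 2 * hAB
    have b1 : B 1 * (A 0 * B 1 - A 1 * B 0) + B 2 * (A 0 * B 2 - A 2 * B 0) = 0 := by
      linear_combination A 0 * hBB - B 0 * hAB
    have b2 : B 2 * (A 1 * B 2 - A 2 * B 1) - B 0 * (A 0 * B 1 - A 1 * B 0) = 0 := by
      linear_combination A 1 * hBB - B 1 * hAB
    have b3 : B 0 * (A 0 * B 2 - A 2 * B 0) + B 1 * (A 1 * B 2 - A 2 * B 1) = 0 := by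
      linear_combination B 2 * hAB - A 2 * hBB
    refine ⟨sq_eq_zero_iff.1 ?_, sq_eq_zero_iff.1 ?_, sq_eq_zero_iff.1 ?_⟩
    · linear_combination -B 1 * a2 - B 0 * a1 + A 2 * b3
    · linear_combination B 2 * a3 - B 0 * a1 - A 1 * b2
    · linear_combination B 2 * a3 - B 1 * a2 - A 0 * b1
  obtain ⟨h01, h02, h12⟩ := hcross
  obtain ⟨k, hk⟩ := hA
  refine ⟨B k, -A k, Or.inr (neg_ne_zero.2 hk), fun j => ?_⟩
  fin_cases k <;> fin_cases j <;> simp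
  all_goals first | ring1 | linear_combination h01 | linear_combination -h01 |
    linear_combination h02 | linear_combination -h02 | linear_combination h12 |
    linear_combination -h12

/-- The inverse of a chart would be an analytic map from an open set of `ℂ²` to `ℂ³` with injective
derivative at the vertex. The equation of the cone makes the image of that derivative isotropic,
which its dimension forbids. -/
lemma not_isSmoothPoint_cone (z₀ : Brieskorn 2 2 2) (hz₀ : z₀.1 = 0) :
    ¬ IsSmoothPoint 2 (Brieskorn.HolAt 2 2 2) z₀ := by
  rintro ⟨e, hx, he⟩
  have hy := e.map_source hx
  have hG : ∀ i : Fin 2, ∃ G : (Fin 3 → ℂ) → ℂ, AnalyticAt ℂ G z₀.1 ∧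
      ∀ᶠ z in 𝓝 z₀, e z i = G z.1 := fun i =>
    (he z₀ hx fun y => y i).1 (analyticAt_of_contDiff (contDiff_coord i) _)
  have hZ : ∀ j : Fin 3, AnalyticAt ℂ (fun y => (e.symm y).1 j) (e z₀) := by
    intro j
    refine (he z₀ hx fun y => (e.symm y).1 j).2 ⟨fun z => z j, analyticAt_of_contDiff (by fun_prop) _, ?_⟩
    filter_upwards [e.open_source.mem_nhds hx] with z hz
    simp [e.left_inv hz]
  choose G hGa hGe using hG
  let Z' : Fin 3 → EuclideanSpace ℂ (Fin 2) →L[ℂ] ℂ :=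
    fun j => fderiv ℂ (fun y => (e.symm y).1 j) (e z₀)
  have hZ' : ∀ j, HasFDerivAt (fun y => (e.symm y).1 j) (Z' j) (e z₀) := fun j =>
    (hZ j).differentiableAt.hasFDerivAt
  have hZpi : HasFDerivAt (fun y => (e.symm y).1) (ContinuousLinearMap.pi Z') (e z₀) :=
    hasFDerivAt_pi.2 hZ'
  have hez : e.symm (e z₀) = z₀ := e.left_inv hx
  -- The chart coordinates are restrictions of analytic functions `G i` on `ℂ³`; composing them with
  -- the inverse gives the identity, and the chain rule yields injectivity.
  have hinj : ∀ w, (∀ j, Z' j w = 0) → w = 0 := by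
    intro w hw
    ext i
    have h1 : HasFDerivAt (G i) (fderiv ℂ (G i) z₀.1) ((e.symm (e z₀)).1) := by
      rw [hez]
      exact (hGa i).differentiableAt.hasFDerivAt
    have h2 := h1.comp (e z₀) hZpi
    have h3 : (fun y : EuclideanSpace ℂ (Fin 2) => y i) =ᶠ[𝓝 (e z₀)]
        G i ∘ fun y => (e.symm y).1 := by
      have hc : ContinuousAt e.symm (e z₀) := e.continuousAt_symm hy
      have h4 := hGe i
      rw [← hez] at h4
      filter_upwards [hc.eventually h4, e.open_target.mem_nhds hy] with y h5 h6
      rw [e.right_inv h6] at h5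
      exact h5
    have h4 := h2.congr_of_eventuallyEq h3
    have h5 : HasFDerivAt (fun y : EuclideanSpace ℂ (Fin 2) => y i)
        (EuclideanSpace.proj i : EuclideanSpace ℂ (Fin 2) →L[ℂ] ℂ) (e z₀) :=
      (EuclideanSpace.proj i : EuclideanSpace ℂ (Fin 2) →L[ℂ] ℂ).hasFDerivAt
    have h6 := congrArg (fun L : EuclideanSpace ℂ (Fin 2) →L[ℂ] ℂ => L w) (h5.unique h4)
    have h7 : ContinuousLinearMap.pi Z' w = 0 := funext hw
    simpa [h7] using h6
  -- The cone equation along the line `e z₀ + t • w`, divided by `t ^ 2`, passes to the limit `t →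
  -- 0` since the curve starts at the vertex.
  have hiso : ∀ w, Z' 0 w ^ 2 + Z' 1 w ^ 2 + Z' 2 w ^ 2 = 0 := by
    intro w
    have hline : ∀ j, HasDerivAt (fun t : ℂ => (e.symm (e z₀ + t • w)).1 j) (Z' j w) 0 := by
      intro j
      have h1 : HasDerivAt (fun t : ℂ => e z₀ + t • w) w 0 := by
        simpa using ((hasDerivAt_id (0 : ℂ)).smul_const w).const_add (e z₀)
      have h2 : HasFDerivAt (fun y => (e.symm y).1 j) (Z' j) (e z₀ + (0 : ℂ) • w) := by
        simpa using hZ' j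
      exact h2.comp_hasDerivAt (0 : ℂ) h1
    have hslope : ∀ j, Filter.Tendsto (fun t : ℂ => t⁻¹ * (e.symm (e z₀ + t • w)).1 j) (𝓝[≠] 0)
        (𝓝 (Z' j w)) := by
      intro j
      have h1 := (hline j).tendsto_slope_zero
      simpa [hez, hz₀] using h1
    have hlim := (((hslope 0).pow 2).add ((hslope 1).pow 2)).add ((hslope 2).pow 2)
    refine tendsto_nhds_unique hlim ?_
    refine tendsto_const_nhds.congr fun t => ?_
    have := (e.symm (e z₀ + t • w)).2
    linear_combination -(t⁻¹ ^ 2) * this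
  have e0 := hiso (EuclideanSpace.single 0 1)
  have e1 := hiso (EuclideanSpace.single 1 1)
  have e2 := hiso (EuclideanSpace.single 0 1 + EuclideanSpace.single 1 1)
  simp only [map_add] at e2
  obtain ⟨a, b, hab, hrel⟩ := exists_relation_of_isotropic
    (A := fun j => Z' j (EuclideanSpace.single 0 1)) (B := fun j => Z' j (EuclideanSpace.single 1 1))
    e0 e1 (by linear_combination (1 / 2 : ℂ) * e2 - (1 / 2 : ℂ) * e0 - (1 / 2 : ℂ) * e1)
  have hw := hinj (a • EuclideanSpace.single 0 1 + b • EuclideanSpace.single 1 1) fun j => by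
    simpa using hrel j
  have w0 := congrArg (fun v : EuclideanSpace ℂ (Fin 2) => v 0) hw
  have w1 := congrArg (fun v : EuclideanSpace ℂ (Fin 2) => v 1) hw
  simp at w0 w1
  rcases hab with h | h
  · exact h w0
  · exact h w1

/-! ### The moduli space of fixed point marked maps as a quotient -/

/-- The map of moduli spaces forgetting the marking of the critical points. -/
def forgetM : M2tm → M2fm :=
  Quotient.map forget (by
    rintro _ x ⟨g, rfl⟩
    exact ⟨g, rfl⟩)

lemma forgetM_toModuli (x : Rat2tm) : forgetM x.toModuli = (forget x).toModuli := rfl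

lemma surjective_forgetM : Function.Surjective forgetM := by
  intro m
  obtain ⟨y, rfl⟩ := isOpenQuotientMap_toModuli_fm.surjective m
  obtain ⟨x, rfl⟩ := surjective_forget y
  exact ⟨x.toModuli, rfl⟩

lemma continuous_forgetM : Continuous forgetM :=
  isOpenQuotientMap_toModuli_tm.isQuotientMap.continuous_iff.2
    (isOpenQuotientMap_toModuli_fm.continuous.comp continuous_forget)

lemma isOpenMap_forgetM : IsOpenMap forgetM := by
  intro U hU
  have : forgetM '' U = Rat2fm.toModuli '' (forget '' (Rat2tm.toModuli ⁻¹' U)) := by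
    ext m
    constructor
    · rintro ⟨n, hn, rfl⟩
      obtain ⟨x, rfl⟩ := isOpenQuotientMap_toModuli_tm.surjective n
      exact ⟨_, ⟨x, hn, rfl⟩, rfl⟩
    · rintro ⟨_, ⟨x, hx, rfl⟩, rfl⟩
      exact ⟨x.toModuli, hx, rfl⟩
  rw [this]
  exact isOpenQuotientMap_toModuli_fm.isOpenMap _
    (isOpenMap_forget _ (hU.preimage isOpenQuotientMap_toModuli_tm.continuous))

lemma isOpenQuotientMap_forgetM : IsOpenQuotientMap forgetM :=
  ⟨surjective_forgetM, continuous_forgetM, isOpenMap_forgetM⟩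

lemma m2fm_holAt_congr (g g' : M2fm → ℂ) (m : M2fm) (h : g =ᶠ[𝓝 m] g') (hg : M2fm.HolAt g m) :
    M2fm.HolAt g' m :=
  holByLifts_quotient.1 ((holByLifts_quotient.2 hg).congr
    (isLiftSystem_fm.quotient isOpenQuotientMap_toModuli_fm) h)

lemma exists_toModuli_eq {x : Rat2fm} {m : M2tm} (h : x.toModuli = forgetM m) :
    ∃ y : Rat2tm, forget y = x ∧ y.toModuli = m := by
  obtain ⟨y, rfl⟩ := isOpenQuotientMap_toModuli_tm.surjective m
  rw [forgetM_toModuli] at h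
  obtain ⟨g, hg⟩ := toModuli_fm_eq_iff.1 h
  exact ⟨g • y, hg, toModuli_eq_iff.2 ⟨g, rfl⟩⟩

/-- Both structures are tested on marked maps, where `forget` is locally biholomorphic; so this
holds even where `forgetM` is not locally injective. -/
lemma holAt_forgetM_iff (g : M2fm → ℂ) (m : M2tm) :
    M2fm.HolAt g (forgetM m) ↔ M2tm.HolAt (g ∘ forgetM) m := by
  constructor
  · rintro h x rfl
    exact (holAt_forget_iff (g ∘ Rat2fm.toModuli) x).1 (h (forget x) rfl)
  · intro h x hx
    obtain ⟨y, rfl, rfl⟩ := exists_toModuli_eq hx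
    exact (holAt_forget_iff (g ∘ Rat2fm.toModuli) y).2 (h y rfl)

lemma exists_neg_ratio (m : M2tm) : ∃ m' : M2tm, forgetM m' = forgetM m ∧ m'.ratio = -m.ratio := by
  obtain ⟨x, rfl⟩ := isOpenQuotientMap_toModuli_tm.surjective m
  refine ⟨((Equiv.swap 0 1 : Equiv.Perm (Fin 2)) • x).toModuli, rfl, ?_⟩
  funext i j
  exact ratio_perm_swap x i j

lemma forgetM_eq_iff {m m' : M2tm} :
    forgetM m = forgetM m' ↔ m.ratio = m'.ratio ∨ m.ratio = -m'.ratio := by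
  constructor
  · intro h
    obtain ⟨x, rfl⟩ := isOpenQuotientMap_toModuli_tm.surjective m
    obtain ⟨y, hy, rfl⟩ := exists_toModuli_eq (x := forget x) (m := m') h
    obtain ⟨σ, rfl⟩ := forget_eq_iff.1 hy
    rcases perm_eq σ with rfl | rfl
    · exact Or.inl (by rw [one_smul])
    · right
      funext i j
      have := ratio_perm_swap x i j
      simp only [Pi.neg_apply, ratio_toModuli, this, neg_neg]
  · rintro (h | h)
    · rw [injective_m2tm_ratio h]
    · obtain ⟨n, hn, hn'⟩ := exists_neg_ratio m'
      rw [← hn, injective_m2tm_ratio (h.trans hn'.symm)]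

lemma continuous_ratio_apply (i j : Fin 3) : Continuous fun m : M2tm => m.ratio i j := by
  by_cases hij : i = j
  · subst hij
    simp only [M2tm.ratio_self]
    exact continuous_const
  · exact continuous_ratio hij

/-- The products of two ratios, as functions on the moduli space of fixed point marked maps. -/
def M2fm.ratioMul (m : M2fm) (i j k l : Fin 3) : ℂ :=
  (Function.surjInv surjective_forgetM m).ratio i j *
    (Function.surjInv surjective_forgetM m).ratio k l

lemma ratioMul_forgetM (m : M2tm) (i j k l : Fin 3) :
    (forgetM m).ratioMul i j k l = m.ratio i j * m.ratio k l := by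
  unfold M2fm.ratioMul
  rcases forgetM_eq_iff.1 (Function.surjInv_eq surjective_forgetM (forgetM m)) with h | h <;>
    simp [h]

/-- One index with `s p ≠ 0` fixes the sign, and the products with that entry propagate it. Hence
products of two ratios separate the points of the sign quotient, which makes it Hausdorff. -/
lemma eq_or_eq_neg_of_mul_eq {ι : Type} {r s : ι → ℂ} (h : ∀ i j, r i * r j = s i * s j) :
    r = s ∨ r = -s := by
  by_cases hs : ∀ i, s i = 0
  · left
    funext i
    have := h i i
    rw [hs i, mul_zero, mul_self_eq_zero] at this
    rw [this, hs i]
  · push Not at hs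
    obtain ⟨p, hp⟩ := hs
    rcases mul_self_eq_mul_self_iff.1 (h p p) with h' | h'
    · left
      funext i
      refine mul_right_cancel₀ hp ?_
      rw [← h i p, h']
    · right
      funext i
      refine mul_right_cancel₀ (neg_ne_zero.2 hp) ?_
      rw [Pi.neg_apply, neg_mul_neg, ← h i p, h']

lemma injective_ratioMul : Function.Injective M2fm.ratioMul := by
  intro m m' h
  obtain ⟨n, rfl⟩ := surjective_forgetM m
  obtain ⟨n', rfl⟩ := surjective_forgetM m'
  have hmul : ∀ p q : Fin 3 × Fin 3, n.ratio p.1 p.2 * n.ratio q.1 q.2 =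
      n'.ratio p.1 p.2 * n'.ratio q.1 q.2 := by
    intro p q
    rw [← ratioMul_forgetM, ← ratioMul_forgetM, h]
  refine forgetM_eq_iff.2 ?_
  rcases eq_or_eq_neg_of_mul_eq (r := fun p : Fin 3 × Fin 3 => n.ratio p.1 p.2)
    (s := fun p : Fin 3 × Fin 3 => n'.ratio p.1 p.2) hmul with h' | h'
  · exact Or.inl (funext fun i => funext fun j => congrFun h' (i, j))
  · exact Or.inr (funext fun i => funext fun j => congrFun h' (i, j))

instance : T2Space M2fm := by
  refine T2Space.of_injective_continuous injective_ratioMul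
    (continuous_pi fun i => continuous_pi fun j => continuous_pi fun k => continuous_pi fun l => ?_)
  refine isOpenQuotientMap_forgetM.isQuotientMap.continuous_iff.2 ?_
  refine ((continuous_ratio_apply i j).mul (continuous_ratio_apply k l)).congr fun m => ?_
  exact (ratioMul_forgetM m i j k l).symm

instance : SecondCountableTopology M2fm := ContinuousConstSMul.secondCountableTopology

lemma forgetM_eq_tripleFixed_iff {m : M2tm} :
    forgetM m = Rat2fm.toModuli tripleFixed ↔ m.ratio = 0 := by
  have hzero : ∀ {n : M2tm}, Rat2fm.toModuli tripleFixed = forgetM n → n.ratio = 0 := by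
    intro n h
    obtain ⟨y, hy, rfl⟩ := exists_toModuli_eq h
    funext i j
    exact ratio_eq_zero_of_forget_eq hy i j
  refine ⟨fun h => hzero h.symm, fun h => ?_⟩
  obtain ⟨n, hn⟩ := surjective_forgetM (Rat2fm.toModuli tripleFixed)
  rw [← hn]
  exact forgetM_eq_iff.2 (Or.inl (h.trans (hzero hn.symm).symm))

/-! ### Charts of the moduli space of fixed point marked maps -/

lemma exists_openPartialHomeomorph {X Y : Type} [TopologicalSpace X] [TopologicalSpace Y]
    [Nonempty X] {f : X → Y} {S : Set X} (hS : IsOpen S) (hf : ContinuousOn f S)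
    (hinj : Set.InjOn f S) (hopen : ∀ U ⊆ S, IsOpen U → IsOpen (f '' U)) :
    ∃ e : OpenPartialHomeomorph X Y, e.source = S ∧ (e : X → Y) = f := by
  refine ⟨OpenPartialHomeomorph.ofContinuousOpenRestrict hinj.toPartialEquiv hf ?_ hS, rfl, rfl⟩
  intro U hU
  have h1 : IsOpen (Subtype.val '' U) := hS.isOpenMap_subtype_val U hU
  have h2 := hopen (Subtype.val '' U) (by rintro _ ⟨x, -, rfl⟩; exact x.2) h1
  rwa [Set.image_image] at h2

lemma isSmoothPoint_m2fm {m : M2tm} (hm : m.ratio ≠ 0) :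
    IsSmoothPoint 2 M2fm.HolAt (forgetM m) := by
  obtain ⟨i, hi⟩ := Function.ne_iff.1 hm
  obtain ⟨j, hij⟩ := Function.ne_iff.1 hi
  have : Nonempty M2tm := ⟨m⟩
  -- A ball about a nonzero number with radius its norm contains no pair of opposite numbers, so
  -- `forgetM` is injective here.
  let S : Set M2tm := (fun n => n.ratio i j) ⁻¹' Metric.ball (m.ratio i j) ‖m.ratio i j‖
  have hS : IsOpen S := Metric.isOpen_ball.preimage (continuous_ratio_apply i j)
  have hmS : m ∈ S := Metric.mem_ball_self (norm_pos_iff.2 hij)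
  have hinj : Set.InjOn forgetM S := by
    intro a ha b hb hab
    rcases forgetM_eq_iff.1 hab with h | h
    · exact injective_m2tm_ratio h
    · exfalso
      have ha' : ‖a.ratio i j - m.ratio i j‖ < ‖m.ratio i j‖ := mem_ball_iff_norm.1 ha
      have hb' : ‖b.ratio i j - m.ratio i j‖ < ‖m.ratio i j‖ := mem_ball_iff_norm.1 hb
      rw [h, Pi.neg_apply, Pi.neg_apply] at ha'
      have h2 := norm_add_le (-b.ratio i j - m.ratio i j) (b.ratio i j - m.ratio i j)
      rw [show -b.ratio i j - m.ratio i j + (b.ratio i j - m.ratio i j) = -2 * m.ratio i j by ring,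
        norm_mul, norm_neg, Complex.norm_ofNat] at h2
      linarith
  obtain ⟨e, he, hef⟩ := exists_openPartialHomeomorph hS continuous_forgetM.continuousOn hinj
    fun U _ hU => isOpenMap_forgetM U hU
  have hbi : IsBiholomorphic M2tm.HolAt M2fm.HolAt e := by
    intro x _ g
    rw [hef]
    exact holAt_forgetM_iff g x
  have hme : m ∈ e.source := he ▸ hmS
  refine IsSmoothPoint.of_biholomorphic (hbi.symm m2tm_holAt_congr) ?_ ?_
  · rw [← hef]
    exact e.map_source hme
  · exact isSmoothPoint_m2tm _

/-- The coordinates on the moduli space of totally marked maps near the class of `z + 1/z`. -/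
def ratioPair (m : M2tm) : EuclideanSpace ℂ (Fin 2) := !₂[m.ratio 0 1, m.ratio 0 2]

/-- The map from the moduli space of fixed point marked maps to the quadratic cone. -/
def toCone (m : M2fm) : Brieskorn 2 2 2 :=
  coneMap (ratioPair (Function.surjInv surjective_forgetM m))

lemma ratioPair_eq_neg {m m' : M2tm} (h : m.ratio = -m'.ratio) : ratioPair m = -ratioPair m' := by
  ext i
  fin_cases i <;> simp [ratioPair, h]

lemma toCone_forgetM (m : M2tm) : toCone (forgetM m) = coneMap (ratioPair m) := by
  unfold toCone
  rcases forgetM_eq_iff.1 (Function.surjInv_eq surjective_forgetM (forgetM m)) with h | h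
  · rw [injective_m2tm_ratio h]
  · rw [ratioPair_eq_neg h, coneMap_neg]

/-- The two ratios at index `0` form a chart upstairs in which identification under `forgetM` is `v
↦ -v`; dividing by this sign is exactly what `coneMap` does, for points, topology and holomorphic
functions. -/
theorem exists_chart_m2fm :
    ∃ e : OpenPartialHomeomorph M2fm (Brieskorn 2 2 2),
      Rat2fm.toModuli tripleFixed ∈ e.source ∧ (e (Rat2fm.toModuli tripleFixed)).1 = 0 ∧
      IsBiholomorphic M2fm.HolAt (Brieskorn.HolAt 2 2 2) e := by
  obtain ⟨χ, hsource, -, hχ, hbi⟩ := exists_chart_m2tm 0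
  replace hχ : (χ : M2tm → EuclideanSpace ℂ (Fin 2)) = ratioPair := hχ
  replace hsource : χ.source = {m | m.ratio 0 1 * m.ratio 0 2 ≠ 1} := hsource
  -- The condition defining the chart upstairs is a product of two ratios, so it is unaffected by
  -- the sign and descends.
  let S : Set M2fm := {m | m.ratioMul 0 1 0 2 ≠ 1}
  have hmem : ∀ m : M2tm, forgetM m ∈ S ↔ m ∈ χ.source := by
    intro m
    rw [hsource]
    simp only [S, Set.mem_ofPred_eq, ratioMul_forgetM]
  have hpre : forgetM ⁻¹' S = χ.source := Set.ext hmem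
  have hS : IsOpen S := by
    rw [← isOpenQuotientMap_forgetM.isQuotientMap.isOpen_preimage, hpre]
    exact χ.open_source
  have hcomp : toCone ∘ forgetM = coneMap ∘ ratioPair := funext toCone_forgetM
  have hcont : ContinuousOn toCone S := by
    intro m hm
    obtain ⟨n, rfl⟩ := surjective_forgetM m
    refine ContinuousAt.continuousWithinAt ?_
    have h1 : ContinuousAt (toCone ∘ forgetM) n := by
      rw [hcomp, ← hχ]
      exact continuous_coneMap.continuousAt.comp (χ.continuousAt ((hmem n).1 hm))
    rw [ContinuousAt, ← isOpenQuotientMap_forgetM.map_nhds_eq, Filter.tendsto_map'_iff]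
    exact h1
  have hinj : Set.InjOn toCone S := by
    intro a ha b hb hab
    obtain ⟨a, rfl⟩ := surjective_forgetM a
    obtain ⟨b, rfl⟩ := surjective_forgetM b
    rw [toCone_forgetM, toCone_forgetM, coneMap_eq_iff] at hab
    rcases hab with h | h
    · rw [← hχ] at h
      rw [χ.injOn ((hmem a).1 ha) ((hmem b).1 hb) h]
    · obtain ⟨b', hb', hr⟩ := exists_neg_ratio b
      rw [← ratioPair_eq_neg hr, ← hχ] at h
      rw [← hb'] at hb ⊢
      rw [χ.injOn ((hmem a).1 ha) ((hmem b').1 hb) h]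
  have hopen : ∀ U ⊆ S, IsOpen U → IsOpen (toCone '' U) := by
    intro U hUS hU
    have h1 : toCone '' U = coneMap '' (χ '' (forgetM ⁻¹' U)) := by
      rw [hχ, ← Set.image_comp, ← hcomp, Set.image_comp,
        Set.image_preimage_eq _ surjective_forgetM]
    rw [h1]
    refine isOpenMap_coneMap _ (χ.isOpen_image_of_subset_source (hU.preimage continuous_forgetM) ?_)
    exact fun n hn => (hmem n).1 (hUS hn)
  have : Nonempty M2fm := ⟨Rat2fm.toModuli tripleFixed⟩
  obtain ⟨n, hn⟩ := surjective_forgetM (Rat2fm.toModuli tripleFixed)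
  have hn0 := forgetM_eq_tripleFixed_iff.1 hn
  obtain ⟨e, he, hef⟩ := exists_openPartialHomeomorph hS hcont hinj hopen
  refine ⟨e, ?_, ?_, ?_⟩
  · rw [he, ← hn, hmem, hsource]
    simp [hn0]
  · rw [hef, ← hn, toCone_forgetM]
    funext i
    fin_cases i <;> simp [coneMap, ratioPair, hn0]
  · intro m hm g
    rw [he] at hm
    obtain ⟨k, rfl⟩ := surjective_forgetM m
    rw [hef, toCone_forgetM, cone_holAt_iff, holAt_forgetM_iff, Function.comp_assoc, hcomp, ← hχ]
    exact hbi k ((hmem k).1 hm) (g ∘ coneMap)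

theorem not_isSmoothPoint_m2fm_iff (m : M2fm) :
    ¬ IsSmoothPoint 2 M2fm.HolAt m ↔ m = Rat2fm.toModuli tripleFixed := by
  constructor
  · intro h
    obtain ⟨n, rfl⟩ := surjective_forgetM m
    by_contra hne
    exact h (isSmoothPoint_m2fm fun h0 => hne (forgetM_eq_tripleFixed_iff.2 h0))
  · rintro rfl h
    obtain ⟨e, hx, h0, he⟩ := exists_chart_m2fm
    refine not_isSmoothPoint_cone _ h0 (IsSmoothPoint.of_biholomorphic
      (he.symm m2fm_holAt_congr) (e.map_source hx) ?_)
    rwa [e.left_inv hx]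

end QuadRat

end

open QuadRat

theorem lemma6p6 :
    -- the two spaces of marked maps
    IsComplexManifold 5 Rat2fm.HolAt ∧
    IsComplexManifold 5 Rat2tm.HolAt ∧
    IsUnramifiedCover 2 Rat2tm.HolAt Rat2fm.HolAt forget ∧
    -- the action on totally marked maps is free, and the quotient is a complex surface
    (∀ (g : Rat1) (x : Rat2tm), g • x = x → g = 1) ∧
    IsComplexManifold 2 M2tm.HolAt ∧
    -- the orbit of `z + 1/z` is the only non-free orbit on fixed point marked maps
    (∀ x : Rat2fm, (∃ g : Rat1, g ≠ 1 ∧ g • x = x) ↔ x ∈ MulAction.orbit Rat1 tripleFixed) ∧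
    -- its class is the only singular point of the moduli space, and is of type (2,2,2)
    T2Space M2fm ∧ SecondCountableTopology M2fm ∧
    (∀ m : M2fm, ¬ IsSmoothPoint 2 M2fm.HolAt m ↔ m = Rat2fm.toModuli tripleFixed) ∧
    HasSingularityType 2 2 2 M2fm.HolAt (Rat2fm.toModuli tripleFixed) := by
  exact ⟨isComplexManifold_fm, isComplexManifold_tm, isUnramifiedCover_forget, free_tm,
    isComplexManifold_m2tm, nonfree_fm_iff, inferInstance, inferInstance,
    not_isSmoothPoint_m2fm_iff, exists_chart_m2fm⟩
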